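/- Let $k$ be a field that is complete with respect to a normalized (surjective) discrete valuation $v:k^\times\to\mathbb Z$. Let $q\in k^\times$ with $v(q)>0$, and let $E_q=\mathbb G_m/q^{\mathbb Z}$ be the Tate curve with parameter $q$, that is, the elliptic curve $y^2+xy=x^3+a_4(q)x+a_6(q)$ with $$a_4(q)=-5\sum_{n\ge1}\frac{n^3q^n}{1-q^n},\qquad a_6(q)=-\sum_{n\ge1}\frac{5n^3+7n^5}{12}\cdot\frac{q^n}{1-q^n}.$$ For $a\in k^\times$ let $[a]\in E_q(k)$ be the point corresponding to $a$ under the uniformization $k^\times/q^{\mathbb Z}\cong E_q(k)$: $[a]=O$ if $a\in q^{\mathbb Z}$, and otherwise $$[a]=\Big(\sum_{n\in\mathbb Z}\frac{q^na}{(1-q^na)^2}-2\sum_{n\ge1}\frac{nq^n}{1-q^n},\ \ \sum_{n\in\mathbb Z}\frac{(q^na)^2}{(1-q^na)^3}+\sum_{n\ge1}\frac{nq^n}{1-q^n}\Big).$$ For an elliptic curve $E$ over $k$ with identity $O$, let $\langle\cdot,\cdot\rangle:E(k)_{\mathrm{tors}}\times E(k)_{\mathrm{tors}}\to k^\times\otimes\mathbb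 Q/\mathbb Z$ be the pairing $\langle P,Q\rangle=\langle [P]-[O],[Q]-[O]\rangle$, where for divisors $D$ with torsion class and $D'=\sum_j e_jQ_j$ of degree $0$ one puts $$\langle D,D'\rangle=\prod_j N_{k(Q_j)/k}\big(\mathrm{lc}_{Q_j}(f,n)\big)^{e_j},\qquad \mathrm{lc}_{Q}(f,n)=\Big(\frac{f}{\pi_Q^{\mathrm{ord}_Q(f)}}\Big)(Q)\otimes\frac1n\in k(Q)^\times\otimes\mathbb Q/\mathbb Z,$$ for any $n>0$ and $f\in k(E)^\times$ with $\mathrm{div}(f)=nD$ and any uniformizer $\pi_Q$ at $Q$ (the group law of $k^\times\otimes\mathbb Q/\mathbb Z$ is written multiplicatively in the product; the result does not depend on the choices). The intrinsic subgroup is $$E(k)_{\mathrm{tors}}^{\mathrm{is}}=\{P\in E(k)_{\mathrm{tors}}\mid \langle P,Q\rangle=0\text{ for all }Q\in E(k)_{\mathrm{tors}}\}.$$ For every $m>0$, if $a\in k^\times$ and $[a]\in E_q(k)[m]$, then $a^m=q^s$ for some $s\in\mathbb Z$, and $s_m([a]):=s\bmod m$ is a well-defined map $s_m:E_q(k)[m]\to\mathbb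 Z/m\mathbb Z$. Moreover: 1. For all $m>0$ and $a,b\in k^\times$ with $[a],[b]\in E_q(k)[m]$, $$\langle[a],[b]\rangle=a^{-s_m([b])}\otimes\frac1m=b^{-s_m([a])}\otimes\frac1m=q^{-s_m([a])s_m([b])}\otimes\frac1{m^2},$$ where $s_m([a])$ and $s_m([b])$ may be replaced by arbitrary integers representing these classes. 2. $E_q(k)_{\mathrm{tors}}^{\mathrm{is}}=\{[\zeta]\mid\zeta\in\mu(k)\}$, where $\mu(k)$ is the group of all roots of unity in $k$. -/

import Mathlib

open scoped TensorProduct WithZero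

/-! ### The group of values -/

/-- The group `ℚ/ℤ`. -/
abbrev QModZ : Type := ℚ ⧸ AddSubgroup.zmultiples (1 : ℚ)

/-- The group `K^× ⊗ ℚ/ℤ`, written additively. -/
abbrev UnitsTensorQZ (K : Type*) [Field K] : Type _ := Additive Kˣ ⊗[ℤ] QModZ

/-- The element `x ⊗ (1/n)` of `K^× ⊗ ℚ/ℤ`. -/
noncomputable def unitTmul {K : Type*} [Field K] (x : Kˣ) (n : ℕ) : UnitsTensorQZ K :=
  Additive.ofMul x ⊗ₜ[ℤ] (QuotientAddGroup.mk (1 / (n : ℚ)) : QModZ)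

/-! ### Smooth projective curves, through their function fields

A smooth projective curve `X` over `k` is recovered from its function field `F / k`:
its closed points are the discrete valuation rings of `F` that contain `k`. -/

/-- A closed point of the smooth projective curve over `k` with function field `F`,
given by its local ring. -/
structure CurvePoint (k F : Type*) [Field k] [Field F] [Algebra k F] where
  /-- the local ring of the curve at the point -/
  ring : ValuationSubring F
  algebraMap_mem : ∀ c : k, algebraMap k F c ∈ ring
  isDVR : IsDiscreteValuationRing ring

namespace CurvePoint

variable {k F : Type*} [Field k] [Field F] [Algebra k F]

instance (Q : CurvePoint k F) : IsDiscreteValuationRing Q.ring := Q.isDVR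

/-- The residue field `k(Q)`. -/
abbrev residueField (Q : CurvePoint k F) : Type _ := IsLocalRing.ResidueField Q.ring

/-- The inclusion of `k` in the local ring at `Q`. -/
def constants (Q : CurvePoint k F) : k →+* Q.ring :=
  (algebraMap k F).codRestrict Q.ring.toSubring Q.algebraMap_mem

noncomputable instance (Q : CurvePoint k F) : Algebra k Q.residueField :=
  ((IsLocalRing.residue Q.ring).comp Q.constants).toAlgebra

/-- The order of vanishing at `Q` of a rational function. -/
noncomputable def ord (Q : CurvePoint k F) (f : Fˣ) : ℤ :=
  -WithZero.log ((IsDiscreteValuationRing.maximalIdeal Q.ring).valuation F (f : F))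

theorem valuation_irreducible (Q : CurvePoint k F) {π : Q.ring} (hπ : Irreducible π) :
    (IsDiscreteValuationRing.maximalIdeal Q.ring).valuation F (π : F) =
      WithZero.exp (-1 : ℤ) := by
  have h := IsDedekindDomain.HeightOneSpectrum.valuation_of_algebraMap (K := F)
    (IsDiscreteValuationRing.maximalIdeal Q.ring) π
  have h2 := IsDedekindDomain.HeightOneSpectrum.intValuation_singleton
    (IsDiscreteValuationRing.maximalIdeal Q.ring) hπ.ne_zero hπ.maximalIdeal_eq
  exact h.trans h2

/-- `f / π ^ ord_Q(f)` is a unit of the local ring at `Q`, for every uniformizer `π`. -/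
theorem exists_unit (Q : CurvePoint k F) {π : Q.ring} (hπ : Irreducible π) (f : Fˣ) :
    ∃ u : Q.ringˣ, ((u : Q.ring) : F) = (f : F) / (π : F) ^ Q.ord f := by
  have hf : (IsDiscreteValuationRing.maximalIdeal Q.ring).valuation F (f : F) ≠ 0 :=
    (Valuation.ne_zero_iff _).2 f.ne_zero
  have hv : (IsDiscreteValuationRing.maximalIdeal Q.ring).valuation F
      ((f : F) / (π : F) ^ Q.ord f) = 1 := by
    rw [map_div₀, map_zpow₀, Q.valuation_irreducible hπ, ← WithZero.exp_zsmul, ord]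
    simp only [smul_eq_mul, mul_neg, mul_one, neg_neg]
    rw [WithZero.exp_log hf, div_self hf]
  obtain ⟨x, hx⟩ := IsDiscreteValuationRing.exists_lift_of_le_one hv.le
  obtain ⟨y, hy⟩ := IsDiscreteValuationRing.exists_lift_of_le_one
    (show (IsDiscreteValuationRing.maximalIdeal Q.ring).valuation F
      ((f : F) / (π : F) ^ Q.ord f)⁻¹ ≤ 1 by rw [map_inv₀, hv, inv_one])
  have h0 : (f : F) / (π : F) ^ Q.ord f ≠ 0 := fun h => by simp [h] at hv
  have hxy : x * y = 1 := by
    apply IsFractionRing.injective Q.ring F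
    rw [map_mul, hx, hy, mul_inv_cancel₀ h0, map_one]
  exact ⟨Units.mkOfMulEqOne x y hxy, hx⟩

/-- A uniformizer at `Q`. -/
noncomputable def uniformizer (Q : CurvePoint k F) : Q.ring :=
  (IsDiscreteValuationRing.exists_irreducible Q.ring).choose

theorem uniformizer_irreducible (Q : CurvePoint k F) : Irreducible Q.uniformizer :=
  (IsDiscreteValuationRing.exists_irreducible Q.ring).choose_spec

/-- The value `(f / π ^ ord_Q(f))(Q)` in `k(Q)^×`. -/
noncomputable def leadingValue (Q : CurvePoint k F) (f : Fˣ) : Q.residueFieldˣ :=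
  Units.map (IsLocalRing.residue Q.ring).toMonoidHom
    (Q.exists_unit Q.uniformizer_irreducible f).choose

/-- The leading coefficient `lc_Q(f, n) = (f / π ^ ord_Q(f))(Q) ⊗ (1/n)`
in `k(Q)^× ⊗ ℚ/ℤ`; it does not depend on `π` if `n` divides `ord_Q(f)`. -/
noncomputable def lc (Q : CurvePoint k F) (f : Fˣ) (n : ℕ) : UnitsTensorQZ Q.residueField :=
  unitTmul (Q.leadingValue f) n

/-- The map `k(Q)^× ⊗ ℚ/ℤ → k^× ⊗ ℚ/ℤ` induced by the norm of `k(Q) / k`. -/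
noncomputable def norm (Q : CurvePoint k F) :
    UnitsTensorQZ Q.residueField →ₗ[ℤ] UnitsTensorQZ k :=
  LinearMap.rTensor QModZ (MonoidHom.toAdditive
    (Units.map (Algebra.norm k : Q.residueField →* k))).toIntLinearMap

end CurvePoint

/-- Divisors on the curve. -/
abbrev CurveDivisor (k F : Type*) [Field k] [Field F] [Algebra k F] : Type _ :=
  CurvePoint k F →₀ ℤ

open Classical in
/-- The pairing `⟨D, E⟩ = ∏_j N_{k(Q_j)/k}(lc_{Q_j}(f, n)) ^ e_j` (written additively)
of a divisor `D` whose class is torsion and a divisor `E = ∑_j e_j Q_j` of degree zero,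
where `n > 0` and `div(f) = n D`; for such `D` and `E` it does not depend on `n` and `f`.
By convention it is `0` if the class of `D` is not torsion. -/
noncomputable def divisorPairing {k F : Type*} [Field k] [Field F] [Algebra k F]
    (D E : CurveDivisor k F) : UnitsTensorQZ k :=
  if h : ∃ nf : ℕ × Fˣ, 0 < nf.1 ∧ ∀ Q : CurvePoint k F, Q.ord nf.2 = nf.1 * D Q then
    E.sum fun Q e => e • Q.norm (Q.lc h.choose.2 h.choose.1)
  else 0

/-! ### Elliptic curves -/

namespace WeierstrassCurve.Affine

open Polynomial

variable {k : Type*} [Field k]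

/-- The closed point `Q` of the projective curve `W` is the `k`-rational point `P`: the
coordinate function `x` has a pole at `Q` if `P = O`, and `x - x₀`, `y - y₀` both vanish
at `Q` if `P = (x₀, y₀)`. -/
def IsAt (W : Affine k) (Q : CurvePoint k W.FunctionField) : W.Point → Prop
  | .zero => algebraMap W.CoordinateRing W.FunctionField (CoordinateRing.mk W (C X)) ∉ Q.ring
  | .some x₀ y₀ _ =>
      algebraMap W.CoordinateRing W.FunctionField (CoordinateRing.XClass W x₀) ∈
        Q.ring.nonunits ∧
      algebraMap W.CoordinateRing W.FunctionField (CoordinateRing.YClass W (C y₀)) ∈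
        Q.ring.nonunits

open Classical in
/-- The prime divisor `[P]` of a `k`-rational point `P`; there is exactly one closed point
at `P`. -/
noncomputable def pointDivisor (W : Affine k) (P : W.Point) :
    CurveDivisor k W.FunctionField :=
  if h : ∃ Q, IsAt W Q P then Finsupp.single h.choose 1 else 0

/-- The pairing `⟨P, Q⟩ = ⟨[P] - [O], [Q] - [O]⟩` of torsion points. -/
noncomputable def torsionPairing (W : Affine k) (P Q : W.Point) : UnitsTensorQZ k :=
  divisorPairing (pointDivisor W P - pointDivisor W 0) (pointDivisor W Q - pointDivisor W 0)

/-- The intrinsic subgroup `E(k)_tors^is` (as a set): the torsion points that pair to zero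
with all torsion points. -/
def intrinsicSubgroup [DecidableEq k] (W : Affine k) : Set W.Point :=
  {P | IsOfFinAddOrder P ∧ ∀ Q : W.Point, IsOfFinAddOrder Q → torsionPairing W P Q = 0}

end WeierstrassCurve.Affine

/-! ### The Tate curve -/

namespace TateCurve

variable {k : Type*} [Field k] [TopologicalSpace k]

/-- `s_j(q) = ∑_{n ≥ 1} n ^ j q ^ n / (1 - q ^ n)`. -/
noncomputable def sumS (j : ℕ) (q : k) : k :=
  ∑' n : ℕ+, ((n : ℕ) : k) ^ j * q ^ (n : ℕ) / (1 - q ^ (n : ℕ))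

/-- The coefficient `a₄(q) = -5 s₃(q)`. -/
noncomputable def a₄ (q : k) : k := -5 * sumS 3 q

/-- The coefficient `a₆(q) = -(5 s₃(q) + 7 s₅(q)) / 12`, where the division by `12` is done
in the integral coefficients of the series (`12` divides `5 n ^ 3 + 7 n ^ 5`). -/
noncomputable def a₆ (q : k) : k :=
  -∑' n : ℕ+, (((5 * (n : ℕ) ^ 3 + 7 * (n : ℕ) ^ 5) / 12 : ℕ) : k) * q ^ (n : ℕ) /
    (1 - q ^ (n : ℕ))

/-- The Tate curve `E_q : y ^ 2 + x y = x ^ 3 + a₄(q) x + a₆(q)`. -/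
noncomputable def curve (q : kˣ) : WeierstrassCurve.Affine k :=
  { a₁ := 1, a₂ := 0, a₃ := 0, a₄ := a₄ (q : k), a₆ := a₆ (q : k) }

/-- `X(u, q) = ∑_{n ∈ ℤ} q ^ n u / (1 - q ^ n u) ^ 2 - 2 s₁(q)`. -/
noncomputable def xCoord (q u : kˣ) : k :=
  (∑' n : ℤ, (q : k) ^ n * u / (1 - (q : k) ^ n * u) ^ 2) - 2 * sumS 1 (q : k)

/-- `Y(u, q) = ∑_{n ∈ ℤ} (q ^ n u) ^ 2 / (1 - q ^ n u) ^ 3 + s₁(q)`. -/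
noncomputable def yCoord (q u : kˣ) : k :=
  (∑' n : ℤ, ((q : k) ^ n * u) ^ 2 / (1 - (q : k) ^ n * u) ^ 3) + sumS 1 (q : k)

open Classical in
/-- The point `[u]` of `E_q(k)` given by the uniformization `k^× / q^ℤ ≅ E_q(k)`: it is `O`
for `u ∈ q^ℤ` and `(X(u, q), Y(u, q))` otherwise. (The last branch is never reached when `k`
is a complete nonarchimedean field and `|q| < 1`.) -/
noncomputable def point (q u : kˣ) : (curve q).Point :=
  if u ∈ Subgroup.zpowers q then 0
  else if h : (curve q).Nonsingular (xCoord q u) (yCoord q u) then .some _ _ h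
  else 0

open Classical in
/-- The map `s_m : E_q(k)[m] → ℤ/m`, `[a] ↦ s mod m` where `a ^ m = q ^ s`
(extended by `0` to the other points). -/
noncomputable def sIndex (q : kˣ) (m : ℕ) (P : (curve q).Point) : ZMod m :=
  if h : ∃ s : ℤ, ∃ a : kˣ, point q a = P ∧ a ^ m = q ^ s then (h.choose : ZMod m) else 0

end TateCurve

/-! Everything is expressed through the theta function θ(u) = ∏_{n≥0} (1 - qⁿu) ∏_{n≥1} (1 - qⁿ/u),
which satisfies θ(qu) = -u⁻¹ θ(u), and its logarithmic derivative ζ = -u θ'/θ.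

The analytic part proves Tate's uniformization from the series. By the Jacobi triple product
(`theta_eq_thetaSeries`), θ(u/a) θ(uae) is a kernel of rank two in (u, a), so a 3×3 determinant
vanishes: this is the three term relation. Its derivative (`zetaSum_add`) writes ζ(x) + ζ(y) + ζ(z)
- ζ(xyz) + 1 as a theta quotient. The coordinate series are the next two Taylor coefficients of
ζ(u(1 + t)) at t = 0, whence X(x) - X(y) is a theta quotient and the chord through the points x, y
has slope ζ(x) + ζ(y) - ζ(xy). Multiplying the values of a line at v and at v⁻¹ places all points on
one cubic (`exists_cubic`). Laurent expansions at u = 1 show that it is the cubic of E_q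
(`cubic_unique`), and the vanishing of its X² coefficient is the addition theorem. Thus u ↦ [u] is a
homomorphism; contraction mappings show that it is surjective. All expansions have integral
coefficients, so no characteristic is excluded.

The algebraic part makes the pairing computable on a Weierstrass curve. There is exactly one closed
point at a rational point, its residue field is k, and every function has there a leading
coefficient in k with respect to a parameter. Functions without zeros and poles are constant, so the
pairing can be computed with any function that has the right divisor
(`CurvePoint.divisorPairing_eq`). The chord through P and P', divided by the vertical line through
their sum, has divisor [P] + [P'] - [P + P'] - [O].

For a^m = q^s a product of such chords has divisor m([a] - [O]). By the theta formula for the values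
of chords, its value at b telescopes, up to m-th powers, to a quotient of the values of θ(b/u)/θ(u)
at u = x and at u = a^m x = q^s x. Quasi-periodicity evaluates this to a^m b^(-s), and the leading
coefficient at O is 1, so ⟨[a],[b]⟩ = b^(-s) ⊗ 1/m.

For the intrinsic subgroup, the valuations of the parameters of torsion points form a subgroup of ℤ,
generated by the valuation of some b. If [a] pairs to zero with [b], then b^(-s) = ζ c^m with ζ a
root of unity, and c is again the parameter of a torsion point. Comparing valuations gives m ∣ s, so
a power of q times a is a root of unity. -/

set_option linter.unusedSectionVars false

namespace TateCurve

section Analytic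

open Filter Topology

variable {K : Type*} [NontriviallyNormedField K] [CompleteSpace K] [IsUltrametricDist K]

/-! ### The Euler product and the theta function -/

/-- The product `∏_{n ≥ 0} (1 - q ^ n x)`. -/
noncomputable def eulerProd (q x : K) : K := ∏' n : ℕ, (1 - q ^ n * x)

theorem summable_norm_pow_mul {q : K} (hq : ‖q‖ < 1) (x : K) :
    Summable fun n : ℕ => ‖-(q ^ n * x)‖ := by
  simpa [norm_mul, norm_pow] using (summable_geometric_of_lt_one (norm_nonneg q) hq).mul_right ‖x‖

theorem multipliable_euler {q : K} (hq : ‖q‖ < 1) (x : K) :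
    Multipliable fun n : ℕ => (1 - q ^ n * x) := by
  simpa [sub_eq_add_neg] using multipliable_one_add_of_summable (summable_norm_pow_mul hq x)

theorem tendsto_euler {q : K} (hq : ‖q‖ < 1) (x : K) :
    Tendsto (fun N => ∏ n ∈ Finset.range N, (1 - q ^ n * x)) atTop (𝓝 (eulerProd q x)) :=
  (multipliable_euler hq x).hasProd.tendsto_prod_nat

theorem eulerProd_eq {q : K} (hq : ‖q‖ < 1) (x : K) :
    eulerProd q x = (1 - x) * eulerProd q (q * x) := by
  have h1 := (tendsto_euler hq x).comp (tendsto_add_atTop_nat 1)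
  have h2 := (tendsto_euler hq (q * x)).const_mul (1 - x)
  refine tendsto_nhds_unique h1 (h2.congr fun N => ?_)
  simp only [Function.comp, Finset.prod_range_succ' _ N]
  rw [mul_comm]
  simp [pow_succ, mul_assoc]

theorem eulerProd_ne_zero {q : K} (hq : ‖q‖ < 1) {x : K} (hx : ∀ n : ℕ, q ^ n * x ≠ 1) :
    eulerProd q x ≠ 0 := by
  have := tprod_one_add_ne_zero_of_summable (f := fun n : ℕ => -(q ^ n * x))
    (fun n h => hx n (by linear_combination -h)) (summable_norm_pow_mul hq x)
  simpa [eulerProd, sub_eq_add_neg] using this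

theorem norm_sub_le_max' (x y : K) : ‖x - y‖ ≤ max ‖x‖ ‖y‖ := by
  simpa [sub_eq_add_neg] using IsUltrametricDist.norm_add_le_max x (-y)

/-- By the ultrametric inequality the quadratic remainder of the product is bounded independently of
the number of factors. The bound therefore survives the passage to the infinite product and yields
its derivative. -/
theorem norm_prod_one_sub_le {C : ℝ} (hC : 0 ≤ C) (σ : ℕ → K) (hσ : ∀ n, ‖σ n‖ ≤ C) (h : K)
    (hh : C * ‖h‖ ≤ 1) (N : ℕ) :
    ‖∏ n ∈ Finset.range N, (1 - h * σ n) - 1 + h * ∑ n ∈ Finset.range N, σ n‖ ≤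
      C ^ 2 * ‖h‖ ^ 2 := by
  induction N with
  | zero => simp; positivity
  | succ N ih =>
    have hS : ‖∑ n ∈ Finset.range N, σ n‖ ≤ C :=
      IsUltrametricDist.norm_sum_le_of_forall_le_of_nonneg hC fun i _ => hσ i
    have h1 : ‖1 - h * σ N‖ ≤ 1 := by
      refine (norm_sub_le_max' _ _).trans (max_le (by simp) ?_)
      rw [norm_mul, mul_comm]
      exact (mul_le_mul_of_nonneg_right (hσ N) (norm_nonneg _)).trans hh
    rw [Finset.prod_range_succ, Finset.sum_range_succ]
    set S := ∑ n ∈ Finset.range N, σ n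
    set T := ∏ n ∈ Finset.range N, (1 - h * σ n)
    have : T * (1 - h * σ N) - 1 + h * (S + σ N) =
        (T - 1 + h * S) * (1 - h * σ N) + h * h * (S * σ N) := by ring
    rw [this]
    refine (IsUltrametricDist.norm_add_le_max _ _).trans (max_le ?_ ?_)
    · rw [norm_mul]
      exact (mul_le_of_le_one_right (norm_nonneg _) h1).trans ih
    · simp only [norm_mul]
      nlinarith [mul_le_mul hS (hσ N) (norm_nonneg _) hC, sq_nonneg ‖h‖]

theorem summable_of_tendsto_zero {f : ℕ → K} (h : Tendsto f atTop (𝓝 0)) : Summable f := by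
  refine NonarchimedeanAddGroup.summable_of_tendsto_cofinite_zero ?_
  rwa [Nat.cofinite_eq_atTop]

theorem tendsto_pow_mul {q : K} (hq : ‖q‖ < 1) (x : K) :
    Tendsto (fun n : ℕ => q ^ n * x) atTop (𝓝 0) := by
  simpa using (tendsto_pow_atTop_nhds_zero_of_norm_lt_one hq).mul_const x

/-- The logarithmic derivative of the Euler product. -/
theorem hasDerivAt_eulerProd {q : K} (hq : ‖q‖ < 1) {x : K} (hx : ∀ n : ℕ, q ^ n * x ≠ 1) :
    HasDerivAt (eulerProd q) (-(eulerProd q x * ∑' n : ℕ, q ^ n / (1 - q ^ n * x))) x := by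
  set σ : ℕ → K := fun n => q ^ n / (1 - q ^ n * x) with hσ
  have hx' : ∀ n : ℕ, 1 - q ^ n * x ≠ 0 := fun n h => hx n (by linear_combination -h)
  have hσ0 : Tendsto σ atTop (𝓝 0) := by
    have h1 : Tendsto (fun n : ℕ => 1 - q ^ n * x) atTop (𝓝 1) := by
      simpa using (tendsto_pow_mul hq x).const_sub 1
    have := (tendsto_pow_atTop_nhds_zero_of_norm_lt_one hq).div h1 one_ne_zero
    rwa [zero_div] at this
  have hs : Summable σ := summable_of_tendsto_zero hσ0
  obtain ⟨C, hC⟩ := hσ0.norm.bddAbove_range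
  have hC' : ∀ n, ‖σ n‖ ≤ max C 1 := fun n => (hC ⟨n, rfl⟩).trans (le_max_left _ _)
  set D := max C 1
  have hD : 0 < D := lt_of_lt_of_le one_pos (le_max_right _ _)
  -- The finite products at `x + h` are those at `x` times `∏ (1 - h * σ n)`, so the uniform
  -- remainder bound passes to the limit.
  have key : ∀ h : K, D * ‖h‖ ≤ 1 →
      ‖eulerProd q (x + h) - eulerProd q x + h * (eulerProd q x * ∑' n, σ n)‖ ≤
        ‖eulerProd q x‖ * (D ^ 2 * ‖h‖ ^ 2) := by
    intro h hh
    have h1 := tendsto_euler hq x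
    have h2 := tendsto_euler hq (x + h)
    have h3 := hs.hasSum.tendsto_sum_nat
    refine le_of_tendsto_of_tendsto
      ((h2.sub h1).add ((h1.mul h3).const_mul h)).norm (h1.norm.mul_const (D ^ 2 * ‖h‖ ^ 2))
      (Eventually.of_forall fun N => ?_)
    have e : ∏ n ∈ Finset.range N, (1 - q ^ n * (x + h)) =
        (∏ n ∈ Finset.range N, (1 - q ^ n * x)) * ∏ n ∈ Finset.range N, (1 - h * σ n) := by
      rw [← Finset.prod_mul_distrib]
      refine Finset.prod_congr rfl fun n _ => ?_
      have := hx' n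
      simp only [hσ]
      field_simp
      ring
    have := norm_prod_one_sub_le hD.le σ hC' h hh N
    simp only [e]
    calc _ = ‖(∏ n ∈ Finset.range N, (1 - q ^ n * x)) *
          (∏ n ∈ Finset.range N, (1 - h * σ n) - 1 + h * ∑ n ∈ Finset.range N, σ n)‖ := by
            congr 1; ring
      _ ≤ _ := by
            rw [norm_mul]
            exact mul_le_mul_of_nonneg_left this (norm_nonneg _)
  rw [hasDerivAt_iff_isLittleO_nhds_zero]
  refine Asymptotics.IsBigO.trans_isLittleO (g := fun h : K => ‖h‖ ^ 2) ?_ ?_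
  · refine Asymptotics.IsBigO.of_bound (‖eulerProd q x‖ * D ^ 2) ?_
    have : ∀ᶠ h : K in 𝓝 0, ‖h‖ < D⁻¹ := by
      filter_upwards [Metric.ball_mem_nhds (0 : K) (inv_pos.2 hD)] with h hh
      simpa using hh
    filter_upwards [this] with h hh
    have h1 : D * ‖h‖ ≤ 1 := by
      have := mul_le_mul_of_nonneg_left hh.le hD.le
      rwa [mul_inv_cancel₀ hD.ne'] at this
    have := key h h1
    simp only [smul_eq_mul, Real.norm_eq_abs, abs_pow, abs_norm]
    calc _ = ‖eulerProd q (x + h) - eulerProd q x + h * (eulerProd q x * ∑' n, σ n)‖ := by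
            congr 1; ring
      _ ≤ _ := by linarith
  · simpa using (Asymptotics.isLittleO_norm_pow_id (E' := K) one_lt_two)

/-- The logarithmic derivative is not available at the zeros. The functional equation `eulerProd_eq`
moves any point towards 0, and in the open unit disc no factor vanishes; hence the induction on `N`
with `‖q ^ N * x‖ < 1`. -/
theorem differentiable_eulerProd {q : K} (hq : ‖q‖ < 1) : Differentiable K (eulerProd q) := by
  have key : ∀ N : ℕ, ∀ x : K, ‖q ^ N * x‖ < 1 → DifferentiableAt K (eulerProd q) x := by
    intro N
    induction N with
    | zero =>
      intro x hx
      refine (hasDerivAt_eulerProd hq fun n h => ?_).differentiableAt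
      have h1 : ‖q ^ n * x‖ < 1 := by
        rw [pow_zero, one_mul] at hx
        rw [norm_mul, norm_pow]
        exact (mul_le_of_le_one_left (norm_nonneg _)
          (pow_le_one₀ (norm_nonneg _) hq.le)).trans_lt hx
      rw [h, norm_one] at h1
      exact lt_irrefl _ h1
    | succ N ih =>
      intro x hx
      have h1 := ih (q * x) (by rwa [← mul_assoc, ← pow_succ])
      have h2 : DifferentiableAt K (fun y => (1 - y) * eulerProd q (q * y)) x :=
        ((differentiableAt_const 1).sub differentiableAt_id).mul
          (DifferentiableAt.fun_comp' x h1 (differentiableAt_id.const_mul q))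
      exact h2.congr_of_eventuallyEq (Eventually.of_forall fun y => eulerProd_eq hq y)
  intro x
  have := (tendsto_pow_mul hq x).norm.eventually_lt_const (show ‖(0 : K)‖ < 1 by simp)
  obtain ⟨N, hN⟩ := this.exists
  exact key N x hN

/-- The theta function `∏_{n ≥ 0} (1 - q ^ n u) ∏_{n ≥ 1} (1 - q ^ n u⁻¹)`. -/
noncomputable def theta (q u : K) : K := eulerProd q u * eulerProd q (q * u⁻¹)

/-- The theta function without its factor `1 - u`. -/
noncomputable def thetaReg (q u : K) : K := eulerProd q (q * u) * eulerProd q (q * u⁻¹)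

theorem theta_eq {q : K} (hq : ‖q‖ < 1) (u : K) : theta q u = (1 - u) * thetaReg q u := by
  rw [theta, thetaReg, eulerProd_eq hq u, mul_assoc]

theorem theta_inv {q : K} (hq : ‖q‖ < 1) {u : K} (hu : u ≠ 0) :
    theta q u⁻¹ = -u⁻¹ * theta q u := by
  rw [theta_eq hq, theta_eq hq, thetaReg, thetaReg, inv_inv]
  field_simp
  ring

theorem theta_mul_self {q : K} (hq : ‖q‖ < 1) (hq0 : q ≠ 0) {u : K} (hu : u ≠ 0) :
    theta q (q * u) = -u⁻¹ * theta q u := by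
  rw [theta, theta_eq hq, thetaReg, show q * (q * u)⁻¹ = u⁻¹ by field_simp,
    eulerProd_eq hq u⁻¹]
  field_simp
  ring

theorem theta_ne_zero {q : K} (hq : ‖q‖ < 1) (hq0 : q ≠ 0) {u : K}
    (h : ∀ n : ℤ, q ^ n * u ≠ 1) : theta q u ≠ 0 := by
  refine mul_ne_zero (eulerProd_ne_zero hq fun n => by simpa using h n)
    (eulerProd_ne_zero hq fun n hn => h (-(n + 1)) ?_)
  have hu : u ≠ 0 := by rintro rfl; simp at hn
  rw [zpow_neg, zpow_add_one₀ hq0, zpow_natCast]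
  field_simp at hn ⊢
  rw [← hn]

theorem theta_one {q : K} (hq : ‖q‖ < 1) : theta q 1 = 0 := by simp [theta_eq hq]

theorem thetaReg_one_ne_zero {q : K} (hq : ‖q‖ < 1) : thetaReg q 1 ≠ 0 := by
  have : eulerProd q q ≠ 0 := eulerProd_ne_zero hq fun n h => by
    have := congrArg norm h
    rw [← pow_succ, norm_pow, norm_one] at this
    exact absurd this (pow_lt_one₀ (norm_nonneg _) hq (by simp)).ne
  simpa [thetaReg] using this

theorem differentiableAt_theta {q : K} (hq : ‖q‖ < 1) {u : K} (hu : u ≠ 0) :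
    DifferentiableAt K (theta q) u :=
  (differentiable_eulerProd hq u).mul (DifferentiableAt.fun_comp' u
    (differentiable_eulerProd hq _) ((differentiableAt_inv hu).const_mul q))

theorem differentiableAt_thetaReg {q : K} (hq : ‖q‖ < 1) {u : K} (hu : u ≠ 0) :
    DifferentiableAt K (thetaReg q) u :=
  (DifferentiableAt.fun_comp' u (differentiable_eulerProd hq _)
    (differentiableAt_id.const_mul q)).mul (DifferentiableAt.fun_comp' u
    (differentiable_eulerProd hq _) ((differentiableAt_inv hu).const_mul q))

/-- The symmetry u ↦ u⁻¹ makes the two Euler factors contribute opposite terms. They cancel in the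
product rule itself, so characteristic 2 is no exception. -/
theorem hasDerivAt_thetaReg_one {q : K} (hq : ‖q‖ < 1) : HasDerivAt (thetaReg q) 0 1 := by
  have h1 : HasDerivAt (fun u : K => q * u) (q * 1) 1 := (hasDerivAt_id 1).const_mul q
  have h2 : HasDerivAt (fun u : K => q * u⁻¹) (q * (-(1 ^ 2)⁻¹)) 1 :=
    (hasDerivAt_inv one_ne_zero).const_mul q
  have e : HasDerivAt (eulerProd q) (deriv (eulerProd q) q) q :=
    (differentiable_eulerProd hq q).hasDerivAt
  have e1 : HasDerivAt (eulerProd q) (deriv (eulerProd q) q) (q * 1) := by rwa [mul_one]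
  have e2 : HasDerivAt (eulerProd q) (deriv (eulerProd q) q) (q * 1⁻¹) := by
    rwa [inv_one, mul_one]
  have := (e1.comp (1 : K) h1).mul (e2.comp (1 : K) h2)
  refine HasDerivAt.congr_deriv (f := thetaReg q) this ?_
  simp only [inv_one, mul_one, one_pow, Function.comp]
  ring

/-! ### The Jacobi triple product -/

/-- The triangular numbers `n (n - 1) / 2`. -/
def tri (n : ℤ) : ℤ := n * (n - 1) / 2

theorem two_mul_tri (n : ℤ) : 2 * tri n = n * (n - 1) :=
  Int.mul_ediv_cancel' (by
    rcases Int.even_or_odd' n with ⟨m, rfl | rfl⟩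
    · exact ⟨m * (2 * m - 1), by ring⟩
    · exact ⟨(2 * m + 1) * m, by ring⟩)

theorem tri_add_one (n : ℤ) : tri (n + 1) = tri n + n := by
  have := two_mul_tri n
  have := two_mul_tri (n + 1)
  linarith

/-- The series `∑_j (-1) ^ j q ^ (j (j - 1) / 2) u ^ j`. -/
noncomputable def thetaSeries (q u : K) : K := ∑' j : ℤ, (-1) ^ j * q ^ tri j * u ^ j

theorem summable_tri {q u : K} (hq : ‖q‖ < 1) (hq0 : q ≠ 0) (hu : u ≠ 0) :
    Summable fun j : ℤ => ‖q ^ tri j * u ^ j‖ := by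
  have hlim : ∀ c : K, Tendsto (fun n : ℕ => ‖q ^ n * c‖) atTop (𝓝 0) := fun c => by
    simpa using (tendsto_pow_mul hq c).norm
  have e1 : ∀ n : ℕ, tri (-((n + 1 : ℕ) : ℤ)) = tri (-(n : ℤ)) + (n + 1) := fun n => by
    have := tri_add_one (-((n + 1 : ℕ) : ℤ))
    push_cast at this ⊢
    rw [show -((n : ℤ) + 1) + 1 = -n by ring] at this
    linarith
  refine Summable.of_nat_of_neg (summable_of_ratio_test_tendsto_lt_one zero_lt_one
    (Eventually.of_forall fun n => ?_) ((hlim u).congr fun n => ?_))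
    (summable_of_ratio_test_tendsto_lt_one zero_lt_one
    (Eventually.of_forall fun n => ?_) ((hlim (q * u⁻¹)).congr fun n => ?_))
  · simp [hq0, hu, zpow_ne_zero]
  · rw [norm_norm, norm_norm, ← norm_div]
    congr 1
    push_cast
    rw [tri_add_one, zpow_add₀ hq0, zpow_add_one₀ hu, zpow_natCast q n]
    have := zpow_ne_zero (tri (n : ℤ)) hq0
    have := zpow_ne_zero (n : ℤ) hu
    field_simp
  · simp [hq0, hu, zpow_ne_zero]
  · rw [norm_norm, norm_norm, ← norm_div]
    congr 1
    rw [e1, zpow_add₀ hq0, zpow_add_one₀ hq0, zpow_natCast q n]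
    push_cast
    rw [neg_add, ← sub_eq_add_neg, zpow_sub_one₀ hu]
    have := zpow_ne_zero (tri (-(n : ℤ))) hq0
    have := zpow_ne_zero (-(n : ℤ)) hu
    field_simp

/-- `1 / ∏_{i = 1}^n (1 - q ^ i)`, and `0` for negative `n`. -/
noncomputable def invPoch (q : K) (n : ℤ) : K :=
  if n < 0 then 0 else (∏ i ∈ Finset.range n.toNat, (1 - q ^ i * q))⁻¹

theorem norm_one_sub_pow {q : K} (hq : ‖q‖ < 1) (n : ℕ) : ‖1 - q ^ n * q‖ = 1 := by
  have h : ‖-(q ^ n * q)‖ < ‖(1 : K)‖ := by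
    rw [norm_neg, ← pow_succ, norm_pow, norm_one]
    exact pow_lt_one₀ (norm_nonneg _) hq (by simp)
  rw [sub_eq_add_neg, IsUltrametricDist.norm_add_eq_max_of_norm_ne_norm h.ne', max_eq_left h.le,
    norm_one]

theorem one_sub_pow_ne_zero {q : K} (hq : ‖q‖ < 1) (n : ℕ) : 1 - q ^ n * q ≠ 0 := by
  rw [← norm_ne_zero_iff, norm_one_sub_pow hq]; exact one_ne_zero

/-- Extending by zero to negative integers keeps the recursion valid on all of ℤ, because 1 - q⁰ =
0. The finite triple product can then be summed over ℤ without boundary terms. -/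
theorem invPoch_sub_one {q : K} (hq : ‖q‖ < 1) (n : ℤ) :
    invPoch q (n - 1) = (1 - q ^ n) * invPoch q n := by
  rcases lt_trichotomy n 0 with h | rfl | h
  · rw [invPoch, invPoch, if_pos h, if_pos (by omega), mul_zero]
  · simp [invPoch]
  · obtain ⟨m, rfl⟩ : ∃ m : ℕ, n = m + 1 := ⟨(n - 1).toNat, by omega⟩
    rw [invPoch, invPoch, if_neg (by omega), if_neg (by omega)]
    rw [show ((m : ℤ) + 1 - 1).toNat = m by omega, show ((m : ℤ) + 1).toNat = m + 1 by omega,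
      Finset.prod_range_succ, mul_inv, show q ^ ((m : ℤ) + 1) = q ^ m * q by
        rw [← pow_succ]; norm_cast]
    rw [mul_left_comm, mul_inv_cancel₀ (one_sub_pow_ne_zero hq m), mul_one]

theorem norm_invPoch_le {q : K} (hq : ‖q‖ < 1) (n : ℤ) : ‖invPoch q n‖ ≤ 1 := by
  rw [invPoch]
  split_ifs
  · simp
  · rw [norm_inv, norm_prod]
    simp [norm_one_sub_pow hq]

theorem tendsto_invPoch {q : K} (hq : ‖q‖ < 1) {φ : ℕ → ℤ} (hφ : Tendsto φ atTop atTop) :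
    Tendsto (fun N => invPoch q (φ N)) atTop (𝓝 (eulerProd q q)⁻¹) := by
  have h1 := (tendsto_euler hq q).inv₀ (by simpa [thetaReg] using thetaReg_one_ne_zero hq)
  have h2 : Tendsto (fun N => (φ N).toNat) atTop atTop :=
    tendsto_atTop.2 fun b => (hφ.eventually_ge_atTop (b : ℤ)).mono fun N h => by omega
  refine (h1.comp h2).congr' ?_
  filter_upwards [hφ.eventually_ge_atTop 0] with N h
  rw [invPoch, if_neg (by omega)]
  rfl

/-- The coefficients of the finite triple product. -/
noncomputable def tripleCoeff (q : K) (N : ℕ) (j : ℤ) : K :=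
  (-1) ^ j * q ^ tri j * ((∏ i ∈ Finset.range (2 * N), (1 - q ^ i * q)) *
    (invPoch q (N + j) * invPoch q (N - j)))

/-- This recursion is multiplication by the two new factors (1 - q^N u)(1 - q^(N+1) u⁻¹) = (1 +
q^(2N+1)) - q^N u - q^(N+1) u⁻¹, read off at u^j. -/
theorem tripleCoeff_succ {q : K} (hq : ‖q‖ < 1) (hq0 : q ≠ 0) (N : ℕ) (j : ℤ) :
    tripleCoeff q (N + 1) j = (1 + q ^ (2 * N + 1)) * tripleCoeff q N j -
      q ^ N * tripleCoeff q N (j - 1) - q ^ (N + 1) * tripleCoeff q N (j + 1) := by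
  have h1 := invPoch_sub_one hq (N + 1 + j)
  have h2 := invPoch_sub_one hq (N + j)
  have h3 := invPoch_sub_one hq (N + 1 - j)
  have h4 := invPoch_sub_one hq (N - j)
  rw [show (N : ℤ) + 1 + j - 1 = N + j by ring] at h1
  rw [show (N : ℤ) + 1 - j - 1 = N - j by ring] at h3
  have t1 := tri_add_one j
  have t2 : tri (j - 1) = tri j - (j - 1) := by
    have := tri_add_one (j - 1)
    rw [sub_add_cancel] at this
    linarith
  simp only [tripleCoeff]
  rw [show 2 * (N + 1) = 2 * N + 1 + 1 by ring, Finset.prod_range_succ, Finset.prod_range_succ]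
  push_cast
  rw [show (N : ℤ) + (j - 1) = N + j - 1 by ring, show (N : ℤ) - (j - 1) = N + 1 - j by ring,
    show (N : ℤ) + (j + 1) = N + 1 + j by ring, show (N : ℤ) - (j + 1) = N - j - 1 by ring,
    h2, h4, h1, h3, t1, t2]
  have m1 : (-1 : K) ≠ 0 := by simp
  simp only [zpow_add₀ hq0, zpow_sub₀ hq0, zpow_add₀ m1, zpow_sub₀ m1, zpow_one, zpow_natCast]
  have hj := zpow_ne_zero j hq0
  have hN := pow_ne_zero N hq0
  simp only [pow_mul', pow_succ, pow_zero, one_mul]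
  generalize ∏ i ∈ Finset.range (2 * N), (1 - q ^ i * q) = T
  generalize invPoch q (N + 1 + j) = R1
  generalize invPoch q (N + 1 - j) = R2
  field_simp
  ring

theorem _root_.HasSum.congr' {ι : Type*} {f g : ι → K} {a b : K} (h : HasSum f a)
    (hfg : ∀ i, f i = g i) (e : a = b) : HasSum g b := by
  rwa [← e, ← funext hfg]

theorem hasSum_tripleCoeff {q u : K} (hq : ‖q‖ < 1) (hq0 : q ≠ 0) (hu : u ≠ 0) (N : ℕ) :
    HasSum (fun j : ℤ => tripleCoeff q N j * u ^ j)
      ((∏ n ∈ Finset.range N, (1 - q ^ n * u)) *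
        ∏ n ∈ Finset.range N, (1 - q ^ n * (q * u⁻¹))) := by
  induction N with
  | zero =>
    have : ∀ j : ℤ, j ≠ 0 → tripleCoeff q 0 j * u ^ j = 0 := fun j hj => by
      rcases lt_or_gt_of_ne hj with h | h
      · simp [tripleCoeff, invPoch, h]
      · simp [tripleCoeff, invPoch, h]
    convert hasSum_single 0 this using 1
    simp [tripleCoeff, invPoch, tri]
  | succ N ih =>
    have s1 := ((Equiv.subRight (1 : ℤ)).hasSum_iff.2 ih).mul_left (q ^ N * u)
    have s2 := ((Equiv.addRight (1 : ℤ)).hasSum_iff.2 ih).mul_left (q ^ (N + 1) * u⁻¹)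
    have s3 := ((ih.mul_left (1 + q ^ (2 * N + 1))).sub s1).sub s2
    rw [Finset.prod_range_succ, Finset.prod_range_succ]
    refine s3.congr' (fun j => ?_) ?_
    · simp only [Function.comp, Equiv.subRight_apply, Equiv.coe_addRight,
        tripleCoeff_succ hq hq0, zpow_sub_one₀ hu, zpow_add_one₀ hu]
      field_simp
    · simp only [pow_mul', pow_succ]
      field_simp
      ring_nf

/-- Let `N → ∞` in the finite triple product. All factors 1 - qⁱ have norm one, so its terms are
dominated by `‖q ^ tri j * u ^ j‖` uniformly in `N`, and dominated convergence applies. -/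
theorem theta_eq_thetaSeries {q u : K} (hq : ‖q‖ < 1) (hq0 : q ≠ 0) (hu : u ≠ 0) :
    theta q u = (eulerProd q q)⁻¹ * thetaSeries q u := by
  have hE : eulerProd q q ≠ 0 := by simpa [thetaReg] using thetaReg_one_ne_zero hq
  have h1 := (tendsto_euler hq u).mul (tendsto_euler hq (q * u⁻¹))
  refine tendsto_nhds_unique h1 ?_
  have h2 : Tendsto (fun N => ∑' j : ℤ, tripleCoeff q N j * u ^ j) atTop
      (𝓝 (∑' j : ℤ, (-1) ^ j * q ^ tri j * (eulerProd q q)⁻¹ * u ^ j)) := by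
    refine tendsto_tsum_of_dominated_convergence (summable_tri hq hq0 hu) (fun j => ?_)
      (Eventually.of_forall fun N j => ?_)
    · refine Tendsto.mul_const _ (Tendsto.const_mul _ ?_)
      have a1 := (tendsto_euler hq q).comp
        (tendsto_id.const_mul_atTop' (show 0 < 2 by norm_num) : Tendsto (fun N => 2 * N) _ atTop)
      have a2 := tendsto_invPoch hq (φ := fun N => N + j)
        (tendsto_atTop_add_const_right _ _ tendsto_natCast_atTop_atTop)
      have a3 := tendsto_invPoch hq (φ := fun N => N - j)
        (tendsto_atTop_add_const_right _ (-j) tendsto_natCast_atTop_atTop)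
      have := a1.mul (a2.mul a3)
      rwa [← mul_assoc, mul_inv_cancel₀ hE, one_mul] at this
    · have e : ‖∏ i ∈ Finset.range (2 * N), (1 - q ^ i * q)‖ = 1 := by
        rw [norm_prod]; simp [norm_one_sub_pow hq]
      rw [tripleCoeff, norm_mul, norm_mul, norm_mul, norm_mul, norm_mul, e, norm_zpow, norm_neg,
        norm_one, one_zpow, one_mul, one_mul, norm_mul]
      refine mul_le_mul_of_nonneg_right ?_ (norm_nonneg _)
      refine mul_le_of_le_one_right (norm_nonneg _) ?_
      exact mul_le_one₀ (norm_invPoch_le hq _) (norm_nonneg _) (norm_invPoch_le hq _)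
  have h3 : ∑' j : ℤ, (-1) ^ j * q ^ tri j * (eulerProd q q)⁻¹ * u ^ j =
      (eulerProd q q)⁻¹ * thetaSeries q u := by
    rw [thetaSeries, ← tsum_mul_left]
    exact tsum_congr fun j => by ring
  rw [h3] at h2
  exact h2.congr fun N => (hasSum_tripleCoeff hq hq0 hu N).tsum_eq

/-! ### The three term relation -/

/-- `∑_n q ^ (n (n - 1)) x ^ n`. -/
noncomputable def gaussSeries (q x : K) : K := ∑' n : ℤ, (q ^ 2) ^ tri n * x ^ n

theorem hasSum_gaussSeries {q x : K} (hq : ‖q‖ < 1) (hq0 : q ≠ 0) (hx : x ≠ 0) :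
    HasSum (fun n : ℤ => (q ^ 2) ^ tri n * x ^ n) (gaussSeries q x) :=
  (summable_tri (by rw [norm_pow]; exact pow_lt_one₀ (norm_nonneg _) hq two_ne_zero)
    (pow_ne_zero 2 hq0) hx).of_norm.hasSum

/-- The pairs (i, j) are split by the parity of i + j; each class is a copy of ℤ² with coordinates
half the sum and half the difference. -/
theorem hasSum_int_prod_parity {f : ℤ × ℤ → K} {a b : K}
    (ha : HasSum (fun p : ℤ × ℤ => f (p.1 - p.2, p.1 + p.2)) a)
    (hb : HasSum (fun p : ℤ × ℤ => f (p.1 - p.2, p.1 + 1 + p.2)) b) : HasSum f (a + b) := by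
  have i0 : Function.Injective fun p : ℤ × ℤ => (p.1 - p.2, p.1 + p.2) := by
    rintro ⟨a, b⟩ ⟨c, d⟩ h
    simp only [Prod.mk.injEq] at h ⊢
    omega
  have i1 : Function.Injective fun p : ℤ × ℤ => (p.1 - p.2, p.1 + 1 + p.2) := by
    rintro ⟨a, b⟩ ⟨c, d⟩ h
    simp only [Prod.mk.injEq] at h ⊢
    omega
  refine (i0.hasSum_range_iff.2 ha).add_isCompl (isCompl_iff.2 ⟨?_, ?_⟩)
    (i1.hasSum_range_iff.2 hb)
  · rw [Set.disjoint_left]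
    rintro _ ⟨⟨a, b⟩, rfl⟩ ⟨⟨c, d⟩, h⟩
    simp only [Prod.mk.injEq] at h
    omega
  · refine codisjoint_iff.2 (Set.eq_univ_iff_forall.2 ?_)
    rintro ⟨i, j⟩
    rcases Int.even_or_odd' (i + j) with ⟨m, h | h⟩
    · exact Or.inl ⟨(m, j - m), by simp only [Prod.mk.injEq]; omega⟩
    · exact Or.inr ⟨(m, j - m - 1), by simp only [Prod.mk.injEq]; omega⟩

theorem nonarchimedeanRing : NonarchimedeanRing K :=
  ⟨NonarchimedeanAddGroup.is_nonarchimedean⟩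

/-- In the double series put (i, j) = (n - l, n + l) or (n - l, n + 1 + l). Then tri i + tri j
becomes 2 tri n + 2 tri l plus a linear term, so n and l separate. The sign (-1)^(i+j) is constant
on each class and produces the minus sign of the second product. -/
theorem thetaSeries_mul {q u a e : K} (hq : ‖q‖ < 1) (hq0 : q ≠ 0) (hu : u ≠ 0) (ha : a ≠ 0)
    (he : e ≠ 0) :
    thetaSeries q (u * a⁻¹) * thetaSeries q (u * a * e) =
      gaussSeries q (u ^ 2 * e) * gaussSeries q (q * a ^ 2 * e) -
        u * e * gaussSeries q (q * u ^ 2 * e) * (a * gaussSeries q (q ^ 2 * a ^ 2 * e)) := by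
  have : NonarchimedeanRing K := nonarchimedeanRing
  have hs : ∀ x : K, x ≠ 0 → HasSum (fun j : ℤ => (-1) ^ j * q ^ tri j * x ^ j)
      (thetaSeries q x) := fun x hx => by
    refine (Summable.of_norm ?_).hasSum
    simpa [norm_mul, mul_assoc] using summable_tri hq hq0 hx
  have h1 := (hs _ (mul_ne_zero hu (inv_ne_zero ha))).mul_of_nonarchimedean
    (hs _ (mul_ne_zero (mul_ne_zero hu ha) he))
  have h2 := (hasSum_gaussSeries hq hq0 (mul_ne_zero (pow_ne_zero 2 hu) he)).mul_of_nonarchimedean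
    (hasSum_gaussSeries hq hq0 (mul_ne_zero (mul_ne_zero hq0 (pow_ne_zero 2 ha)) he))
  have h3 := ((hasSum_gaussSeries hq hq0
    (mul_ne_zero (mul_ne_zero hq0 (pow_ne_zero 2 hu)) he)).mul_left (u * e)).mul_of_nonarchimedean
    ((hasSum_gaussSeries hq hq0
      (mul_ne_zero (mul_ne_zero (pow_ne_zero 2 hq0) (pow_ne_zero 2 ha)) he)).mul_left a)
  rw [sub_eq_add_neg]
  have m1 : (-1 : K) ≠ 0 := by simp
  have hm : ∀ n : ℤ, ((-1 : K) ^ n) ^ 2 = 1 := fun n => by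
    rw [← zpow_natCast, ← zpow_mul, mul_comm, zpow_mul]; simp
  have hp : ∀ n : ℤ, (q ^ 2) ^ n = q ^ (2 * n) := fun n => by
    rw [zpow_mul]; norm_cast
  refine h1.unique (hasSum_int_prod_parity (h2.congr' (fun p => ?_) rfl)
    (h3.neg.congr' (fun p => ?_) rfl))
  · obtain ⟨n, l⟩ := p
    have t : tri (n - l) = 2 * tri n + 2 * tri l + l - tri (n + l) := by
      linarith [two_mul_tri n, two_mul_tri l, two_mul_tri (n - l), two_mul_tri (n + l)]
    simp only [t, hp]
    simp only [mul_zpow, zpow_add₀ hq0, zpow_sub₀ hq0, zpow_add₀ m1, zpow_sub₀ m1, zpow_sub₀ hu,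
      zpow_add₀ hu, zpow_sub₀ ha, zpow_add₀ ha, zpow_add₀ he, inv_zpow', zpow_neg,
      ← zpow_natCast, ← zpow_mul]
    have := zpow_ne_zero (tri (n + l)) hq0
    have := zpow_ne_zero n ha
    have := zpow_ne_zero l ha
    have := zpow_ne_zero l hu
    have := zpow_ne_zero l m1
    push_cast
    simp only [two_mul, zpow_add₀ hu, zpow_add₀ ha, zpow_add₀ hq0]
    field_simp
    exact (hm n).symm
  · obtain ⟨n, l⟩ := p
    have t : tri (n - l) = 2 * tri n + n + 2 * tri l + 2 * l - tri (n + 1 + l) := by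
      linarith [two_mul_tri n, two_mul_tri l, two_mul_tri (n - l), two_mul_tri (n + 1 + l)]
    simp only [t, hp]
    simp only [mul_zpow, zpow_add₀ hq0, zpow_sub₀ hq0, zpow_add₀ m1, zpow_sub₀ m1, zpow_sub₀ hu,
      zpow_add₀ hu, zpow_sub₀ ha, zpow_add₀ ha, zpow_add₀ he, inv_zpow', zpow_neg,
      ← zpow_natCast, ← zpow_mul, zpow_one]
    have := zpow_ne_zero (tri (n + 1 + l)) hq0
    have := zpow_ne_zero n ha
    have := zpow_ne_zero l ha
    have := zpow_ne_zero l hu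
    have := zpow_ne_zero l m1
    push_cast
    simp only [two_mul, zpow_add₀ hu, zpow_add₀ ha, zpow_add₀ hq0]
    field_simp
    rw [hm n]

/-- Only the fact that the kernel has rank two matters for the three term relation, so the four
functions are merely asserted to exist. -/
theorem theta_mul_eq {q e : K} (hq : ‖q‖ < 1) (hq0 : q ≠ 0) (he : e ≠ 0) :
    ∃ A B C D : K → K, ∀ u a : K, u ≠ 0 → a ≠ 0 →
      theta q (u * a⁻¹) * theta q (u * a * e) = A u * B a - C u * D a := by
  refine ⟨fun u => (eulerProd q q)⁻¹ ^ 2 * gaussSeries q (u ^ 2 * e),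
    fun a => gaussSeries q (q * a ^ 2 * e),
    fun u => (eulerProd q q)⁻¹ ^ 2 * (u * e * gaussSeries q (q * u ^ 2 * e)),
    fun a => a * gaussSeries q (q ^ 2 * a ^ 2 * e), fun u a hu ha => ?_⟩
  rw [theta_eq_thetaSeries hq hq0 (mul_ne_zero hu (inv_ne_zero ha)),
    theta_eq_thetaSeries hq hq0 (mul_ne_zero (mul_ne_zero hu ha) he)]
  linear_combination (eulerProd q q)⁻¹ ^ 2 * thetaSeries_mul hq hq0 hu ha he

/-- The three term relation of the theta function. -/
theorem theta_three_term {q : K} (hq : ‖q‖ < 1) (hq0 : q ≠ 0) {x y z s : K} (hx : x ≠ 0)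
    (hy : y ≠ 0) (hz : z ≠ 0) (hs : s ≠ 0) :
    theta q x * theta q (x * y * z) * (theta q y * theta q z) *
        (theta q (y⁻¹ * s⁻¹) * theta q (z * s)) -
      theta q (x * s⁻¹) * theta q (x * y * z * s) * (theta q y * theta q z) *
        (theta q y⁻¹ * theta q z) +
      theta q (x * y) * theta q (x * z) * (theta q s⁻¹ * theta q (y * z * s)) *
        (theta q y⁻¹ * theta q z) = 0 := by
  -- For the kernel K(u, a) = θ(u/a) θ(uayz), the determinant with rows u = x, 1, y⁻¹ and columns a
  -- = 1, s, y⁻¹ is zero. Since θ(1) = 0, the entries K(1, 1) and K(y⁻¹, y⁻¹) vanish and only three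
  -- terms are left.
  obtain ⟨A, B, C, D, h⟩ := theta_mul_eq hq hq0 (mul_ne_zero hy hz)
  have hy' := inv_ne_zero hy
  have e1 := h x 1 hx one_ne_zero
  have e2 := h x s hx hs
  have e3 := h x y⁻¹ hx hy'
  have e4 := h 1 1 one_ne_zero one_ne_zero
  have e5 := h 1 s one_ne_zero hs
  have e6 := h 1 y⁻¹ one_ne_zero hy'
  have e7 := h y⁻¹ 1 hy' one_ne_zero
  have e8 := h y⁻¹ s hy' hs
  have e9 := h y⁻¹ y⁻¹ hy' hy'
  simp only [inv_one, inv_inv, mul_one, one_mul] at e1 e2 e3 e4 e5 e6 e7 e8 e9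
  rw [theta_one hq, zero_mul] at e4
  rw [inv_mul_cancel₀ hy, theta_one hq, zero_mul] at e9
  rw [show x * (y * z) = x * y * z by ring] at e1
  rw [show x * s * (y * z) = x * y * z * s by ring] at e2
  rw [show x * y⁻¹ * (y * z) = x * z by field_simp] at e3
  rw [show s * (y * z) = y * z * s by ring] at e5
  rw [show y⁻¹ * (y * z) = z by field_simp] at e6 e7
  rw [show y⁻¹ * s * (y * z) = z * s by field_simp] at e8
  rw [e1, e2, e3, e5, e6, e7, e8]
  linear_combination (-(A x * B y⁻¹ - C x * D y⁻¹) * (A y⁻¹ * B s - C y⁻¹ * D s)) * e4 -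
    ((A x * B 1 - C x * D 1) * (A 1 * B s - C 1 * D s) -
      (A x * B s - C x * D s) * (A 1 * B 1 - C 1 * D 1)) * e9

/-! ### The zeta function -/

/-- `∑_{n ∈ ℤ} q ^ n u / (1 - q ^ n u)`, with `1` added to the terms with `n < 0`. -/
noncomputable def zetaSum (q u : K) : K :=
  ∑' n : ℤ, (q ^ n * u / (1 - q ^ n * u) + if n < 0 then 1 else 0)

/-- `∑_{n ≥ 0} q ^ n u / (1 - q ^ n u)`. -/
noncomputable def zetaHalf (q u : K) : K := ∑' n : ℕ, q ^ n * u / (1 - q ^ n * u)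

theorem hasSum_zetaHalf {q : K} (hq : ‖q‖ < 1) (u : K) :
    HasSum (fun n : ℕ => q ^ n * u / (1 - q ^ n * u)) (zetaHalf q u) := by
  refine (summable_of_tendsto_zero ?_).hasSum
  have h := tendsto_pow_mul hq u
  have := h.div (h.const_sub 1) (by simp)
  rwa [zero_div] at this

theorem inv_div_one_sub_inv {u : K} (hu0 : u ≠ 0) (hu : u ≠ 1) :
    u⁻¹ / (1 - u⁻¹) = -1 - u / (1 - u) := by
  have h1 : 1 - u ≠ 0 := sub_ne_zero.2 hu.symm
  have h2 : u - 1 ≠ 0 := sub_ne_zero.2 hu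
  rw [show 1 - u⁻¹ = (u - 1) / u by field_simp, div_div_eq_mul_div, inv_mul_cancel₀ hu0]
  field_simp
  ring

/-- As n → -∞ the terms z / (1 - z) tend to -1, which the added 1 compensates. The negative half
then becomes minus the half series at `q * u⁻¹`. -/
theorem hasSum_zetaSum {q : K} (hq : ‖q‖ < 1) (hq0 : q ≠ 0) {u : K} (hu0 : u ≠ 0)
    (hu : ∀ n : ℤ, q ^ n * u ≠ 1) :
    HasSum (fun n : ℤ => q ^ n * u / (1 - q ^ n * u) + if n < 0 then 1 else 0)
      (zetaHalf q u - zetaHalf q (q * u⁻¹)) := by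
  rw [sub_eq_add_neg]
  refine HasSum.of_nat_of_neg_add_one ((hasSum_zetaHalf hq u).congr' (fun n => ?_) rfl)
    ((hasSum_zetaHalf hq (q * u⁻¹)).neg.congr' (fun n => ?_) rfl)
  · simp
  · have h1 := hu (-((n : ℤ) + 1))
    rw [if_pos (by omega)]
    rw [zpow_neg, zpow_add_one₀ hq0, zpow_natCast] at h1 ⊢
    have := inv_div_one_sub_inv (mul_ne_zero (inv_ne_zero
      (mul_ne_zero (pow_ne_zero n hq0) hq0)) hu0) h1
    rw [mul_inv, inv_inv, mul_assoc] at this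
    rw [this]
    ring

theorem zetaSum_eq {q : K} (hq : ‖q‖ < 1) (hq0 : q ≠ 0) {u : K} (hu0 : u ≠ 0)
    (hu : ∀ n : ℤ, q ^ n * u ≠ 1) :
    zetaSum q u = zetaHalf q u - zetaHalf q (q * u⁻¹) :=
  (hasSum_zetaSum hq hq0 hu0 hu).tsum_eq

theorem zetaHalf_eq {q : K} (hq : ‖q‖ < 1) (u : K) :
    zetaHalf q u = u / (1 - u) + zetaHalf q (q * u) := by
  rw [zetaHalf, (hasSum_zetaHalf hq u).summable.tsum_eq_zero_add]
  simp [zetaHalf, pow_succ, mul_assoc]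

theorem zpow_mul_inv_ne_one {q u : K} (hu : ∀ n : ℤ, q ^ n * u ≠ 1) (n : ℤ) :
    q ^ n * u⁻¹ ≠ 1 := fun h => hu (-n) (by
  have := congrArg (·⁻¹) h
  simpa [mul_comm] using this)

theorem zetaSum_inv {q : K} (hq : ‖q‖ < 1) (hq0 : q ≠ 0) {u : K} (hu0 : u ≠ 0)
    (hu : ∀ n : ℤ, q ^ n * u ≠ 1) : zetaSum q u⁻¹ = -1 - zetaSum q u := by
  rw [zetaSum_eq hq hq0 hu0 hu, zetaSum_eq hq hq0 (inv_ne_zero hu0) (zpow_mul_inv_ne_one hu),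
    inv_inv, zetaHalf_eq hq u, zetaHalf_eq hq u⁻¹]
  rw [inv_div_one_sub_inv hu0 (by simpa using hu 0)]
  ring

/-- The logarithmic derivative of the theta function. -/
theorem hasDerivAt_theta {q : K} (hq : ‖q‖ < 1) (hq0 : q ≠ 0) {u : K} (hu0 : u ≠ 0)
    (hu : ∀ n : ℤ, q ^ n * u ≠ 1) :
    HasDerivAt (theta q) (-(theta q u * zetaSum q u) / u) u := by
  have hu1 : ∀ n : ℕ, q ^ n * u ≠ 1 := fun n => by simpa using hu n
  have hu2 : ∀ n : ℕ, q ^ n * (q * u⁻¹) ≠ 1 := fun n => by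
    have := zpow_mul_inv_ne_one hu (n + 1)
    rwa [zpow_add_one₀ hq0, mul_assoc, zpow_natCast] at this
  have hz : ∀ x : K, x * ∑' n : ℕ, q ^ n / (1 - q ^ n * x) = zetaHalf q x := fun x => by
    rw [zetaHalf, ← tsum_mul_left]
    exact tsum_congr fun n => by ring
  have h2 : HasDerivAt (fun u : K => q * u⁻¹) (q * (-(u ^ 2)⁻¹)) u :=
    (hasDerivAt_inv hu0).const_mul q
  have := (hasDerivAt_eulerProd hq hu1).mul ((hasDerivAt_eulerProd hq hu2).comp u h2)
  refine HasDerivAt.congr_deriv (f := theta q) this ?_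
  rw [zetaSum_eq hq hq0 hu0 hu, ← hz u, ← hz (q * u⁻¹), theta]
  simp only [Function.comp]
  field_simp
  ring_nf

/-- The fundamental identity between the zeta function and the theta function. -/
theorem zetaSum_add {q : K} (hq : ‖q‖ < 1) (hq0 : q ≠ 0) {x y z : K} (hx : x ≠ 0)
    (hy : y ≠ 0) (hz : z ≠ 0) (hx' : ∀ n : ℤ, q ^ n * x ≠ 1) (hy' : ∀ n : ℤ, q ^ n * y ≠ 1)
    (hz' : ∀ n : ℤ, q ^ n * z ≠ 1) (hxyz : ∀ n : ℤ, q ^ n * (x * y * z) ≠ 1) :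
    (zetaSum q x + zetaSum q y + zetaSum q z - zetaSum q (x * y * z) + 1) *
        (theta q x * theta q y * theta q z * theta q (x * y * z)) =
      thetaReg q 1 * theta q (x * y) * theta q (x * z) * theta q (y * z) := by
  have hxyz0 : x * y * z ≠ 0 := mul_ne_zero (mul_ne_zero hx hy) hz
  have hyi := inv_ne_zero hy
  have d1 : ∀ w : K, w ≠ 0 → HasDerivAt (fun s : K => w * s⁻¹) (-w) 1 := fun w _ => by
    simpa using (hasDerivAt_inv (one_ne_zero (α := K))).const_mul w
  have d2 : ∀ w : K, HasDerivAt (fun s : K => w * s) w 1 := fun w => by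
    simpa using (hasDerivAt_id (1 : K)).const_mul w
  have t1 : ∀ w : K, w ≠ 0 → (∀ n : ℤ, q ^ n * w ≠ 1) →
      HasDerivAt (fun s : K => theta q (w * s⁻¹)) (theta q w * zetaSum q w) 1 := fun w hw hw' => by
    have h := hasDerivAt_theta hq hq0 hw hw'
    rw [show w = w * 1⁻¹ by simp] at h
    have := h.comp (1 : K) (d1 w hw)
    refine this.congr_deriv ?_
    simp only [inv_one, mul_one]
    field_simp
  have t2 : ∀ w : K, w ≠ 0 → (∀ n : ℤ, q ^ n * w ≠ 1) →
      HasDerivAt (fun s : K => theta q (w * s)) (-(theta q w * zetaSum q w)) 1 := fun w hw hw' => by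
    have h := hasDerivAt_theta hq hq0 hw hw'
    rw [show w = w * 1 by simp] at h
    have := h.comp (1 : K) (d2 w)
    refine this.congr_deriv ?_
    simp only [mul_one]
    field_simp
  have t3 : HasDerivAt (fun s : K => theta q s⁻¹) (thetaReg q 1) 1 := by
    have h := (hasDerivAt_inv (one_ne_zero (α := K))).const_sub 1
    have hr : DifferentiableAt K (fun s : K => thetaReg q s⁻¹) 1 :=
      DifferentiableAt.fun_comp' 1 (differentiableAt_thetaReg hq (by simp))
        (differentiableAt_inv one_ne_zero)
    have := h.mul hr.hasDerivAt
    refine HasDerivAt.congr_of_eventuallyEq (this.congr_deriv (by simp))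
      (Eventually.of_forall fun s => theta_eq hq s⁻¹)
  -- The value of this derivative is irrelevant, since it is multiplied by θ(1) = 0; genericity of
  -- `y * z` is thus not needed.
  have t4 : HasDerivAt (fun s : K => theta q (y * z * s))
      (deriv (fun s : K => theta q (y * z * s)) 1) 1 :=
    (DifferentiableAt.fun_comp' 1 (differentiableAt_theta hq (by simp [hy, hz]))
      (d2 _).differentiableAt).hasDerivAt
  -- Differentiate the three term relation at s = 1. In its last term θ(s⁻¹) has a simple zero
  -- there, so only its derivative `thetaReg q 1` survives.
  have D := ((((t1 y⁻¹ hyi (zpow_mul_inv_ne_one hy')).mul (t2 z hz hz')).const_mul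
      (theta q x * theta q (x * y * z) * (theta q y * theta q z))).sub
    ((((t1 x hx hx').mul (t2 _ hxyz0 hxyz)).mul_const (theta q y * theta q z)).mul_const
      (theta q y⁻¹ * theta q z))).add
    (((t3.mul t4).const_mul (theta q (x * y) * theta q (x * z))).mul_const
      (theta q y⁻¹ * theta q z))
  have D0 := D.congr_of_eventuallyEq (f₁ := fun _ => (0 : K)) (by
    filter_upwards [isOpen_ne.mem_nhds (one_ne_zero (α := K))] with s hs
    exact (theta_three_term hq hq0 hx hy hz hs).symm)
  have E := D0.unique (hasDerivAt_const (1 : K) (0 : K))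
  simp only [inv_one, mul_one, theta_one hq] at E
  rw [zetaSum_inv hq hq0 hy hy'] at E
  have n1 : theta q y⁻¹ ≠ 0 := theta_ne_zero hq hq0 (zpow_mul_inv_ne_one hy')
  have n2 : theta q z ≠ 0 := theta_ne_zero hq hq0 hz'
  apply mul_left_cancel₀ (mul_ne_zero n1 n2)
  linear_combination -E

/-! ### The coordinate series -/

/-- `∑_{n ∈ ℤ} q ^ n u / (1 - q ^ n u) ^ 2`. -/
noncomputable def xSum (q u : K) : K := ∑' n : ℤ, q ^ n * u / (1 - q ^ n * u) ^ 2

/-- `∑_{n ∈ ℤ} (q ^ n u) ^ 2 / (1 - q ^ n u) ^ 3`. -/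
noncomputable def ySum (q u : K) : K := ∑' n : ℤ, (q ^ n * u) ^ 2 / (1 - q ^ n * u) ^ 3

/-- Treats both ends of ℤ at once: `φ` near 0 governs n → +∞, and `ψ`, which is `φ` in the
coordinate at infinity, governs n → -∞. In the ultrametric setting this limit is all that
summability requires. -/
theorem tendsto_zpow_orbit {q : K} (hq : ‖q‖ < 1) (hq0 : q ≠ 0) {u : K} (hu0 : u ≠ 0)
    {φ ψ : K → K} (hφ : ContinuousAt φ 0) (hφ0 : φ 0 = 0) (hψ : ContinuousAt ψ 0) (hψ0 : ψ 0 = 0)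
    (h : ∀ y, y ≠ 0 → φ y⁻¹ = ψ y) :
    Tendsto (fun n : ℤ => φ (q ^ n * u)) cofinite (𝓝 0) := by
  rw [Int.cofinite_eq, tendsto_sup]
  constructor
  · have h1 : Tendsto (fun n : ℕ => ψ (q ^ n * u⁻¹)) atTop (𝓝 0) := by
      have := hψ.tendsto.comp (tendsto_pow_mul hq u⁻¹)
      rwa [hψ0] at this
    have h2 : Tendsto (fun n : ℤ => (-n).toNat) atBot atTop :=
      tendsto_atTop.2 fun b => (eventually_le_atBot (-(b : ℤ))).mono fun n hn => by omega
    refine (h1.comp h2).congr' ?_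
    filter_upwards [eventually_le_atBot 0] with n hn
    rw [Function.comp, ← h _ (mul_ne_zero (pow_ne_zero _ hq0) (inv_ne_zero hu0)), mul_inv, inv_inv,
      ← zpow_natCast, ← zpow_neg, show -((-n).toNat : ℤ) = n by omega]
  · have h1 : Tendsto (fun n : ℕ => φ (q ^ n * u)) atTop (𝓝 0) := by
      have := hφ.tendsto.comp (tendsto_pow_mul hq u)
      rwa [hφ0] at this
    have h2 : Tendsto Int.toNat atTop atTop :=
      tendsto_atTop.2 fun b => (eventually_ge_atTop (b : ℤ)).mono fun n hn => by omega
    refine (h1.comp h2).congr' ?_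
    filter_upwards [eventually_ge_atTop 0] with n hn
    rw [Function.comp, ← zpow_natCast, show (n.toNat : ℤ) = n by omega]

theorem summable_xSum {q : K} (hq : ‖q‖ < 1) (hq0 : q ≠ 0) {u : K} (hu0 : u ≠ 0) :
    Summable fun n : ℤ => q ^ n * u / (1 - q ^ n * u) ^ 2 := by
  refine NonarchimedeanAddGroup.summable_of_tendsto_cofinite_zero
    (tendsto_zpow_orbit hq hq0 hu0 (φ := fun x => x / (1 - x) ^ 2) (ψ := fun x => x / (x - 1) ^ 2)
    ?_ (by simp) ?_ (by simp) fun y hy => ?_)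
  · exact continuousAt_id.div (by fun_prop) (by simp)
  · exact continuousAt_id.div (by fun_prop) (by simp)
  · rw [show 1 - y⁻¹ = (y - 1) / y by field_simp, div_pow, div_div_eq_mul_div]
    congr 1
    field_simp

theorem summable_ySum {q : K} (hq : ‖q‖ < 1) (hq0 : q ≠ 0) {u : K} (hu0 : u ≠ 0) :
    Summable fun n : ℤ => (q ^ n * u) ^ 2 / (1 - q ^ n * u) ^ 3 := by
  refine NonarchimedeanAddGroup.summable_of_tendsto_cofinite_zero
    (tendsto_zpow_orbit hq hq0 hu0 (φ := fun x => x ^ 2 / (1 - x) ^ 3)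
    (ψ := fun x => x / (x - 1) ^ 3) ?_ (by simp) ?_ (by simp) fun y hy => ?_)
  · exact (continuousAt_id.pow 2).div (by fun_prop) (by simp)
  · exact continuousAt_id.div (by fun_prop) (by simp)
  · rw [show 1 - y⁻¹ = (y - 1) / y by field_simp, div_pow, div_div_eq_mul_div]
    congr 1
    field_simp

theorem xSum_inv {q : K} (hq0 : q ≠ 0) {u : K} (hu0 : u ≠ 0) (hu : ∀ n : ℤ, q ^ n * u ≠ 1) :
    xSum q u⁻¹ = xSum q u := by
  rw [xSum, xSum, ← (Equiv.neg ℤ).tsum_eq]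
  refine tsum_congr fun n => ?_
  have h1 := sub_ne_zero.2 (hu n)
  have h2 : 1 - q ^ n * u ≠ 0 := sub_ne_zero.2 (hu n).symm
  have := zpow_ne_zero n hq0
  have e : 1 - q ^ (-n) * u⁻¹ = (q ^ n * u - 1) / (q ^ n * u) := by
    rw [zpow_neg]; field_simp
  simp only [Equiv.neg_apply]
  rw [e, zpow_neg, div_pow, div_div_eq_mul_div]
  field_simp
  ring

theorem ySum_inv {q : K} (hq : ‖q‖ < 1) (hq0 : q ≠ 0) {u : K} (hu0 : u ≠ 0)
    (hu : ∀ n : ℤ, q ^ n * u ≠ 1) : ySum q u⁻¹ = -ySum q u - xSum q u := by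
  rw [ySum, ySum, xSum, ← (Equiv.neg ℤ).tsum_eq, ← tsum_neg, ← Summable.tsum_sub
    (summable_ySum hq hq0 hu0).neg (summable_xSum hq hq0 hu0)]
  refine tsum_congr fun n => ?_
  have h1 := sub_ne_zero.2 (hu n)
  have h2 : 1 - q ^ n * u ≠ 0 := sub_ne_zero.2 (hu n).symm
  have := zpow_ne_zero n hq0
  have e : 1 - q ^ (-n) * u⁻¹ = (q ^ n * u - 1) / (q ^ n * u) := by
    rw [zpow_neg]; field_simp
  simp only [Equiv.neg_apply]
  rw [e, zpow_neg, div_pow, div_div_eq_mul_div]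
  field_simp
  ring

theorem xSum_zpow_mul {q : K} (hq0 : q ≠ 0) (u : K) (m : ℤ) : xSum q (q ^ m * u) = xSum q u := by
  rw [xSum, xSum, ← (Equiv.addRight m).tsum_eq (fun n : ℤ => q ^ n * u / (1 - q ^ n * u) ^ 2)]
  exact tsum_congr fun n => by simp [zpow_add₀ hq0, mul_assoc]

theorem ySum_zpow_mul {q : K} (hq0 : q ≠ 0) (u : K) (m : ℤ) : ySum q (q ^ m * u) = ySum q u := by
  rw [ySum, ySum,
    ← (Equiv.addRight m).tsum_eq (fun n : ℤ => (q ^ n * u) ^ 2 / (1 - q ^ n * u) ^ 3)]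
  exact tsum_congr fun n => by simp [zpow_add₀ hq0, mul_assoc]

/-- The difference quotient of the zeta function. -/
noncomputable def zetaQuot (q u t : K) : K :=
  ∑' n : ℤ, q ^ n * u / ((1 - q ^ n * u) * (1 - q ^ n * u * (1 + t)))

theorem exists_bound_of_tendsto_cofinite {ι : Type*} {f : ι → K}
    (h : Tendsto f cofinite (𝓝 0)) : ∃ C : ℝ, 0 < C ∧ ∀ i, ‖f i‖ ≤ C := by
  obtain ⟨C, hC⟩ := h.norm.bddAbove_range_of_cofinite
  exact ⟨max C 1, lt_of_lt_of_le one_pos (le_max_right _ _),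
    fun i => (hC ⟨i, rfl⟩).trans (le_max_left _ _)⟩

theorem hasSum_zetaSum' {q : K} (hq : ‖q‖ < 1) (hq0 : q ≠ 0) {u : K} (hu0 : u ≠ 0)
    (hu : ∀ n : ℤ, q ^ n * u ≠ 1) :
    HasSum (fun n : ℤ => q ^ n * u / (1 - q ^ n * u) + if n < 0 then 1 else 0)
      (zetaSum q u) := (hasSum_zetaSum hq hq0 hu0 hu).summable.hasSum

theorem exists_bound_rho {q : K} (hq : ‖q‖ < 1) (hq0 : q ≠ 0) {u : K} (hu0 : u ≠ 0)
    (hu : ∀ n : ℤ, q ^ n * u ≠ 1) :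
    ∃ C : ℝ, 0 < C ∧ ∀ n : ℤ, ‖q ^ n * u / (1 - q ^ n * u)‖ ≤ C := by
  obtain ⟨C, h0, hC⟩ := exists_bound_of_tendsto_cofinite
    (hasSum_zetaSum' hq hq0 hu0 hu).summable.tendsto_cofinite_zero
  refine ⟨max C 1, lt_of_lt_of_le h0 (le_max_left _ _), fun n => ?_⟩
  have := norm_sub_le_max' (q ^ n * u / (1 - q ^ n * u) + if n < 0 then (1 : K) else 0)
    (if n < 0 then (1 : K) else 0)
  rw [add_sub_cancel_right] at this
  refine this.trans (max_le_max (hC n) ?_)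
  split_ifs <;> simp

theorem norm_one_sub_of_lt {a : K} (h : ‖a‖ < 1) : ‖1 - a‖ = 1 := by
  have h : ‖-a‖ < ‖(1 : K)‖ := by simpa
  rw [sub_eq_add_neg, IsUltrametricDist.norm_add_eq_max_of_norm_ne_norm h.ne', max_eq_left h.le,
    norm_one]

/-- The ratios qⁿu / (1 - qⁿu) are bounded uniformly in n. Hence one small radius for t serves all
n: the denominators keep their norms and u(1 + t) stays generic. -/
theorem exists_norm_one_sub_mul_eq {q : K} (hq : ‖q‖ < 1) (hq0 : q ≠ 0) {u : K} (hu0 : u ≠ 0)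
    (hu : ∀ n : ℤ, q ^ n * u ≠ 1) :
    ∃ δ : ℝ, 0 < δ ∧ ∀ t : K, ‖t‖ < δ → 1 + t ≠ 0 ∧
      ∀ n : ℤ, ‖1 - q ^ n * u * (1 + t)‖ = ‖1 - q ^ n * u‖ := by
  obtain ⟨C, h0, hC⟩ := exists_bound_rho hq hq0 hu0 hu
  refine ⟨min 1 C⁻¹, by positivity, fun t ht => ⟨fun h => ?_, fun n => ?_⟩⟩
  · rw [show t = -1 by linear_combination h] at ht
    simp at ht
  · have h2 : 1 - q ^ n * u ≠ 0 := sub_ne_zero.2 (hu n).symm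
    have e : 1 - q ^ n * u * (1 + t) = (1 - q ^ n * u) * (1 - q ^ n * u / (1 - q ^ n * u) * t) := by
      field_simp
      ring
    rw [e, norm_mul, norm_one_sub_of_lt (a := q ^ n * u / (1 - q ^ n * u) * t), mul_one]
    rw [norm_mul]
    calc _ ≤ C * ‖t‖ := mul_le_mul_of_nonneg_right (hC n) (norm_nonneg _)
      _ < C * C⁻¹ := mul_lt_mul_of_pos_left (ht.trans_le (min_le_right _ _)) h0
      _ = 1 := mul_inv_cancel₀ h0.ne'

theorem zpow_mul_ne_one_of_norm {q u t : K} (hu : ∀ n : ℤ, q ^ n * u ≠ 1)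
    (ht : ∀ n : ℤ, ‖1 - q ^ n * u * (1 + t)‖ = ‖1 - q ^ n * u‖) (n : ℤ) :
    q ^ n * (u * (1 + t)) ≠ 1 := fun h => by
  have := ht n
  rw [mul_assoc, h, sub_self, norm_zero] at this
  exact sub_ne_zero.2 (hu n).symm (norm_eq_zero.1 this.symm)

theorem zetaSum_mul_one_add {q : K} (hq : ‖q‖ < 1) (hq0 : q ≠ 0) {u t : K} (hu0 : u ≠ 0)
    (hu : ∀ n : ℤ, q ^ n * u ≠ 1) (ht : 1 + t ≠ 0) (ht' : ∀ n : ℤ, q ^ n * (u * (1 + t)) ≠ 1) :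
    zetaSum q (u * (1 + t)) - zetaSum q u = t * zetaQuot q u t := by
  have h := (hasSum_zetaSum' hq hq0 (mul_ne_zero hu0 ht) ht').sub (hasSum_zetaSum' hq hq0 hu0 hu)
  rw [← h.tsum_eq, zetaQuot, ← tsum_mul_left]
  refine tsum_congr fun n => ?_
  have h1 : 1 - q ^ n * u ≠ 0 := sub_ne_zero.2 (hu n).symm
  have h2 : 1 - q ^ n * u * (1 + t) ≠ 0 := sub_ne_zero.2 (by rw [mul_assoc]; exact (ht' n).symm)
  rw [add_sub_add_right_eq_sub, ← mul_assoc (q ^ n)]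
  field_simp
  ring

theorem hasDerivAt_of_norm_le {F : K → K} {x F' : K} {C δ : ℝ} (hδ : 0 < δ)
    (h : ∀ t : K, ‖t‖ < δ → ‖F (x + t) - F x - t * F'‖ ≤ C * ‖t‖ ^ 2) : HasDerivAt F F' x := by
  rw [hasDerivAt_iff_isLittleO_nhds_zero]
  refine Asymptotics.IsBigO.trans_isLittleO (g := fun h : K => ‖h‖ ^ 2) ?_ ?_
  · refine Asymptotics.IsBigO.of_bound C ?_
    filter_upwards [Metric.ball_mem_nhds (0 : K) hδ] with t ht
    simpa using h t (by simpa using ht)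
  · simpa using (Asymptotics.isLittleO_norm_pow_id (E' := K) one_lt_two)

/-- With `zetaQuot_zero` this gives ζ(u(1+t)) = ζ(u) + t · xSum + t² · ySum + …. The difference
quotient replaces the second derivative of ζ, which would lose a factor 2. The remainder is t² times
a series dominated by (qⁿu)³ / (1 - qⁿu)⁴. -/
theorem hasDerivAt_zetaQuot {q : K} (hq : ‖q‖ < 1) (hq0 : q ≠ 0) {u : K} (hu0 : u ≠ 0)
    (hu : ∀ n : ℤ, q ^ n * u ≠ 1) : HasDerivAt (zetaQuot q u) (ySum q u) 0 := by
  obtain ⟨δ, hδ, h⟩ := exists_norm_one_sub_mul_eq hq hq0 hu0 hu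
  have lim : Tendsto (fun n : ℤ => (q ^ n * u) ^ 3 / (1 - q ^ n * u) ^ 4) cofinite (𝓝 0) := by
    refine tendsto_zpow_orbit hq hq0 hu0 (φ := fun x => x ^ 3 / (1 - x) ^ 4)
      (ψ := fun x => x / (x - 1) ^ 4) ?_ (by simp) ?_ (by simp) fun y hy => ?_
    · exact (continuousAt_id.pow 3).div (by fun_prop) (by simp)
    · exact continuousAt_id.div (by fun_prop) (by simp)
    · rw [show 1 - y⁻¹ = (y - 1) / y by field_simp, div_pow, div_div_eq_mul_div]
      congr 1
      field_simp
  obtain ⟨C, hC0, hC⟩ := exists_bound_of_tendsto_cofinite lim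
  have hs : ∀ t : K, 1 + t ≠ 0 → Summable fun n : ℤ =>
      q ^ n * u / ((1 - q ^ n * u) * (1 - q ^ n * u * (1 + t))) := fun t ht => by
    refine NonarchimedeanAddGroup.summable_of_tendsto_cofinite_zero
      (tendsto_zpow_orbit hq hq0 hu0 (φ := fun x => x / ((1 - x) * (1 - x * (1 + t))))
      (ψ := fun x => x / ((x - 1) * (x - (1 + t)))) ?_ (by simp) ?_ (by simp) fun y hy => ?_)
    · exact continuousAt_id.div (by fun_prop) (by simp)
    · exact continuousAt_id.div (by fun_prop) (by simpa [neg_add_eq_zero, eq_comm] using ht)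
    · rw [show 1 - y⁻¹ = (y - 1) / y by field_simp,
        show 1 - y⁻¹ * (1 + t) = (y - (1 + t)) / y by field_simp, div_mul_div_comm,
        div_div_eq_mul_div]
      congr 1
      field_simp
  refine hasDerivAt_of_norm_le (C := C) hδ fun t ht => ?_
  obtain ⟨ht1, ht2⟩ := h t ht
  have e : zetaQuot q u (0 + t) - zetaQuot q u 0 - t * ySum q u =
      t ^ 2 * ∑' n : ℤ, (q ^ n * u) ^ 3 / ((1 - q ^ n * u) ^ 3 * (1 - q ^ n * u * (1 + t))) := by
    rw [zero_add, zetaQuot, zetaQuot, ySum, ← Summable.tsum_sub (hs t ht1) (hs 0 (by simp)),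
      ← tsum_mul_left, ← Summable.tsum_sub ((hs t ht1).sub (hs 0 (by simp)))
        ((summable_ySum hq hq0 hu0).mul_left t), ← tsum_mul_left]
    refine tsum_congr fun n => ?_
    have h1 : 1 - q ^ n * u ≠ 0 := sub_ne_zero.2 (hu n).symm
    have h2 : 1 - q ^ n * u * (1 + t) ≠ 0 := by rw [← norm_ne_zero_iff, ht2, norm_ne_zero_iff]; exact h1
    rw [add_zero, mul_one]
    field_simp
    ring
  rw [e, norm_mul, norm_pow, mul_comm]
  refine mul_le_mul_of_nonneg_right ?_ (by positivity)
  refine IsUltrametricDist.norm_tsum_le_of_forall_le_of_nonneg hC0.le fun n => ?_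
  refine le_trans (le_of_eq ?_) (hC n)
  rw [norm_div, norm_mul, ht2, norm_div, ← norm_mul, ← pow_succ]

theorem zetaQuot_zero (q u : K) : zetaQuot q u 0 = xSum q u :=
  tsum_congr fun n => by rw [add_zero, mul_one, sq]

/-! ### Differences of coordinates -/

theorem eventually_generic {q : K} (hq : ‖q‖ < 1) (hq0 : q ≠ 0) {u : K} (hu0 : u ≠ 0)
    (hu : ∀ n : ℤ, q ^ n * u ≠ 1) :
    ∀ᶠ t : K in 𝓝 0, ∀ n : ℤ, q ^ n * (u * (1 + t)) ≠ 1 := by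
  obtain ⟨δ, hδ, h⟩ := exists_norm_one_sub_mul_eq hq hq0 hu0 hu
  filter_upwards [Metric.ball_mem_nhds (0 : K) hδ] with t ht
  exact zpow_mul_ne_one_of_norm hu (h t (by simpa using ht)).2

theorem zpow_ne_one_of_norm {q t : K} (hq : ‖q‖ < 1) (hq0 : q ≠ 0) (ht : ‖t‖ < 1) (ht0 : t ≠ 0)
    (n : ℤ) : q ^ n * (1 + t) ≠ 1 := fun h => by
  have h1 : ‖1 + t‖ = 1 := by
    have := norm_one_sub_of_lt (a := -t) (by simpa using ht)
    rwa [sub_neg_eq_add] at this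
  have h2 := congrArg norm h
  rw [norm_mul, h1, mul_one, norm_one, norm_zpow] at h2
  rcases lt_trichotomy n 0 with hn | rfl | hn
  · exact absurd h2 (one_lt_zpow_of_neg₀ (norm_pos_iff.2 hq0) hq hn).ne'
  · simp [ht0] at h
  · exact absurd h2 (zpow_lt_one₀ (norm_pos_iff.2 hq0) hq hn).ne

theorem continuousAt_eq_of_eventually {F G : K → K} (hF : ContinuousAt F 0)
    (hG : ContinuousAt G 0) (h : ∀ᶠ t in 𝓝[≠] (0 : K), F t = G t) : F =ᶠ[𝓝 0] G := by
  have h0 : F 0 = G 0 := tendsto_nhds_unique_of_eventuallyEq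
    (hF.tendsto.mono_left nhdsWithin_le_nhds) (hG.tendsto.mono_left nhdsWithin_le_nhds) h
  rw [eventually_nhdsWithin_iff] at h
  filter_upwards [h] with t ht
  by_cases h1 : t = 0
  · rw [h1, h0]
  · exact ht h1

/-- The right hand side of the addition formula along `z = (1 + t) x⁻¹`. -/
theorem zetaQuot_sub {q : K} (hq : ‖q‖ < 1) (hq0 : q ≠ 0) {x y : K} (hx : x ≠ 0)
    (hy : y ≠ 0) (hx' : ∀ n : ℤ, q ^ n * x ≠ 1) (hy' : ∀ n : ℤ, q ^ n * y ≠ 1) :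
    (fun t => zetaQuot q x t - zetaQuot q y t) =ᶠ[𝓝 0] fun t =>
      -(thetaReg q 1 * theta q (x⁻¹ * y) * (theta q (x * y * (1 + t)) * thetaReg q (1 + t))) /
        (theta q x⁻¹ * theta q y * (theta q (x * (1 + t)) * theta q (y * (1 + t)))) := by
  have hd : ∀ w : K, HasDerivAt (fun t : K => w * (1 + t)) w 0 := fun w => by
    simpa using ((hasDerivAt_id (0 : K)).const_add 1).const_mul w
  have hxi := inv_ne_zero hx
  have hxi' := zpow_mul_inv_ne_one hx'
  have ct : ∀ w : K, w ≠ 0 → ContinuousAt (fun t : K => theta q (w * (1 + t))) 0 := fun w hw =>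
    (DifferentiableAt.fun_comp' 0 (differentiableAt_theta hq (by simpa))
      (hd w).differentiableAt).continuousAt
  have cr : ContinuousAt (fun t : K => thetaReg q (1 + t)) 0 := by
    have := (DifferentiableAt.fun_comp' 0 (differentiableAt_thetaReg hq (by simp))
      (hd 1).differentiableAt).continuousAt
    simpa using this
  have n1 := theta_ne_zero hq hq0 hxi'
  have n2 := theta_ne_zero hq hq0 hy'
  have n3 := theta_ne_zero hq hq0 hx'
  -- The identity is proved for t ≠ 0 and extended to t = 0 by continuity.
  refine continuousAt_eq_of_eventually ((hasDerivAt_zetaQuot hq hq0 hx hx').continuousAt.sub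
    (hasDerivAt_zetaQuot hq hq0 hy hy').continuousAt) ?_ ?_
  · refine ((continuousAt_const.mul ((ct _ (mul_ne_zero hx hy)).mul cr)).neg).div
      (continuousAt_const.mul ((ct _ hx).mul (ct _ hy))) ?_
    simp [n1, n2, n3]
  · rw [eventually_nhdsWithin_iff]
    filter_upwards [eventually_generic hq hq0 hx hx', eventually_generic hq hq0 hy hy',
      Metric.ball_mem_nhds (0 : K) one_pos] with t h1 h2 h3 ht0
    have h3 : ‖t‖ < 1 := by simpa using h3
    have ht : 1 + t ≠ 0 := fun h => by
      rw [show t = -1 by linear_combination h] at h3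
      simp at h3
    have ht0 : t ≠ 0 := ht0
    -- The triple x⁻¹, y, x(1 + t) has product y(1 + t), so both increments of ζ appear. The factor
    -- θ(1 + t) = -t · thetaReg(1 + t) supplies the t that is cancelled below.
    have m := zetaSum_add hq hq0 hxi hy (mul_ne_zero hx ht) hxi' hy' h1
      (by rwa [show x⁻¹ * y * (x * (1 + t)) = y * (1 + t) by field_simp])
    rw [show x⁻¹ * y * (x * (1 + t)) = y * (1 + t) by field_simp,
      show x⁻¹ * (x * (1 + t)) = 1 + t by field_simp,
      show y * (x * (1 + t)) = x * y * (1 + t) by ring, theta_eq hq (1 + t),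
      zetaSum_inv hq hq0 hx hx'] at m
    have e1 := zetaSum_mul_one_add hq hq0 hx hx' ht h1
    have e2 := zetaSum_mul_one_add hq hq0 hy hy' ht h2
    have n4 := theta_ne_zero hq hq0 h1
    have n5 := theta_ne_zero hq hq0 h2
    rw [eq_div_iff (mul_ne_zero (mul_ne_zero n1 n2) (mul_ne_zero n4 n5))]
    apply mul_left_cancel₀ ht0
    linear_combination m - (theta q x⁻¹ * theta q y * (theta q (x * (1 + t)) *
      theta q (y * (1 + t)))) * (e1 - e2)

theorem xSum_sub {q : K} (hq : ‖q‖ < 1) (hq0 : q ≠ 0) {x y : K} (hx : x ≠ 0)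
    (hy : y ≠ 0) (hx' : ∀ n : ℤ, q ^ n * x ≠ 1) (hy' : ∀ n : ℤ, q ^ n * y ≠ 1) :
    (xSum q x - xSum q y) * (theta q x ^ 2 * theta q y ^ 2) =
      thetaReg q 1 ^ 2 * (x * theta q (x⁻¹ * y) * theta q (x * y)) := by
  have h := (zetaQuot_sub hq hq0 hx hy hx' hy').self_of_nhds
  simp only [zetaQuot_zero, add_zero, mul_one] at h
  have n1 := theta_ne_zero hq hq0 hx'
  have n2 := theta_ne_zero hq hq0 hy'
  rw [h, theta_inv hq hx]
  field_simp

/-- Compare the derivatives at t = 0 in `zetaQuot_sub`. As `thetaReg` is stationary at 1, the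
logarithmic derivative of the right-hand side is -ζ(xy) + ζ(x) + ζ(y). -/
theorem ySum_sub {q : K} (hq : ‖q‖ < 1) (hq0 : q ≠ 0) {x y : K} (hx : x ≠ 0)
    (hy : y ≠ 0) (hx' : ∀ n : ℤ, q ^ n * x ≠ 1) (hy' : ∀ n : ℤ, q ^ n * y ≠ 1)
    (hxy : ∀ n : ℤ, q ^ n * (x * y) ≠ 1) :
    ySum q x - ySum q y =
      (xSum q x - xSum q y) * (zetaSum q x + zetaSum q y - zetaSum q (x * y)) := by
  have hd : ∀ w : K, HasDerivAt (fun t : K => w * (1 + t)) w 0 := fun w => by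
    simpa using ((hasDerivAt_id (0 : K)).const_add 1).const_mul w
  have n0 := theta_ne_zero hq hq0 (zpow_mul_inv_ne_one hx')
  have n1 := theta_ne_zero hq hq0 hx'
  have n2 := theta_ne_zero hq hq0 hy'
  have t1 : ∀ w : K, w ≠ 0 → (∀ n : ℤ, q ^ n * w ≠ 1) → HasDerivAt
      (fun t : K => theta q (w * (1 + t))) (-(theta q w * zetaSum q w)) 0 := fun w hw hw' => by
    have h := hasDerivAt_theta hq hq0 hw hw'
    rw [show w = w * (1 + 0) by simp] at h
    refine (h.comp (0 : K) (hd w)).congr_deriv ?_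
    simp only [add_zero, mul_one]
    field_simp
  have t2 : HasDerivAt (fun t : K => thetaReg q (1 + t)) 0 0 := by
    have h := hasDerivAt_thetaReg_one hq
    rw [show (1 : K) = 1 * (1 + 0) by simp] at h
    simpa [Function.comp_def] using h.comp (0 : K) (hd 1)
  have D := ((((t1 _ (mul_ne_zero hx hy) hxy).mul t2).const_mul
      (thetaReg q 1 * theta q (x⁻¹ * y))).neg).div
    (((t1 x hx hx').mul (t1 y hy hy')).const_mul (theta q x⁻¹ * theta q y))
    (by simp [n0, n1, n2])
  have h := zetaQuot_sub hq hq0 hx hy hx' hy'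
  have E := ((hasDerivAt_zetaQuot hq hq0 hx hx').sub
    (hasDerivAt_zetaQuot hq hq0 hy hy')).unique (D.congr_of_eventuallyEq h)
  have h0 := h.self_of_nhds
  simp only [zetaQuot_zero, add_zero, mul_one] at h0
  rw [E, h0]
  simp only [add_zero, mul_one, mul_zero, Pi.mul_apply, Pi.neg_apply]
  field_simp
  ring

/-! ### The cubic equation -/

/-- `u` does not lie in `q ^ ℤ`. -/
def Generic (q u : K) : Prop := ∀ n : ℤ, q ^ n * u ≠ 1

theorem Generic.inv {q u : K} (h : Generic q u) : Generic q u⁻¹ := zpow_mul_inv_ne_one h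

theorem Generic.of_eq {q u v : K} (h : Generic q u) (e : u = v) : Generic q v := e ▸ h

/-- The first coordinate of the point with parameter `u`. -/
noncomputable def xFun (q u : K) : K := xSum q u - 2 * sumS 1 q

/-- The second coordinate of the point with parameter `u`. -/
noncomputable def yFun (q u : K) : K := ySum q u + sumS 1 q

theorem xFun_inv {q : K} (hq0 : q ≠ 0) {u : K} (hu0 : u ≠ 0) (hu : Generic q u) :
    xFun q u⁻¹ = xFun q u := by rw [xFun, xFun, xSum_inv hq0 hu0 hu]

theorem yFun_inv {q : K} (hq : ‖q‖ < 1) (hq0 : q ≠ 0) {u : K} (hu0 : u ≠ 0) (hu : Generic q u) :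
    yFun q u⁻¹ = -yFun q u - xFun q u := by
  rw [yFun, yFun, xFun, ySum_inv hq hq0 hu0 hu]; ring

theorem xFun_sub {q : K} (hq : ‖q‖ < 1) (hq0 : q ≠ 0) {x y : K} (hx : x ≠ 0)
    (hy : y ≠ 0) (hx' : Generic q x) (hy' : Generic q y) :
    (xFun q x - xFun q y) * (theta q x ^ 2 * theta q y ^ 2) =
      thetaReg q 1 ^ 2 * (x * theta q (x⁻¹ * y) * theta q (x * y)) := by
  rw [← xSum_sub hq hq0 hx hy hx' hy', xFun, xFun, sub_sub_sub_cancel_right]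

theorem yFun_sub {q : K} (hq : ‖q‖ < 1) (hq0 : q ≠ 0) {x y : K} (hx : x ≠ 0)
    (hy : y ≠ 0) (hx' : Generic q x) (hy' : Generic q y) (hxy : Generic q (x * y)) :
    yFun q x - yFun q y =
      (xFun q x - xFun q y) * (zetaSum q x + zetaSum q y - zetaSum q (x * y)) := by
  have := ySum_sub hq hq0 hx hy hx' hy' hxy
  rw [yFun, yFun, xFun, xFun, sub_sub_sub_cancel_right, add_sub_add_right_eq_sub, this]

theorem xFun_ne {q : K} (hq : ‖q‖ < 1) (hq0 : q ≠ 0) {x y : K} (hx : x ≠ 0)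
    (hy : y ≠ 0) (hx' : Generic q x) (hy' : Generic q y) (h1 : Generic q (x⁻¹ * y))
    (h2 : Generic q (x * y)) : xFun q x ≠ xFun q y := fun h => by
  have := xFun_sub hq hq0 hx hy hx' hy'
  rw [h, sub_self, zero_mul] at this
  exact mul_ne_zero (pow_ne_zero 2 (thetaReg_one_ne_zero hq)) (mul_ne_zero (mul_ne_zero hx
    (theta_ne_zero hq hq0 h1)) (theta_ne_zero hq hq0 h2)) this.symm

/-- The product of the values of a line at a point and its negative. -/
theorem line_mul_line_neg {q : K} (hq : ‖q‖ < 1) (hq0 : q ≠ 0) {x y w v : K} (hx : x ≠ 0)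
    (hy : y ≠ 0) (hv : v ≠ 0) (hxyw : x * y * w = 1) (hx' : Generic q x) (hy' : Generic q y)
    (hw' : Generic q w) (hv' : Generic q v) (hwv : Generic q (w * v))
    (hwv' : Generic q (w * v⁻¹)) :
    (yFun q v - (yFun q w + (zetaSum q x + zetaSum q y + zetaSum q w + 1) *
        (xFun q v - xFun q w))) *
      (-yFun q v - xFun q v - (yFun q w + (zetaSum q x + zetaSum q y + zetaSum q w + 1) *
        (xFun q v - xFun q w))) =
      -((xFun q v - xFun q x) * (xFun q v - xFun q y) * (xFun q v - xFun q w)) := by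
  have hw : w ≠ 0 := right_ne_zero_of_mul_eq_one hxyw
  have hvi := inv_ne_zero hv
  have m1 := zetaSum_add hq hq0 hx hy (mul_ne_zero hw hv) hx' hy' hwv
    (by rwa [← mul_assoc, hxyw, one_mul])
  have m2 := zetaSum_add hq hq0 hx hy (mul_ne_zero hw hvi) hx' hy' hwv'
    (by rw [← mul_assoc, hxyw, one_mul]; exact hv'.inv)
  rw [← mul_assoc (x * y), hxyw, one_mul] at m1 m2
  have l1 := yFun_sub hq hq0 hv hw hv' hw' (hwv.of_eq (mul_comm _ _))
  have l2 := yFun_sub hq hq0 hvi hw hv'.inv hw' (hwv'.of_eq (mul_comm _ _))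
  rw [yFun_inv hq hq0 hv hv', xFun_inv hq0 hv hv'] at l2
  rw [mul_comm v w] at l1
  rw [mul_comm v⁻¹ w] at l2
  have d1 := xFun_sub hq hq0 hv hx hv' hx'
  have d2 := xFun_sub hq hq0 hv hy hv' hy'
  have d3 := xFun_sub hq hq0 hv hw hv' hw'
  have i : ∀ {a b : K}, a ≠ 0 → b = a⁻¹ → theta q b = -b * theta q a := fun ha hb => by
    rw [hb, theta_inv hq ha]
  have e1 : theta q (x * y) = -(x * y) * theta q w := i hw (eq_inv_of_mul_eq_one_left hxyw)
  have ey : x * w = y⁻¹ := eq_inv_of_mul_eq_one_left (by rw [← hxyw]; ring)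
  have ex : y * w = x⁻¹ := eq_inv_of_mul_eq_one_left (by rw [← hxyw]; ring)
  rw [← mul_assoc x, ← mul_assoc y, ey, ex, e1] at m1 m2
  have e2 : theta q (y⁻¹ * v) = -(y⁻¹ * v) * theta q (v⁻¹ * y) :=
    i (mul_ne_zero hvi hy) (by rw [mul_inv, inv_inv, mul_comm])
  have e3 : theta q (x⁻¹ * v) = -(x⁻¹ * v) * theta q (v⁻¹ * x) :=
    i (mul_ne_zero hvi hx) (by rw [mul_inv, inv_inv, mul_comm])
  have e4 : theta q (y⁻¹ * v⁻¹) = -(y⁻¹ * v⁻¹) * theta q (v * y) :=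
    i (mul_ne_zero hv hy) (by rw [mul_inv, mul_comm])
  have e5 : theta q (x⁻¹ * v⁻¹) = -(x⁻¹ * v⁻¹) * theta q (v * x) :=
    i (mul_ne_zero hv hx) (by rw [mul_inv, mul_comm])
  rw [e2, e3] at m1
  rw [e4, e5, theta_inv hq hv] at m2
  rw [mul_comm v⁻¹ w, mul_comm v w] at d3
  have nx := theta_ne_zero hq hq0 hx'
  have ny := theta_ne_zero hq hq0 hy'
  have nv := theta_ne_zero hq hq0 hv'
  have nw := theta_ne_zero hq hq0 hw'
  have n1 := theta_ne_zero hq hq0 hwv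
  have n2 := theta_ne_zero hq hq0 hwv'
  have nc := thetaReg_one_ne_zero hq
  set Zx := zetaSum q x
  set Zy := zetaSum q y
  set Zw := zetaSum q w
  set c := thetaReg q 1
  set H1 := Zx + Zy + zetaSum q (w * v) - zetaSum q v + 1 with hH1
  set H2 := Zx + Zy + zetaSum q (w * v⁻¹) - zetaSum q v⁻¹ + 1 with hH2
  -- The slope of the chord through v and w differs from that of the given line by `H1`, a
  -- combination of ζ that `zetaSum_add` turns into a theta quotient. The same holds for v⁻¹ and
  -- `H2`.
  have k1 : yFun q v - (yFun q w + (Zx + Zy + Zw + 1) * (xFun q v - xFun q w)) =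
      -H1 * (xFun q v - xFun q w) := by rw [hH1]; linear_combination l1
  have k2 : -yFun q v - xFun q v - (yFun q w + (Zx + Zy + Zw + 1) * (xFun q v - xFun q w)) =
      -H2 * (xFun q v - xFun q w) := by rw [hH2]; linear_combination l2
  -- After clearing denominators, the theta factors of `H1`, `H2` and X(v) - X(w) regroup into those
  -- of X(v) - X(x) and X(v) - X(y).
  have key : H1 * H2 * (xFun q v - xFun q w) =
      -((xFun q v - xFun q x) * (xFun q v - xFun q y)) := by
    have m1' : H1 * (theta q x * theta q y * theta q (w * v) * theta q v) =
        -(c * v ^ 2 * theta q w * theta q (v⁻¹ * y) * theta q (v⁻¹ * x)) := by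
      rw [m1]; field_simp
    have m2' : H2 * (theta q x * theta q y * theta q (w * v⁻¹) * theta q v) =
        c * v⁻¹ * theta q w * theta q (v * y) * theta q (v * x) := by
      have : H2 * (theta q x * theta q y * theta q (w * v⁻¹) * theta q v) =
        -v * (H2 * (theta q x * theta q y * theta q (w * v⁻¹) * (-v⁻¹ * theta q v))) := by
          field_simp
      rw [this, m2]; field_simp
    have hM : theta q x ^ 2 * theta q y ^ 2 * theta q (w * v) * theta q (w * v⁻¹) *
        theta q v ^ 4 * theta q w ^ 2 ≠ 0 := by simp [nx, ny, nv, nw, n1, n2]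
    refine mul_right_cancel₀ hM ?_
    calc _ = (H1 * (theta q x * theta q y * theta q (w * v) * theta q v)) *
          (H2 * (theta q x * theta q y * theta q (w * v⁻¹) * theta q v)) *
          ((xFun q v - xFun q w) * (theta q v ^ 2 * theta q w ^ 2)) := by ring
      _ = -(((xFun q v - xFun q x) * (theta q v ^ 2 * theta q x ^ 2)) *
          ((xFun q v - xFun q y) * (theta q v ^ 2 * theta q y ^ 2))) *
          (theta q (w * v) * theta q (w * v⁻¹) * theta q w ^ 2) := by
        rw [m1', m2', d1, d2, d3]; field_simp
      _ = _ := by ring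
  rw [k1, k2]
  linear_combination (xFun q v - xFun q w) * key

/-- If u lies in q^ℤ, the perturbation 1 + t has norm one but is not 1, hence is not a power of q.
This allows auxiliary parameters to avoid finitely many orbits. -/
theorem eventually_generic_mul {q : K} (hq : ‖q‖ < 1) (hq0 : q ≠ 0) {u : K} (hu0 : u ≠ 0) :
    ∀ᶠ t : K in 𝓝[≠] 0, Generic q (u * (1 + t)) := by
  by_cases hu : Generic q u
  · exact (eventually_generic hq hq0 hu0 hu).filter_mono nhdsWithin_le_nhds
  · simp only [Generic, not_forall, not_not] at hu
    obtain ⟨n, hn⟩ := hu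
    have h1 : ∀ᶠ t : K in 𝓝[≠] 0, ‖t‖ < 1 := nhdsWithin_le_nhds
      (by simpa [Metric.ball, dist_zero_right] using Metric.ball_mem_nhds (0 : K) one_pos)
    filter_upwards [h1, self_mem_nhdsWithin] with t h1 h0 m hm
    refine zpow_ne_one_of_norm hq hq0 h1 h0 (m - n) ?_
    rw [zpow_sub₀ hq0, div_eq_mul_inv, ← eq_inv_of_mul_eq_one_right hn, mul_assoc, hm]

theorem eventually_one_add_ne_zero : ∀ᶠ t : K in 𝓝[≠] 0, 1 + t ≠ 0 := by
  have : ContinuousAt (fun t : K => 1 + t) 0 := by fun_prop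
  exact nhdsWithin_le_nhds (this.eventually_ne (by simp))

/-- A point outside finitely many orbits. -/
theorem exists_generic {q : K} (hq : ‖q‖ < 1) (hq0 : q ≠ 0) (S : Finset K)
    (hS : ∀ s ∈ S, s ≠ 0) : ∃ x : K, x ≠ 0 ∧ ∀ s ∈ S, Generic q (s * x) := by
  have h : ∀ᶠ t : K in 𝓝[≠] 0, ∀ s ∈ S, Generic q (s * (1 + t)) :=
    (Filter.eventually_all_finset S).2 fun s hs => eventually_generic_mul hq hq0 (hS s hs)
  obtain ⟨t, h1, h2⟩ := (h.and eventually_one_add_ne_zero).exists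
  exact ⟨1 + t, h2, h1⟩

/-- The points with parameters `v` such that `w * v` and `w / v` are generic lie on one cubic. -/
theorem exists_cubic {q : K} (hq : ‖q‖ < 1) (hq0 : q ≠ 0) {x y w : K} (hx : x ≠ 0)
    (hy : y ≠ 0) (hxyw : x * y * w = 1) (hx' : Generic q x) (hy' : Generic q y)
    (hw' : Generic q w) : ∃ b₄ b₆ : K, ∀ v, v ≠ 0 → Generic q v → Generic q (w * v) →
      Generic q (w * v⁻¹) → yFun q v ^ 2 + xFun q v * yFun q v = xFun q v ^ 3 +
        ((zetaSum q x + zetaSum q y + zetaSum q w + 1) ^ 2 +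
          (zetaSum q x + zetaSum q y + zetaSum q w + 1) - (xFun q x + xFun q y + xFun q w)) *
          xFun q v ^ 2 + b₄ * xFun q v + b₆ := by
  set lam := zetaSum q x + zetaSum q y + zetaSum q w + 1 with hlam
  set X₁ := xFun q x
  set X₂ := xFun q y
  set X₃ := xFun q w
  set m := yFun q w - lam * xFun q w with hm
  -- With L = lam · X + m, (Y - L)(-Y - X - L) = L² + LX - (Y² + XY). The coefficients are read off
  -- from Y² + XY = (X - X₁)(X - X₂)(X - X₃) + L² + LX.
  refine ⟨X₁ * X₂ + X₁ * X₃ + X₂ * X₃ + 2 * lam * m + m,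
    m ^ 2 - X₁ * X₂ * X₃, fun v hv hv' a1 a2 => ?_⟩
  have := line_mul_line_neg hq hq0 hx hy hv hxyw hx' hy' hw' hv' a1 a2
  rw [← hlam] at this
  rw [hm]
  linear_combination -this

/-! ### Lambert series -/

theorem norm_natCast_le_one' (n : ℕ) : ‖(n : K)‖ ≤ 1 := IsUltrametricDist.norm_natCast_le_one K n

theorem hasSum_of_succ {f : ℕ → K} {a : K} (h0 : f 0 = 0) (h : HasSum (fun n => f (n + 1)) a) :
    HasSum f a := by
  have := (hasSum_nat_add_iff (f := f) 1).1 h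
  simpa [h0] using this

/-- Power series with binomial coefficients have closed forms with integral coefficients. Polynomial
coefficients in n are expanded in this basis, so that nothing has to be divided in the field. -/
theorem hasSum_choose {x : K} (hx : ‖x‖ < 1) (j : ℕ) : ∀ i : ℕ,
    HasSum (fun n : ℕ => ((n + i).choose (i + j) : K) * x ^ (n + 1))
      (x ^ (j + 1) / (1 - x) ^ (i + j + 1)) := by
  induction j with
  | zero =>
    intro i
    have := (hasSum_choose_mul_geometric_of_norm_lt_one i hx).mul_left x
    refine this.congr' (fun n => ?_) ?_
    · rw [add_zero]; ring
    · rw [add_zero, zero_add, pow_one, mul_one_div]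
  | succ j ih =>
    intro i
    refine hasSum_of_succ ?_ (((ih (i + 1)).mul_left x).congr' (fun n => ?_) ?_)
    · rw [zero_add, Nat.choose_eq_zero_of_lt (by omega)]; simp
    · rw [show n + 1 + i = n + (i + 1) by ring, show i + (j + 1) = i + 1 + j by ring]; ring
    · rw [show i + (j + 1) + 1 = i + 1 + j + 1 by ring]; ring

theorem six_mul_choose (N : ℕ) : 6 * (N + 2).choose 3 = (N + 2) * (N + 1) * N := by
  have := Nat.descFactorial_eq_factorial_mul_choose (N + 2) 3
  simp [Nat.descFactorial_succ, Nat.factorial] at this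
  rw [← this]; ring

theorem choose_five (N : ℕ) : 120 * (N + 4).choose 5 = (N + 4) * (N + 3) * (N + 2) * (N + 1) * N := by
  have := Nat.descFactorial_eq_factorial_mul_choose (N + 4) 5
  simp [Nat.descFactorial_succ, Nat.factorial] at this
  rw [← this]; ring

theorem cube_eq (n : ℕ) :
    (n + 1) ^ 3 = (n + 3).choose (3 + 0) + 4 * (n + 2).choose (2 + 1) + (n + 1).choose (1 + 2) := by
  have h1 := six_mul_choose (n + 1)
  have h2 := six_mul_choose n
  have h3 : 6 * (n + 1).choose 3 = (n + 1) * n * (n - 1) := by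
    rcases n with _ | n
    · rfl
    · rw [show n + 1 + 1 = n + 2 by ring, six_mul_choose, Nat.add_sub_cancel]
  norm_num at h1 ⊢
  rcases n with _ | n
  · rfl
  · rw [Nat.add_sub_cancel] at h3
    nlinarith

/-- The quotient is n³ + 7 (n⁵ - n³)/12 at n + 1, and (n⁵ - n³)/12 is a combination of binomial
coefficients with natural coefficients. The division by 12 thus takes place in ℕ only. -/
theorem coeff_eq (n : ℕ) : (5 * (n + 1) ^ 3 + 7 * (n + 1) ^ 5) / 12 =
    (n + 1) ^ 3 + 7 * (2 * (n + 4).choose (4 + 1) + 6 * (n + 3).choose (3 + 2) +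
      2 * (n + 2).choose (2 + 3)) := by
  have h1 := choose_five n
  refine Nat.div_eq_of_eq_mul_left (by norm_num) ?_
  rcases n with _ | _ | n
  · simp [Nat.choose]
  · simp [Nat.choose]
  · have h2 := choose_five (n + 1)
    have h3 := choose_five n
    have h1 := choose_five (n + 2)
    norm_num at h1 h2 h3 ⊢
    rw [show n + 1 + 1 + 4 = n + 2 + 4 by ring, show n + 1 + 1 + 3 = n + 1 + 4 by ring,
      show n + 1 + 1 + 2 = n + 4 by ring]
    nlinarith

theorem hasSum_id {x : K} (hx : ‖x‖ < 1) :
    HasSum (fun n : ℕ => ((n + 1 : ℕ) : K) * x ^ (n + 1)) (x / (1 - x) ^ 2) := by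
  simpa using hasSum_choose hx 0 1

theorem hasSum_cube {x : K} (hx : ‖x‖ < 1) :
    HasSum (fun n : ℕ => (((n + 1) ^ 3 : ℕ) : K) * x ^ (n + 1))
      (x * (1 + 4 * x + x ^ 2) / (1 - x) ^ 4) := by
  refine (((hasSum_choose hx 0 3).add ((hasSum_choose hx 1 2).mul_left 4)).add
    (hasSum_choose hx 2 1)).congr' (fun n => ?_) ?_
  · rw [cube_eq]; push_cast; ring
  · simp only [zero_add, add_zero, Nat.reduceAdd]; ring

theorem hasSum_coeff {x : K} (hx : ‖x‖ < 1) :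
    HasSum (fun n : ℕ => (((5 * (n + 1) ^ 3 + 7 * (n + 1) ^ 5) / 12 : ℕ) : K) * x ^ (n + 1))
      (x * (1 + 4 * x + x ^ 2) / (1 - x) ^ 4 +
        7 * (2 * x ^ 2 * (1 + 3 * x + x ^ 2) / (1 - x) ^ 6)) := by
  refine ((hasSum_cube hx).add (((((hasSum_choose hx 1 4).mul_left 2).add
    ((hasSum_choose hx 2 3).mul_left 6)).add
    ((hasSum_choose hx 3 2).mul_left 2)).mul_left 7)).congr' (fun n => ?_) ?_
  · rw [coeff_eq]; push_cast; ring
  · simp only [Nat.reduceAdd]; ring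

theorem norm_pow_succ_lt_one {q : K} (hq : ‖q‖ < 1) (n : ℕ) : ‖q ^ (n + 1)‖ < 1 := by
  rw [norm_pow]; exact pow_lt_one₀ (norm_nonneg _) hq (by simp)

/-- Expand 1 / (1 - qⁿ) geometrically and interchange the sums in ∑ c(n) q^(nm). Absolute
summability is clear because integers have norm at most one. -/
theorem hasSum_lambert {q : K} (hq : ‖q‖ < 1) (c : ℕ → ℕ) {φ : K → K}
    (hφ : ∀ x : K, ‖x‖ < 1 → HasSum (fun n : ℕ => (c (n + 1) : K) * x ^ (n + 1)) (φ x)) :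
    HasSum (fun m : ℕ => φ (q ^ (m + 1)))
      (∑' n : ℕ+, (c n : K) * q ^ (n : ℕ) / (1 - q ^ (n : ℕ))) := by
  have hs : Summable fun p : ℕ × ℕ => (c (p.2 + 1) : K) * (q ^ (p.1 + 1)) ^ (p.2 + 1) := by
    have g := summable_geometric_of_lt_one (norm_nonneg q) hq
    refine Summable.of_norm_bounded (g.mul_of_nonneg g (fun _ => by positivity)
      fun _ => by positivity) fun p => ?_
    rw [norm_mul, ← pow_mul, norm_pow, ← pow_add]
    refine (mul_le_of_le_one_left (by positivity) (norm_natCast_le_one' _)).trans ?_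
    exact pow_le_pow_of_le_one (norm_nonneg _) hq.le (by nlinarith)
  set F : ℕ × ℕ → K := fun p => (c (p.2 + 1) : K) * (q ^ (p.1 + 1)) ^ (p.2 + 1) with hF
  have h1 : HasSum (fun m : ℕ => φ (q ^ (m + 1))) (∑' p, F p) :=
    HasSum.prod_fiberwise hs.hasSum fun m => hφ _ (norm_pow_succ_lt_one hq m)
  have h2 : HasSum (fun n : ℕ => (c (n + 1) : K) * q ^ (n + 1) / (1 - q ^ (n + 1)))
      (∑' p : ℕ × ℕ, F p.swap) := by
    refine HasSum.prod_fiberwise hs.prod_symm.hasSum fun n => ?_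
    refine ((hasSum_geometric_of_norm_lt_one (norm_pow_succ_lt_one hq n)).mul_left
      ((c (n + 1) : K) * q ^ (n + 1))).congr' (fun m => ?_) (div_eq_mul_inv _ _).symm
    simp only [hF, Prod.swap]
    ring
  have h3 : ∑' p : ℕ × ℕ, F p.swap = ∑' p, F p := (Equiv.prodComm ℕ ℕ).tsum_eq F
  have h4 : (∑' n : ℕ+, (c n : K) * q ^ (n : ℕ) / (1 - q ^ (n : ℕ))) =
      ∑' n : ℕ, (c (n + 1) : K) * q ^ (n + 1) / (1 - q ^ (n + 1)) :=
    tsum_pnat_eq_tsum_succ (f := fun n : ℕ => (c n : K) * q ^ n / (1 - q ^ n))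
  rw [h4, h2.tsum_eq, h3]
  exact h1

theorem hasSum_sumS_one {q : K} (hq : ‖q‖ < 1) :
    HasSum (fun m : ℕ => q ^ (m + 1) / (1 - q ^ (m + 1)) ^ 2) (sumS 1 q) := by
  refine (hasSum_lambert hq id fun x hx => hasSum_id hx).congr' (fun _ => rfl) ?_
  simp [sumS]

theorem hasSum_sumS_three {q : K} (hq : ‖q‖ < 1) :
    HasSum (fun m : ℕ => q ^ (m + 1) * (1 + 4 * q ^ (m + 1) + (q ^ (m + 1)) ^ 2) /
      (1 - q ^ (m + 1)) ^ 4) (sumS 3 q) := by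
  refine (hasSum_lambert hq (fun n => n ^ 3) fun x hx => hasSum_cube hx).congr' (fun _ => rfl) ?_
  simp [sumS]

theorem hasSum_a₆ {q : K} (hq : ‖q‖ < 1) :
    HasSum (fun m : ℕ => q ^ (m + 1) * (1 + 4 * q ^ (m + 1) + (q ^ (m + 1)) ^ 2) /
      (1 - q ^ (m + 1)) ^ 4 + 7 * (2 * (q ^ (m + 1)) ^ 2 * (1 + 3 * q ^ (m + 1) +
        (q ^ (m + 1)) ^ 2) / (1 - q ^ (m + 1)) ^ 6)) (-a₆ q) := by
  refine (hasSum_lambert hq (fun n => (5 * n ^ 3 + 7 * n ^ 5) / 12)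
    fun x hx => hasSum_coeff hx).congr' (fun _ => rfl) ?_
  rw [a₆, neg_neg]

/-! ### Expansions at the origin -/

/-- The elements of norm at most one. -/
def unitBall (K : Type*) [NontriviallyNormedField K] [IsUltrametricDist K] : Subring K where
  carrier := {x | ‖x‖ ≤ 1}
  mul_mem' {a b} ha hb := by
    simpa only [Set.mem_ofPred_eq, norm_mul] using mul_le_one₀ ha (norm_nonneg _) hb
  one_mem' := by simp
  add_mem' {a b} ha hb := (IsUltrametricDist.norm_add_le_max a b).trans (max_le ha hb)
  zero_mem' := by simp
  neg_mem' {a} ha := by simpa using ha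

theorem norm_le_of_mul {x r : K} (h : ‖r‖ ≤ 1) : ‖x * r‖ ≤ ‖x‖ := by
  rw [norm_mul]; exact mul_le_of_le_one_right (norm_nonneg _) h

theorem norm_le_of_hasSum {ι : Type*} {f : ι → K} {a : K} {C : ℝ} (hC : 0 ≤ C) (h : HasSum f a)
    (hf : ∀ i, ‖f i‖ ≤ C) : ‖a‖ ≤ C :=
  le_of_tendsto h.norm (Eventually.of_forall fun s =>
    IsUltrametricDist.norm_sum_le_of_forall_le_of_nonneg hC fun i _ => hf i)

theorem hasSum_int_split {F : ℤ → K} (h : Summable F) :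
    HasSum (fun m : ℕ => F (m + 1) + F (-(m + 1))) ((∑' n, F n) - F 0) := by
  have := (hasSum_nat_add_iff' 1).2 h.hasSum.nat_add_neg
  refine this.congr' (fun m => ?_) ?_
  · push_cast; rfl
  · simp

/-- The parts of the terms of the series for the coordinates, as functions of `x = q ^ n` and
`s = (1 - u) ^ 2 / u`. -/
noncomputable def termE (x s : K) : K :=
  s * x * ((1 + 4 * x + x ^ 2) * (1 - x) ^ 2 - 2 * x ^ 2 * s) /
    ((1 - x) ^ 2 * ((1 - x) ^ 2 - x * s) ^ 2)

/-- The leading part of the terms of the series for `y`. -/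
noncomputable def termB (x s : K) : K :=
  x * ((1 - x) ^ 2 * (1 + 4 * x + x ^ 2) + s * x * (1 + x ^ 2)) / ((1 - x) ^ 2 - x * s) ^ 3

/-- The remaining part of the terms of the series for `y`. -/
noncomputable def termC (x s : K) : K :=
  s * x * (-((1 - x) ^ 4 * (1 + 4 * x + x ^ 2)) + 3 * (1 - x) ^ 2 * x ^ 2 * s - x ^ 3 * s ^ 2) /
    ((1 - x) ^ 2 * ((1 - x) ^ 2 - x * s) ^ 3)

theorem one_sub_ne_zero_of_norm {x : K} (hx : ‖x‖ < 1) : 1 - x ≠ 0 := by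
  rw [← norm_ne_zero_iff, norm_one_sub_of_lt hx]; exact one_ne_zero

theorem sub_ne_zero_of_norm_lt {x u : K} (h : ‖x‖ < ‖u‖) : u - x ≠ 0 := fun h' => by
  rw [sub_eq_zero.1 h'] at h; exact lt_irrefl _ h

theorem denominator_eq {x u : K} (hu : u ≠ 0) :
    (1 - x) ^ 2 - x * ((1 - u) ^ 2 / u) = (1 - x * u) * (u - x) / u := by
  field_simp; ring

/-- Together, the terms for n and -n are invariant under u ↦ u⁻¹, hence depend only on s = (1 -
u)²/u = u + u⁻¹ - 2. -/
theorem termE_eq {x u : K} (hx : ‖x‖ < 1) (hx0 : x ≠ 0) (hu : ‖u‖ = 1) :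
    x * u / (1 - x * u) ^ 2 + x⁻¹ * u / (1 - x⁻¹ * u) ^ 2 - 2 * (x / (1 - x) ^ 2) =
      termE x ((1 - u) ^ 2 / u) := by
  have hu0 : u ≠ 0 := fun h => by simp [h] at hu
  have h1 := one_sub_ne_zero_of_norm hx
  have h2 : 1 - x * u ≠ 0 := one_sub_ne_zero_of_norm (by rwa [norm_mul, hu, mul_one])
  have h3 : u - x ≠ 0 := sub_ne_zero_of_norm_lt (by rwa [hu])
  rw [termE, denominator_eq hu0, show 1 - x⁻¹ * u = -((u - x) / x) by field_simp; ring]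
  field_simp
  ring

/-- The terms of y are not invariant under u ↦ u⁻¹; they are written as (u - 1) B + C with B and C
functions of s. -/
theorem termBC_eq {x u : K} (hx : ‖x‖ < 1) (hx0 : x ≠ 0) (hu : ‖u‖ = 1) :
    (x * u) ^ 2 / (1 - x * u) ^ 3 + (x⁻¹ * u) ^ 2 / (1 - x⁻¹ * u) ^ 3 + x / (1 - x) ^ 2 =
      (u - 1) * termB x ((1 - u) ^ 2 / u) + termC x ((1 - u) ^ 2 / u) := by
  have hu0 : u ≠ 0 := fun h => by simp [h] at hu
  have h1 := one_sub_ne_zero_of_norm hx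
  have h2 : 1 - x * u ≠ 0 := one_sub_ne_zero_of_norm (by rwa [norm_mul, hu, mul_one])
  have h3 : u - x ≠ 0 := sub_ne_zero_of_norm_lt (by rwa [hu])
  rw [termB, termC, denominator_eq hu0, show 1 - x⁻¹ * u = -((u - x) / x) by field_simp; ring]
  field_simp
  ring

theorem hasSum_termE {q : K} (hq : ‖q‖ < 1) (hq0 : q ≠ 0) {u : K} (hu : ‖u‖ = 1) :
    HasSum (fun m : ℕ => termE (q ^ (m + 1)) ((1 - u) ^ 2 / u))
      (xFun q u - u / (1 - u) ^ 2) := by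
  have hu0 : u ≠ 0 := fun h => by simp [h] at hu
  refine ((hasSum_int_split (summable_xSum hq hq0 hu0)).sub
    ((hasSum_sumS_one hq).mul_left 2)).congr' (fun m => ?_) ?_
  · rw [← termE_eq (norm_pow_succ_lt_one hq m) (pow_ne_zero _ hq0) hu, zpow_neg]; norm_cast
  · rw [zpow_zero, one_mul, xFun, xSum]; ring

theorem hasSum_termBC {q : K} (hq : ‖q‖ < 1) (hq0 : q ≠ 0) {u : K} (hu : ‖u‖ = 1) :
    HasSum (fun m : ℕ => (u - 1) * termB (q ^ (m + 1)) ((1 - u) ^ 2 / u) +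
        termC (q ^ (m + 1)) ((1 - u) ^ 2 / u))
      (yFun q u - u ^ 2 / (1 - u) ^ 3) := by
  have hu0 : u ≠ 0 := fun h => by simp [h] at hu
  refine ((hasSum_int_split (summable_ySum hq hq0 hu0)).add
    (hasSum_sumS_one hq)).congr' (fun m => ?_) ?_
  · rw [← termBC_eq (norm_pow_succ_lt_one hq m) (pow_ne_zero _ hq0) hu, zpow_neg]; norm_cast
  · rw [zpow_zero, one_mul, yFun, ySum]; ring

/-- Polynomial expressions with integral coefficients in `x`, `s`, `1 / (1 - x)` and
`1 / ((1 - x) ^ 2 - x * s)` have norm at most one. -/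
theorem exists_lifts {x s : K} (hx : ‖x‖ < 1) (hs : ‖s‖ ≤ 1) :
    ∃ X S I J : unitBall K, (X : K) = x ∧ (S : K) = s ∧ (I : K) * (1 - x) = 1 ∧
      (J : K) * ((1 - x) ^ 2 - x * s) = 1 := by
  have h1 := one_sub_ne_zero_of_norm hx
  have h2 : ‖(1 - x) ^ 2 - x * s‖ = 1 := by
    rw [show (1 - x) ^ 2 - x * s = 1 - x * (2 - x + s) by ring]
    refine norm_one_sub_of_lt ((norm_le_of_mul ?_).trans_lt hx)
    have : 2 - x + s ∈ unitBall K := by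
      refine add_mem (sub_mem ?_ hx.le) hs
      exact_mod_cast natCast_mem (unitBall K) 2
    exact this
  refine ⟨⟨x, hx.le⟩, ⟨s, hs⟩, ⟨(1 - x)⁻¹, ?_⟩, ⟨((1 - x) ^ 2 - x * s)⁻¹, ?_⟩, rfl, rfl,
    inv_mul_cancel₀ h1, inv_mul_cancel₀ ?_⟩
  · change ‖(1 - x)⁻¹‖ ≤ 1
    rw [norm_inv, norm_one_sub_of_lt hx, inv_one]
  · change ‖((1 - x) ^ 2 - x * s)⁻¹‖ ≤ 1
    rw [norm_inv, h2, inv_one]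
  · rw [← norm_ne_zero_iff, h2]; exact one_ne_zero

/-- The first Taylor coefficient. -/
noncomputable def coeffA (x : K) : K := x * (1 + 4 * x + x ^ 2) / (1 - x) ^ 4

/-- The second Taylor coefficient. -/
noncomputable def coeffK (x : K) : K :=
  2 * x ^ 2 * (1 + 3 * x + x ^ 2) / (1 - x) ^ 6

theorem unitBall_coe_two : ((2 : unitBall K) : K) = 2 := rfl

theorem unitBall_coe_three : ((3 : unitBall K) : K) = 3 := rfl

theorem unitBall_coe_four : ((4 : unitBall K) : K) = 4 := rfl

theorem unitBall_coe_eight : ((8 : unitBall K) : K) = 8 := rfl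

theorem unitBall_coe_twelve : ((12 : unitBall K) : K) = 12 := rfl

theorem norm_le_of_eq_mul {a x : K} (Z : unitBall K) (h : a = x * Z) : ‖a‖ ≤ ‖x‖ :=
  h ▸ norm_le_of_mul Z.2

theorem norm_coeffA_le {x : K} (hx : ‖x‖ < 1) : ‖coeffA x‖ ≤ ‖x‖ := by
  obtain ⟨X, S, I, J, rfl, -, hI, -⟩ := exists_lifts hx (s := 0) (by simp)
  have h1 := one_sub_ne_zero_of_norm hx
  refine norm_le_of_eq_mul (I ^ 4 * (1 + 4 * X + X ^ 2)) ?_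
  push_cast
  simp only [unitBall_coe_four]
  rw [eq_div_of_mul_eq h1 hI, coeffA]
  field_simp

theorem norm_coeffK_le {x : K} (hx : ‖x‖ < 1) : ‖coeffK x‖ ≤ ‖x‖ := by
  obtain ⟨X, S, I, J, rfl, -, hI, -⟩ := exists_lifts hx (s := 0) (by simp)
  have h1 := one_sub_ne_zero_of_norm hx
  refine norm_le_of_eq_mul (I ^ 6 * (2 * X * (1 + 3 * X + X ^ 2))) ?_
  push_cast
  simp only [unitBall_coe_two, unitBall_coe_three]
  rw [eq_div_of_mul_eq h1 hI, coeffK]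
  field_simp

theorem norm_coeffK_le' {x : K} (hx : ‖x‖ < 1) : ‖coeffK x‖ ≤ ‖x ^ 2‖ := by
  obtain ⟨X, S, I, J, rfl, -, hI, -⟩ := exists_lifts hx (s := 0) (by simp)
  have h1 := one_sub_ne_zero_of_norm hx
  refine norm_le_of_eq_mul (I ^ 6 * (2 * (1 + 3 * X + X ^ 2))) ?_
  push_cast
  simp only [unitBall_coe_two, unitBall_coe_three]
  rw [eq_div_of_mul_eq h1 hI, coeffK]
  field_simp

/-- The witness is the exact remainder of the Taylor expansion in s, divided by s³. It is x times an
integral polynomial in x, s, 1/(1 - x) and 1/((1 - x)² - xs), which gives the bound by `‖x‖`. The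
expansions of `termB` and `termC` follow the same pattern. -/
theorem termE_expansion {x s : K} (hx : ‖x‖ < 1) (hs : ‖s‖ ≤ 1) : ∃ r, ‖r‖ ≤ ‖x‖ ∧
    termE x s = s * coeffA x + s ^ 2 * coeffK x + s ^ 3 * r := by
  obtain ⟨X, S, I, J, rfl, rfl, hI, hJ⟩ := exists_lifts hx hs
  have h1 := one_sub_ne_zero_of_norm hx
  have h2 := right_ne_zero_of_mul_eq_one hJ
  refine ⟨_, norm_le_of_eq_mul (X ^ 2 * ((1 - X) ^ 2 * (3 + 8 * X + 3 * X ^ 2) -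
    2 * (1 + 3 * X + X ^ 2) * X * S) * (I ^ 6 * J ^ 2)) rfl, ?_⟩
  push_cast
  simp only [unitBall_coe_two, unitBall_coe_three, unitBall_coe_eight]
  rw [eq_div_of_mul_eq h1 hI, eq_div_of_mul_eq h2 hJ, coeffA, coeffK, termE]
  obtain ⟨d, hd⟩ : ∃ d, (1 - (X : K)) ^ 2 - X * S = d := ⟨_, rfl⟩
  rw [hd] at h2 ⊢
  field_simp
  rw [← hd]
  ring

theorem termB_expansion {x s : K} (hx : ‖x‖ < 1) (hs : ‖s‖ ≤ 1) : ∃ r, ‖r‖ ≤ ‖x‖ ∧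
    termB x s = coeffA x + 2 * s * coeffK x + s ^ 2 * r := by
  obtain ⟨X, S, I, J, rfl, rfl, hI, hJ⟩ := exists_lifts hx hs
  have h1 := one_sub_ne_zero_of_norm hx
  have h2 := right_ne_zero_of_mul_eq_one hJ
  refine ⟨_, norm_le_of_eq_mul (X ^ 2 * (3 * (1 - X) ^ 4 * (3 + 8 * X + 3 * X ^ 2) +
    X * (1 - X) ^ 2 * (1 + 4 * X + X ^ 2 - 12 * (1 + 3 * X + X ^ 2)) * S +
    4 * X ^ 2 * (1 + 3 * X + X ^ 2) * S ^ 2) * (I ^ 6 * J ^ 3)) rfl, ?_⟩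
  push_cast
  simp only [unitBall_coe_three, unitBall_coe_four, unitBall_coe_eight,
    unitBall_coe_twelve]
  rw [eq_div_of_mul_eq h1 hI, eq_div_of_mul_eq h2 hJ, coeffA, coeffK, termB]
  obtain ⟨d, hd⟩ : ∃ d, (1 - (X : K)) ^ 2 - X * S = d := ⟨_, rfl⟩
  rw [hd] at h2 ⊢
  field_simp
  rw [← hd]
  ring

theorem termC_expansion {x s : K} (hx : ‖x‖ < 1) (hs : ‖s‖ ≤ 1) : ∃ r, ‖r‖ ≤ ‖x‖ ∧
    termC x s = -(s * coeffA x) + s ^ 2 * r := by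
  obtain ⟨X, S, I, J, rfl, rfl, hI, hJ⟩ := exists_lifts hx hs
  have h1 := one_sub_ne_zero_of_norm hx
  have h2 := right_ne_zero_of_mul_eq_one hJ
  refine ⟨_, norm_le_of_eq_mul (X * (3 * (1 - X) ^ 4 * (X - (1 + 4 * X + X ^ 2)) +
    (1 - X) ^ 2 * X * (3 * (1 + 4 * X + X ^ 2) - X) * S -
    (1 + 4 * X + X ^ 2) * X ^ 2 * S ^ 2) * (I ^ 4 * J ^ 3)) rfl, ?_⟩
  push_cast
  simp only [unitBall_coe_three, unitBall_coe_four]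
  rw [eq_div_of_mul_eq h1 hI, eq_div_of_mul_eq h2 hJ, coeffA, termC]
  obtain ⟨d, hd⟩ : ∃ d, (1 - (X : K)) ^ 2 - X * S = d := ⟨_, rfl⟩
  rw [hd] at h2 ⊢
  field_simp
  rw [← hd]
  ring

theorem norm_pow_succ_le {q : K} (hq : ‖q‖ < 1) (m : ℕ) : ‖q ^ (m + 1)‖ ≤ ‖q‖ := by
  rw [norm_pow]
  exact pow_le_of_le_one (norm_nonneg _) hq.le (by simp)

theorem hasSum_coeffA {q : K} (hq : ‖q‖ < 1) :
    HasSum (fun m : ℕ => coeffA (q ^ (m + 1))) (sumS 3 q) := hasSum_sumS_three hq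

theorem summable_of_norm_le_pow {q : K} (hq : ‖q‖ < 1) {r : ℕ → K}
    (h : ∀ m, ‖r m‖ ≤ ‖q ^ (m + 1)‖) : Summable r :=
  summable_of_tendsto_zero (squeeze_zero_norm h
    (by simpa using ((tendsto_add_atTop_iff_nat 1).2
      (tendsto_pow_atTop_nhds_zero_of_norm_lt_one hq)).norm))

/-- `∑ coeffK (q ^ n)`. -/
noncomputable def sumK (q : K) : K := ∑' m : ℕ, coeffK (q ^ (m + 1))

theorem hasSum_coeffK {q : K} (hq : ‖q‖ < 1) :
    HasSum (fun m : ℕ => coeffK (q ^ (m + 1))) (sumK q) :=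
  (summable_of_norm_le_pow hq fun m => norm_coeffK_le (norm_pow_succ_lt_one hq m)).hasSum

theorem a₆_eq {q : K} (hq : ‖q‖ < 1) : a₆ q = -(sumS 3 q + 7 * sumK q) := by
  rw [← (hasSum_a₆ hq).unique ((hasSum_coeffA hq).add ((hasSum_coeffK hq).mul_left 7)), neg_neg]

theorem norm_sumS_three_le {q : K} (hq : ‖q‖ < 1) : ‖sumS 3 q‖ ≤ ‖q‖ :=
  norm_le_of_hasSum (norm_nonneg _) (hasSum_coeffA hq) fun m =>
    (norm_coeffA_le (norm_pow_succ_lt_one hq m)).trans (norm_pow_succ_le hq m)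

theorem norm_sumK_le {q : K} (hq : ‖q‖ < 1) : ‖sumK q‖ ≤ ‖q‖ ^ 2 :=
  norm_le_of_hasSum (by positivity) (hasSum_coeffK hq) fun m =>
    (norm_coeffK_le' (norm_pow_succ_lt_one hq m)).trans (by
      rw [norm_pow]; exact pow_le_pow_left₀ (norm_nonneg _) (norm_pow_succ_le hq m) 2)

theorem norm_sq_div_le {u : K} (hu : ‖u‖ = 1) : ‖(1 - u) ^ 2 / u‖ ≤ 1 := by
  rw [norm_div, hu, div_one, norm_pow]
  exact pow_le_one₀ (norm_nonneg _) (by simpa [hu] using norm_sub_le_max' 1 u)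

/-- Termwise form of Y(u) + Y(u⁻¹) = -X(u): adding (u - 1) B + C and (u⁻¹ - 1) B + C gives s B + 2
C. -/
theorem termE_eq_termC {x s : K} (hx : ‖x‖ < 1) (hs : ‖s‖ ≤ 1) :
    -2 * termC x s - s * termB x s = termE x s := by
  obtain ⟨X, S, I, J, rfl, rfl, hI, hJ⟩ := exists_lifts hx hs
  have h1 := one_sub_ne_zero_of_norm hx
  have h2 := right_ne_zero_of_mul_eq_one hJ
  rw [termE, termC, termB]
  obtain ⟨d, hd⟩ : ∃ d, (1 - (X : K)) ^ 2 - X * S = d := ⟨_, rfl⟩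
  rw [hd] at h2 ⊢
  field_simp
  rw [← hd]
  ring

/-- The Laurent expansions of the coordinates at `u = 1`, in terms of `u - 1` and
`s = (1 - u) ^ 2 / u`. -/
theorem coord_expansion {q : K} (hq : ‖q‖ < 1) (hq0 : q ≠ 0) {u : K} (hu : ‖u‖ = 1) {s : K}
    (hs : s = (1 - u) ^ 2 / u) : ∃ B C r r₁ r₂ : K, ‖r‖ ≤ ‖q‖ ∧ ‖r₁‖ ≤ ‖q‖ ∧ ‖r₂‖ ≤ ‖q‖ ∧
      B = sumS 3 q + 2 * s * sumK q + s ^ 2 * r₁ ∧ C = -(s * sumS 3 q) + s ^ 2 * r₂ ∧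
      -2 * C - s * B = s * sumS 3 q + s ^ 2 * sumK q + s ^ 3 * r ∧
      xFun q u = u / (1 - u) ^ 2 + (-2 * C - s * B) ∧
      yFun q u = u ^ 2 / (1 - u) ^ 3 + ((u - 1) * B + C) := by
  have hs1 : ‖s‖ ≤ 1 := hs ▸ norm_sq_div_le hu
  have hx := norm_pow_succ_lt_one hq
  choose r hr h using fun m : ℕ => termE_expansion (hx m) hs1
  choose r₁ hr₁ h₁ using fun m : ℕ => termB_expansion (hx m) hs1
  choose r₂ hr₂ h₂ using fun m : ℕ => termC_expansion (hx m) hs1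
  have g := (summable_of_norm_le_pow hq hr).hasSum
  have g₁ := (summable_of_norm_le_pow hq hr₁).hasSum
  have g₂ := (summable_of_norm_le_pow hq hr₂).hasSum
  have le {r : ℕ → K} (h : ∀ m, ‖r m‖ ≤ ‖q ^ (m + 1)‖) (g : HasSum r (∑' m, r m)) :
      ‖∑' m, r m‖ ≤ ‖q‖ :=
    norm_le_of_hasSum (norm_nonneg _) g fun m => (h m).trans (norm_pow_succ_le hq m)
  have kE := (((hasSum_coeffA hq).mul_left s).add ((hasSum_coeffK hq).mul_left (s ^ 2))).add
    (g.mul_left (s ^ 3))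
  have kB := ((hasSum_coeffA hq).add ((hasSum_coeffK hq).mul_left (2 * s))).add
    (g₁.mul_left (s ^ 2))
  have kC := ((hasSum_coeffA hq).mul_left s).neg.add (g₂.mul_left (s ^ 2))
  have kE' := ((kC.mul_left (-2)).sub (kB.mul_left s)).congr'
    (fun m => by rw [← h₁, ← h₂, termE_eq_termC (hx m) hs1, h]) rfl
  refine ⟨_, _, _, _, _, le hr g, le hr₁ g₁, le hr₂ g₂, rfl, rfl, kE'.unique kE, ?_, ?_⟩
  · have := (hasSum_termE hq hq0 hu).unique (kE.congr' (fun m => by rw [← h, hs]) rfl)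
    rw [kE'.unique kE, ← this]; ring
  · have := (hasSum_termBC hq hq0 hu).unique (((kB.mul_left (u - 1)).add kC).congr'
      (fun m => by rw [← h₁, ← h₂, hs]) rfl)
    rw [← this]; ring

/-- On inserting the Laurent expansions, the polar and constant terms in s cancel exactly for the
coefficients a₄ = -5 s₃ and a₆. What is left is s times an integral element. -/
theorem cubic_error {q : K} (hq : ‖q‖ < 1) (hq0 : q ≠ 0) {u : K} (hu : ‖u‖ = 1) (hu1 : u ≠ 1) :
    ∃ z e : K, ‖z‖ ≤ 1 ∧ ‖e‖ ≤ 1 ∧ (1 - u) ^ 2 / u * xFun q u = 1 + ((1 - u) ^ 2 / u) ^ 2 * e ∧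
      yFun q u ^ 2 + xFun q u * yFun q u =
        xFun q u ^ 3 + a₄ q * xFun q u + a₆ q + (1 - u) ^ 2 / u * z := by
  have hu0 : u ≠ 0 := fun h => by simp [h] at hu
  have hu2 := sub_ne_zero.2 hu1.symm
  obtain ⟨s, hs⟩ : ∃ s, s = (1 - u) ^ 2 / u := ⟨_, rfl⟩
  have hs1 : ‖s‖ ≤ 1 := hs ▸ norm_sq_div_le hu
  obtain ⟨B, C, r, r₁, r₂, hr, hr₁, hr₂, hB, hC, hE, hX, hY⟩ := coord_expansion hq hq0 hu hs
  rw [a₆_eq hq, a₄, ← hs]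
  have hA := (norm_sumS_three_le hq).trans hq.le
  have hK := (norm_sumK_le hq).trans (pow_le_one₀ (norm_nonneg _) hq.le)
  obtain ⟨A, hA'⟩ : ∃ A : unitBall K, A = sumS 3 q := ⟨⟨_, hA⟩, rfl⟩
  obtain ⟨κ, hK'⟩ : ∃ A : unitBall K, A = sumK q := ⟨⟨_, hK⟩, rfl⟩
  obtain ⟨S, rfl⟩ : ∃ A : unitBall K, A = s := ⟨⟨_, hs1⟩, rfl⟩
  obtain ⟨r, rfl⟩ : ∃ A : unitBall K, A = r := ⟨⟨_, hr.trans hq.le⟩, rfl⟩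
  obtain ⟨r₁, rfl⟩ : ∃ A : unitBall K, A = r₁ := ⟨⟨_, hr₁.trans hq.le⟩, rfl⟩
  obtain ⟨r₂, rfl⟩ : ∃ A : unitBall K, A = r₂ := ⟨⟨_, hr₂.trans hq.le⟩, rfl⟩
  rw [← hA', ← hK'] at *
  obtain ⟨b, hb⟩ : ∃ b : unitBall K, b = A + ((2 : ℕ) : unitBall K) * S * κ + S ^ 2 * r₁ := ⟨_, rfl⟩
  obtain ⟨c, hc⟩ : ∃ c : unitBall K, c = -A + S * r₂ := ⟨_, rfl⟩
  obtain ⟨e, he⟩ : ∃ e : unitBall K, e = A + S * κ + S ^ 2 * r := ⟨_, rfl⟩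
  have hb' : B = b := by rw [hB, hb]; push_cast; rfl
  have hc' : C = S * c := by rw [hC, hc]; push_cast; ring
  have he' : -2 * C - S * B = S * e := by rw [hE, he]; push_cast; ring
  have hs0 : (S : K) ≠ 0 := by rw [hs]; exact div_ne_zero (pow_ne_zero 2 hu2) hu0
  -- The witness collects the terms of positive order in s, divided by s.
  refine ⟨((r₂ - 2 * r₁ + b ^ 2 - S * (b * c) - S * c ^ 2 - 3 * r - 3 * e ^ 2 -
    S ^ 2 * e ^ 3 + (2 + 3) * A * e : unitBall K) : K), e, Subtype.prop (p := (· ∈ unitBall K)) _, e.2, ?_, ?_⟩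
  · rw [hX, he', mul_add, ← mul_assoc, ← sq]
    congr 1
    rw [hs]; field_simp
  · have hf : u / (1 - u) ^ 2 = 1 / (S : K) := by rw [hs]; field_simp
    have hg : u ^ 2 / (1 - u) ^ 3 = (1 - u) / (S : K) ^ 2 := by rw [hs]; field_simp
    have hsu : (S : K) * u = (1 - u) ^ 2 := by rw [hs]; field_simp
    have e1 : -2 * c - b = (e : K) := mul_left_cancel₀ hs0 (by rw [← he', hb', hc']; ring)
    have h1 : (1 - u) ^ 2 / (S : K) = u := by rw [← hsu]; field_simp
    push_cast
    simp only [unitBall_coe_two, unitBall_coe_three]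
    rw [hY, hX, he', hf, hg, hb', hc']
    have hbK : (b : K) = A + 2 * S * κ + S ^ 2 * r₁ := by rw [← hb', hB]
    have hcK : (c : K) = -A + S * r₂ := by rw [hc]; push_cast; rfl
    have heK : (e : K) = A + S * κ + S ^ 2 * r := by rw [he]; push_cast; rfl
    -- The leading parts 1/s and (1 - u)/s² satisfy the equation y² + xy = x³ of the nodal cubic for
    -- q = 0, so that only the terms with b, c, e remain. Their expansions are inserted afterwards.
    have key : ((1 - u) / (S : K) ^ 2 + ((u - 1) * b + S * c)) ^ 2 +
        (1 / (S : K) + S * e) * ((1 - u) / (S : K) ^ 2 + ((u - 1) * b + S * c)) =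
        (1 / (S : K) + S * e) ^ 3 + ((S * c - 2 * b) / S + S * b ^ 2 - S ^ 2 * b * c -
          S ^ 2 * c ^ 2 - 3 * e / S - 3 * S * e ^ 2 - S ^ 3 * e ^ 3) := by
      rw [show (b : K) = -2 * c - e by linear_combination -e1]
      linear_combination (norm := (field_simp; ring))
        -(1 / (S : K) ^ 2 + 2 * c + e) ^ 2 * hsu
    linear_combination (norm := (field_simp; ring))
      key + hcK - 2 / (S : K) * hbK - 3 / (S : K) * heK

theorem eq_zero_of_norm_le {c : K} {M : ℝ} (h : ∀ᶠ t : K in 𝓝[≠] 0, ‖c‖ ≤ M * ‖t‖) : c = 0 := by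
  have : Tendsto (fun t : K => M * ‖t‖) (𝓝[≠] 0) (𝓝 0) := by
    have h1 : Tendsto (fun t : K => M * ‖t‖) (𝓝 0) (𝓝 (M * ‖(0 : K)‖)) :=
      Continuous.tendsto (by fun_prop) _
    rw [norm_zero, mul_zero] at h1
    exact h1.mono_left nhdsWithin_le_nhds
  exact norm_le_zero_iff.1 (ge_of_tendsto this h)

/-- Multiply the difference of the two cubics by s². With g = sX, which has norm one, this is b₂g² +
(b₄ - a₄)gs + (b₆ - a₆)s² = O(s³), and letting s → 0 kills the coefficients one after another. -/
theorem cubic_unique {q : K} (hq : ‖q‖ < 1) (hq0 : q ≠ 0) {b₂ b₄ b₆ : K}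
    (h : ∀ᶠ t : K in 𝓝[≠] 0, yFun q (1 + t) ^ 2 + xFun q (1 + t) * yFun q (1 + t) =
      xFun q (1 + t) ^ 3 + b₂ * xFun q (1 + t) ^ 2 + b₄ * xFun q (1 + t) + b₆) :
    b₂ = 0 ∧ b₄ = a₄ q ∧ b₆ = a₆ q := by
  have key : ∀ᶠ t : K in 𝓝[≠] 0, ∃ s g z : K, ‖s‖ ≤ 1 ∧ ‖s‖ ≤ ‖t‖ ∧ ‖g‖ = 1 ∧ ‖z‖ ≤ 1 ∧
      b₂ * g ^ 2 + (b₄ - a₄ q) * g * s + (b₆ - a₆ q) * s ^ 2 = s ^ 3 * z ∧ s ≠ 0 := by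
    have h1 : ∀ᶠ t : K in 𝓝[≠] 0, ‖t‖ < 1 := nhdsWithin_le_nhds
      (by simpa [Metric.ball, dist_zero_right] using Metric.ball_mem_nhds (0 : K) one_pos)
    filter_upwards [h, h1, self_mem_nhdsWithin] with t h h1 h0
    have hu : ‖1 + t‖ = 1 := by simpa using norm_one_sub_of_lt (a := -t) (by simpa using h1)
    have hu0 : 1 + t ≠ 0 := by rw [← norm_ne_zero_iff, hu]; exact one_ne_zero
    have ht0 : t ≠ 0 := h0
    obtain ⟨z, e, hz, he, h2, h3⟩ := cubic_error hq hq0 hu (by simpa using ht0)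
    have hs : ‖(1 - (1 + t)) ^ 2 / (1 + t)‖ = ‖t‖ ^ 2 := by
      rw [norm_div, hu, div_one, norm_pow, sub_add_cancel_left, norm_neg]
    have hs0 : (1 - (1 + t)) ^ 2 / (1 + t) ≠ 0 := by
      rw [← norm_ne_zero_iff, hs]; exact pow_ne_zero _ (norm_ne_zero_iff.2 ht0)
    set s := (1 - (1 + t)) ^ 2 / (1 + t)
    refine ⟨s, s * xFun q (1 + t), z, ?_, ?_, ?_, hz, ?_, hs0⟩
    · rw [hs]; exact pow_le_one₀ (norm_nonneg _) h1.le
    · rw [hs, sq]; exact mul_le_of_le_one_left (norm_nonneg _) h1.le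
    · have : ‖-(s ^ 2 * e)‖ < 1 := by
        rw [norm_neg]
        refine (norm_le_of_mul he).trans_lt ?_
        rw [norm_pow, hs, ← pow_mul]
        exact pow_lt_one₀ (norm_nonneg _) h1 (by norm_num)
      rw [h2]
      simpa using norm_one_sub_of_lt this
    · linear_combination s ^ 2 * (h3 - h)
  have b2 : b₂ = 0 := by
    refine eq_zero_of_norm_le (M := max (max ‖b₄ - a₄ q‖ ‖b₆ - a₆ q‖) 1) ?_
    filter_upwards [key] with t ⟨s, g, z, s1, s2, g1, z1, e, _⟩
    have : b₂ * g ^ 2 = (z * s ^ 2 - ((b₄ - a₄ q) * g + (b₆ - a₆ q) * s)) * s := by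
      linear_combination e
    have h1 := congrArg norm this
    rw [norm_mul, norm_mul, norm_pow, g1, one_pow, mul_one] at h1
    rw [h1]
    refine mul_le_mul ((norm_sub_le_max' _ _).trans (max_le ?_ ?_)) s2 (norm_nonneg _)
      (by positivity)
    · refine le_trans ?_ (le_max_right _ _)
      rw [norm_mul, norm_pow]
      exact mul_le_one₀ z1 (by positivity) (pow_le_one₀ (norm_nonneg _) s1)
    · refine (IsUltrametricDist.norm_add_le_max _ _).trans (le_trans ?_ (le_max_left _ _))
      exact max_le_max (by rw [norm_mul, g1, mul_one]) (norm_le_of_mul s1)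
  have b4 : b₄ - a₄ q = 0 := by
    refine eq_zero_of_norm_le (M := max ‖b₆ - a₆ q‖ 1) ?_
    filter_upwards [key] with t ⟨s, g, z, s1, s2, g1, z1, e, s0⟩
    rw [b2] at e
    have : (b₄ - a₄ q) * g = (z * s - (b₆ - a₆ q)) * s :=
      mul_right_cancel₀ s0 (by linear_combination e)
    have h1 := congrArg norm this
    rw [norm_mul, norm_mul, g1, mul_one] at h1
    rw [h1]
    refine mul_le_mul ((norm_sub_le_max' _ _).trans (max_le ?_ (le_max_left _ _))) s2
      (norm_nonneg _) (by positivity)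
    rw [norm_mul]
    exact (mul_le_one₀ z1 (by positivity) s1).trans (le_max_right _ _)
  refine ⟨b2, sub_eq_zero.1 b4, sub_eq_zero.1 (eq_zero_of_norm_le (M := 1) ?_)⟩
  filter_upwards [key] with t ⟨s, g, z, s1, s2, g1, z1, e, s0⟩
  rw [b2, b4] at e
  have : b₆ - a₆ q = s * z := mul_right_cancel₀ (pow_ne_zero 2 s0) (by linear_combination e)
  rw [this, one_mul]
  exact (norm_le_of_mul z1).trans s2

/-- The cubic of `exists_cubic` contains all points near u = 1, so uniqueness applies. The vanishing
of its X² coefficient is the addition theorem for the triple; the rest is the equation of the curve.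
-/
theorem exists_cubic_eq {q : K} (hq : ‖q‖ < 1) (hq0 : q ≠ 0) {x y w : K} (hx : x ≠ 0)
    (hy : y ≠ 0) (hxyw : x * y * w = 1) (hx' : Generic q x) (hy' : Generic q y)
    (hw' : Generic q w) :
    (zetaSum q x + zetaSum q y + zetaSum q w + 1) ^ 2 +
      (zetaSum q x + zetaSum q y + zetaSum q w + 1) - (xFun q x + xFun q y + xFun q w) = 0 ∧
    ∀ v, v ≠ 0 → Generic q v → Generic q (w * v) → Generic q (w * v⁻¹) →
      yFun q v ^ 2 + xFun q v * yFun q v = xFun q v ^ 3 + a₄ q * xFun q v + a₆ q := by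
  have hw := right_ne_zero_of_mul_eq_one hxyw
  obtain ⟨b₄, b₆, hb⟩ := exists_cubic hq hq0 hx hy hxyw hx' hy' hw'
  obtain ⟨h2, rfl, rfl⟩ := cubic_unique hq hq0 (b₄ := b₄) (b₆ := b₆) (by
    filter_upwards [eventually_one_add_ne_zero, eventually_generic_mul hq hq0 one_ne_zero,
      eventually_generic_mul hq hq0 hw,
      eventually_generic_mul hq hq0 (inv_ne_zero hw)] with t h0 h1 h2 h3
    exact hb _ h0 (h1.of_eq (one_mul _)) h2 (h3.inv.of_eq (by rw [mul_inv, inv_inv])))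
  refine ⟨h2, fun v h1 h3 h4 h5 => ?_⟩
  rw [hb v h1 h3 h4 h5, h2, zero_mul, add_zero]

/-- The coordinates satisfy the equation of the Tate curve. -/
theorem equation {q : K} (hq : ‖q‖ < 1) (hq0 : q ≠ 0) {v : K} (hv : v ≠ 0) (hv' : Generic q v) :
    yFun q v ^ 2 + xFun q v * yFun q v = xFun q v ^ 3 + a₄ q * xFun q v + a₆ q := by
  classical
  -- The cubic misses the v for which wv or w/v is not generic, so w is adapted to the given v; then
  -- x is chosen so that x and (wx)⁻¹ are generic.
  obtain ⟨w, hw, hw'⟩ := exists_generic hq hq0 {1, v, v⁻¹} (by simp [hv])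
  obtain ⟨x, hx, hx'⟩ := exists_generic hq hq0 {1, w} (by simp [hw])
  have h1 := hw' 1 (by simp)
  have h2 := hw' v (by simp)
  have h3 := hw' v⁻¹ (by simp)
  have h4 := hx' 1 (by simp)
  rw [one_mul] at h1 h4
  exact (exists_cubic_eq hq hq0 hx (inv_ne_zero (mul_ne_zero hw hx)) (w := w)
    (by field_simp) h4 (hx' w (by simp)).inv h1).2 v hv hv' (h2.of_eq (mul_comm _ _))
    (h3.of_eq (mul_comm _ _))

/-- The slope of the line through the points with parameters `x` and `y`. -/
theorem sum_xFun {q : K} (hq : ‖q‖ < 1) (hq0 : q ≠ 0) {x y : K} (hx : x ≠ 0)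
    (hy : y ≠ 0) (hx' : Generic q x) (hy' : Generic q y) (hxy : Generic q (x * y)) :
    xFun q x + xFun q y + xFun q (x * y) = (zetaSum q x + zetaSum q y - zetaSum q (x * y)) ^ 2 +
      (zetaSum q x + zetaSum q y - zetaSum q (x * y)) := by
  have h0 := mul_ne_zero hx hy
  have := (exists_cubic_eq hq hq0 hx hy (mul_inv_cancel₀ h0) hx' hy' hxy.inv).1
  rw [xFun_inv hq0 h0 hxy, zetaSum_inv hq hq0 h0 hxy] at this
  linear_combination -this

theorem yFun_mul {q : K} (hq : ‖q‖ < 1) (hq0 : q ≠ 0) {x y : K} (hx : x ≠ 0)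
    (hy : y ≠ 0) (hx' : Generic q x) (hy' : Generic q y) (hxy : Generic q (x * y)) :
    yFun q (x * y) = -((zetaSum q x + zetaSum q y - zetaSum q (x * y)) *
      (xFun q (x * y) - xFun q x) + yFun q x) - xFun q (x * y) := by
  have h0 := mul_ne_zero hx hy
  have e : x * (x * y)⁻¹ = y⁻¹ := by field_simp
  have := yFun_sub hq hq0 hx (inv_ne_zero h0) hx' hxy.inv (hy'.inv.of_eq e.symm)
  rw [e, zetaSum_inv hq hq0 hy hy', zetaSum_inv hq hq0 h0 hxy, xFun_inv hq0 h0 hxy,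
    yFun_inv hq hq0 h0 hxy] at this
  linear_combination this

/-! ### The uniformization -/

theorem norm_coeffA_sub_le {x : K} (hx : ‖x‖ < 1) : ‖coeffA x - x‖ ≤ ‖x ^ 2‖ := by
  obtain ⟨X, S, I, J, rfl, -, hI, -⟩ := exists_lifts hx (s := 0) (by simp)
  have h1 := one_sub_ne_zero_of_norm hx
  refine norm_le_of_eq_mul (I ^ 4 * (8 - (2 + 3) * X + 4 * X ^ 2 - X ^ 3)) ?_
  push_cast
  simp only [unitBall_coe_two, unitBall_coe_three, unitBall_coe_four, unitBall_coe_eight]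
  rw [eq_div_of_mul_eq h1 hI, coeffA]
  field_simp
  ring

theorem norm_sumS_three_sub_le {q : K} (hq : ‖q‖ < 1) : ‖sumS 3 q - q‖ ≤ ‖q‖ ^ 2 := by
  have h : HasSum (fun m : ℕ => coeffA (q ^ (m + 1 + 1))) (sumS 3 q - coeffA q) := by
    have := (hasSum_nat_add_iff' (f := fun m : ℕ => coeffA (q ^ (m + 1))) 1).2 (hasSum_coeffA hq)
    rwa [Finset.sum_range_one, zero_add, pow_one] at this
  have h1 : ‖sumS 3 q - coeffA q‖ ≤ ‖q‖ ^ 2 := by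
    refine norm_le_of_hasSum (by positivity) h fun m => ?_
    refine (norm_coeffA_le (norm_pow_succ_lt_one hq _)).trans ?_
    rw [norm_pow]
    exact pow_le_pow_of_le_one (norm_nonneg _) hq.le (by omega)
  have h2 := norm_coeffA_sub_le hq
  rw [norm_pow] at h2
  rw [show sumS 3 q - q = (sumS 3 q - coeffA q) + (coeffA q - q) by ring]
  exact (IsUltrametricDist.norm_add_le_max _ _).trans (max_le h1 h2)

theorem norm_a₄_le {q : K} (hq : ‖q‖ < 1) : ‖a₄ q‖ ≤ ‖q‖ := by
  rw [a₄, norm_mul, norm_neg]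
  refine (mul_le_of_le_one_left (norm_nonneg _) ?_).trans (norm_sumS_three_le hq)
  exact_mod_cast norm_natCast_le_one' (K := K) 5

theorem norm_a₆_add_le {q : K} (hq : ‖q‖ < 1) : ‖a₆ q + q‖ ≤ ‖q‖ ^ 2 := by
  rw [a₆_eq hq, show -(sumS 3 q + 7 * sumK q) + q = -(sumS 3 q - q) - sumK q * 7 by ring]
  refine (norm_sub_le_max' _ _).trans (max_le ?_ ?_)
  · rw [norm_neg]; exact norm_sumS_three_sub_le hq
  · refine (norm_le_of_mul ?_).trans (norm_sumK_le hq)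
    exact_mod_cast norm_natCast_le_one' (K := K) 7

theorem norm_a₆_le {q : K} (hq : ‖q‖ < 1) : ‖a₆ q‖ ≤ ‖q‖ := by
  rw [show a₆ q = a₆ q + q - q by ring]
  refine (norm_sub_le_max' _ _).trans (max_le ((norm_a₆_add_le hq).trans ?_) le_rfl)
  exact pow_le_of_le_one (norm_nonneg _) hq.le (by norm_num)

theorem exists_eq_mul {a b : K} (hb : b ≠ 0) (h : ‖a‖ ≤ ‖b‖) : ∃ z : unitBall K, a = b * z := by
  refine ⟨⟨a / b, ?_⟩, (mul_div_cancel₀ a hb).symm⟩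
  change ‖a / b‖ ≤ 1
  rw [norm_div]
  exact div_le_one_of_le₀ h (norm_nonneg _)

/-- Since a₄ ∈ qO and a₆ ∈ -q + q²O, with O the unit ball, the discriminant lies in q + q²O. -/
theorem curve_Δ_ne_zero {q : Kˣ} (hq : ‖(q : K)‖ < 1) : (curve q).Δ ≠ 0 := by
  obtain ⟨x, hx⟩ := exists_eq_mul q.ne_zero (norm_a₄_le hq)
  obtain ⟨z, hz⟩ := exists_eq_mul (b := (q : K) ^ 2) (pow_ne_zero 2 q.ne_zero)
    ((norm_a₆_add_le hq).trans_eq (norm_pow _ _).symm)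
  obtain ⟨Q, hQ⟩ : ∃ Q : unitBall K, (Q : K) = q := ⟨⟨q, hq.le⟩, rfl⟩
  have hz' : a₆ (q : K) = q * (-1 + q * z) := by linear_combination hz
  have h : (curve q).Δ - q = q ^ 2 * ((-z + x ^ 2 - ((64 : ℕ) : unitBall K) * Q * x ^ 3 -
      ((432 : ℕ) : unitBall K) * (-1 + Q * z) ^ 2 + ((72 : ℕ) : unitBall K) * x * (-1 + Q * z) :
        unitBall K) : K) := by
    simp only [WeierstrassCurve.Δ, WeierstrassCurve.b₂, WeierstrassCurve.b₄, WeierstrassCurve.b₆,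
      WeierstrassCurve.b₈, curve]
    have c₁ : ((64 : unitBall K) : K) = 64 := map_ofNat (unitBall K).subtype 64
    have c₂ : ((432 : unitBall K) : K) = 432 := map_ofNat (unitBall K).subtype 432
    have c₃ : ((72 : unitBall K) : K) = 72 := map_ofNat (unitBall K).subtype 72
    push_cast
    rw [hx, hz', hQ, c₁, c₂, c₃]
    ring
  have h2 := norm_le_of_eq_mul _ h
  rw [norm_pow] at h2
  intro h0
  rw [h0, zero_sub, norm_neg] at h2
  have h3 := norm_pos_iff.2 q.ne_zero
  nlinarith

theorem generic_iff {q u : Kˣ} : Generic (q : K) u ↔ u ∉ Subgroup.zpowers q := by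
  rw [Subgroup.mem_zpowers_iff]
  push Not
  constructor
  · intro h n hn
    refine h (-n) ?_
    rw [← hn, Units.val_zpow_eq_zpow_val, ← zpow_add₀ q.ne_zero, neg_add_cancel, zpow_zero]
  · intro h n hn
    refine h (-n) (Units.ext ?_)
    rw [Units.val_zpow_eq_zpow_val, zpow_neg]
    exact (eq_inv_of_mul_eq_one_right hn).symm

theorem curve_equation {q u : Kˣ} (hq : ‖(q : K)‖ < 1) (hu : Generic (q : K) u) :
    (curve q).Equation (xCoord q u) (yCoord q u) := by
  rw [WeierstrassCurve.Affine.equation_iff]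
  have := equation hq q.ne_zero u.ne_zero hu
  change yFun (q : K) u ^ 2 + 1 * xFun (q : K) u * yFun (q : K) u + 0 * yFun (q : K) u =
    xFun (q : K) u ^ 3 + 0 * xFun (q : K) u ^ 2 + a₄ (q : K) * xFun (q : K) u + a₆ (q : K)
  rw [one_mul, zero_mul, zero_mul, add_zero, add_zero, this]

theorem curve_nonsingular {q : Kˣ} (hq : ‖(q : K)‖ < 1) {x y : K} (h : (curve q).Equation x y) :
    (curve q).Nonsingular x y :=
  (WeierstrassCurve.Affine.equation_iff_nonsingular_of_Δ_ne_zero (curve_Δ_ne_zero hq)).1 h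

theorem point_eq_zero {q u : Kˣ} (hu : ¬ Generic (q : K) u) : point q u = 0 := by
  rw [point, if_pos (not_not.1 (mt generic_iff.2 hu))]

theorem point_eq_some {q u : Kˣ} (hq : ‖(q : K)‖ < 1) (hu : Generic (q : K) u) :
    point q u = .some (xFun (q : K) u) (yFun (q : K) u)
      (curve_nonsingular hq (curve_equation hq hu)) := by
  rw [point, if_neg (generic_iff.1 hu), dif_pos (curve_nonsingular hq (curve_equation hq hu))]
  rfl

theorem point_eq_zero_iff {q u : Kˣ} (hq : ‖(q : K)‖ < 1) :
    point q u = 0 ↔ u ∈ Subgroup.zpowers q := by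
  by_cases hu : Generic (q : K) u
  · rw [point_eq_some hq hu]
    exact ⟨fun h => (WeierstrassCurve.Affine.Point.some_ne_zero _ h).elim,
      fun h => (generic_iff.1 hu h).elim⟩
  · exact ⟨fun _ => not_not.1 (mt generic_iff.2 hu), fun _ => point_eq_zero hu⟩

open Classical in
theorem point_zpow_mul {q : Kˣ} (u : Kˣ) (m : ℤ) : point q (q ^ m * u) = point q u := by
  have h1 : xCoord q (q ^ m * u) = xCoord q u := by
    have := xSum_zpow_mul q.ne_zero (u : K) m
    simp only [xSum] at this
    simp only [xCoord, Units.val_mul, Units.val_zpow_eq_zpow_val, this]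
  have h2 : yCoord q (q ^ m * u) = yCoord q u := by
    have := ySum_zpow_mul q.ne_zero (u : K) m
    simp only [ySum] at this
    simp only [yCoord, Units.val_mul, Units.val_zpow_eq_zpow_val, this]
  have h3 : q ^ m * u ∈ Subgroup.zpowers q ↔ u ∈ Subgroup.zpowers q :=
    Subgroup.mul_mem_cancel_left _ (Subgroup.zpow_mem_zpowers q m)
  have h4 : ∀ {x y x' y' : K}, x = x' → y = y' →
      (if h : (curve q).Nonsingular x y then WeierstrassCurve.Affine.Point.some x y h else 0) =
      if h : (curve q).Nonsingular x' y' then WeierstrassCurve.Affine.Point.some x' y' h else 0 := by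
    rintro x y _ _ rfl rfl; rfl
  simp only [point, h3]
  rw [h4 h1 h2]

-- For parameters in general position the group law is the chord construction with slope ζ(u) + ζ(v)
-- - ζ(uv). The remaining positions, tangents included, are reached in `point_mul` by an auxiliary
-- shift.
open Classical in
theorem point_mul_of_generic {q u v : Kˣ} (hq : ‖(q : K)‖ < 1) (hu : Generic (q : K) u)
    (hv : Generic (q : K) v) (huv : Generic (q : K) (u * v : Kˣ))
    (huv' : Generic (q : K) (u⁻¹ * v : Kˣ)) : point q (u * v) = point q u + point q v := by
  have hu0 := u.ne_zero
  have hv0 := v.ne_zero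
  rw [point_eq_some hq huv, point_eq_some hq hu, point_eq_some hq hv]
  rw [Units.val_mul] at huv
  rw [Units.val_mul, Units.val_inv_eq_inv_val] at huv'
  have hX := xFun_ne hq q.ne_zero hu0 hv0 hu hv huv' huv
  have hs : (curve q).slope (xFun (q : K) u) (xFun (q : K) v) (yFun (q : K) u) (yFun (q : K) v) =
      zetaSum (q : K) u + zetaSum (q : K) v - zetaSum (q : K) (u * v) := by
    rw [WeierstrassCurve.Affine.slope_of_X_ne hX, div_eq_iff (sub_ne_zero.2 hX),
      yFun_sub hq q.ne_zero hu0 hv0 hu hv huv, mul_comm]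
  have h1 := sum_xFun hq q.ne_zero hu0 hv0 hu hv huv
  have h2 := yFun_mul hq q.ne_zero hu0 hv0 hu hv huv
  have h3 : (curve q).addX (xFun (q : K) u) (xFun (q : K) v) ((curve q).slope (xFun (q : K) u)
      (xFun (q : K) v) (yFun (q : K) u) (yFun (q : K) v)) = xFun (q : K) (u * v) := by
    rw [hs, WeierstrassCurve.Affine.addX]
    change _ + 1 * _ - 0 - _ - _ = _
    linear_combination -h1
  rw [WeierstrassCurve.Affine.Point.add_some (fun h => hX h.1)]
  simp only [WeierstrassCurve.Affine.Point.some.injEq, h3, Units.val_mul, true_and,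
    WeierstrassCurve.Affine.addY, WeierstrassCurve.Affine.negAddY]
  rw [hs, WeierstrassCurve.Affine.negY]
  change _ = _ - 1 * _ - 0
  rw [h2]
  ring

theorem exists_generic_unit {q : Kˣ} (hq : ‖(q : K)‖ < 1) (S : Finset Kˣ) :
    ∃ x : Kˣ, ∀ s ∈ S, Generic (q : K) (s * x : Kˣ) := by
  classical
  obtain ⟨x, hx, h⟩ := exists_generic hq q.ne_zero (S.image Units.val) (by simp)
  refine ⟨Units.mk0 x hx, fun s hs => ?_⟩
  rw [Units.val_mul, Units.val_mk0]
  exact h _ (Finset.mem_image_of_mem _ hs)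

open Classical in
/-- The uniformization is a homomorphism. -/
theorem point_mul {q : Kˣ} (hq : ‖(q : K)‖ < 1) (u v : Kˣ) :
    point q (u * v) = point q u + point q v := by
  have key : ∀ u x : Kˣ, Generic (q : K) x → Generic (q : K) (u * x : Kˣ) →
      Generic (q : K) (u⁻¹ * x : Kˣ) → point q (u * x) = point q u + point q x := by
    intro u x h1 h2 h3
    by_cases hu : Generic (q : K) u
    · exact point_mul_of_generic hq hu h1 h2 h3
    · rw [point_eq_zero hu, zero_add]
      obtain ⟨n, rfl⟩ := not_not.1 (mt generic_iff.2 hu)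
      exact point_zpow_mul x n
  -- Evaluate [uvx] as [uv] + [x] and as [u] + [v] + [x] with x generic for every addition involved,
  -- then cancel [x].
  obtain ⟨x, h2⟩ := exists_generic_unit hq {1, u * v, (u * v)⁻¹, v, u⁻¹ * v, v⁻¹}
  have h1 := h2 1 (by simp)
  rw [one_mul] at h1
  have e1 := key (u * v) x h1 (h2 _ (by simp)) (h2 _ (by simp))
  have e2 := key u (v * x) (h2 v (by simp)) (by rw [← mul_assoc]; exact h2 (u * v) (by simp))
    (by rw [← mul_assoc]; exact h2 (u⁻¹ * v) (by simp))
  have e3 := key v x h1 (h2 _ (by simp)) (h2 _ (by simp))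
  rw [mul_assoc, e2, e3, ← add_assoc] at e1
  exact (add_right_cancel e1).symm

/-! ### Surjectivity of the uniformization -/

/-- `G` is bounded by `b` and Lipschitz with constant `c` on `D`. -/
def LipOn (D : Set K) (b c : ℝ) (G : K → K) : Prop :=
  ∀ x ∈ D, ‖G x‖ ≤ b ∧ ∀ y ∈ D, ‖G x - G y‖ ≤ c * ‖x - y‖

namespace LipOn

variable {D : Set K} {b c b' c' B C : ℝ} {G G' : K → K}

theorem congr (h : LipOn D b c G) (e : ∀ x ∈ D, G' x = G x) : LipOn D b c G' := fun x hx => by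
  refine ⟨?_, fun y hy => ?_⟩
  · rw [e x hx]; exact (h x hx).1
  · rw [e x hx, e y hy]; exact (h x hx).2 y hy

theorem mono (h : LipOn D b c G) (hb : b ≤ B) (hc : c ≤ C) : LipOn D B C G := fun x hx =>
  ⟨(h x hx).1.trans hb, fun y hy => ((h x hx).2 y hy).trans
    (mul_le_mul_of_nonneg_right hc (norm_nonneg _))⟩

theorem const {k : K} (hk : ‖k‖ ≤ b) (hc : 0 ≤ c) : LipOn D b c fun _ => k := fun _ _ =>
  ⟨hk, fun _ _ => by rw [sub_self, norm_zero]; positivity⟩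

theorem add (h : LipOn D b c G) (h' : LipOn D b c G') : LipOn D b c fun x => G x + G' x :=
  fun x hx => ⟨(IsUltrametricDist.norm_add_le_max _ _).trans (max_le (h x hx).1 (h' x hx).1),
    fun y hy => by
      rw [add_sub_add_comm]
      exact (IsUltrametricDist.norm_add_le_max _ _).trans
        (max_le ((h x hx).2 y hy) ((h' x hx).2 y hy))⟩

theorem neg (h : LipOn D b c G) : LipOn D b c fun x => -G x := fun x hx =>
  ⟨by rw [norm_neg]; exact (h x hx).1, fun y hy => by
    rw [← neg_sub', norm_neg]; exact (h x hx).2 y hy⟩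

theorem sub (h : LipOn D b c G) (h' : LipOn D b c G') : LipOn D b c fun x => G x - G' x := by
  simpa only [sub_eq_add_neg] using h.add h'.neg

theorem mul (h : LipOn D b c G) (h' : LipOn D b' c' G') (hB : b * b' ≤ B) (h1 : b * c' ≤ C)
    (h2 : c * b' ≤ C) : LipOn D B C fun x => G x * G' x := fun x hx => by
  refine ⟨?_, fun y hy => ?_⟩
  · rw [norm_mul]
    exact (mul_le_mul (h x hx).1 (h' x hx).1 (norm_nonneg _)
      ((norm_nonneg _).trans (h x hx).1)).trans hB
  · rw [show G x * G' x - G y * G' y = G x * (G' x - G' y) + (G x - G y) * G' y by ring]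
    refine (IsUltrametricDist.norm_add_le_max _ _).trans (max_le ?_ ?_)
    · rw [norm_mul]
      refine (mul_le_mul (h x hx).1 ((h' x hx).2 y hy) (norm_nonneg _)
        ((norm_nonneg _).trans (h x hx).1)).trans ?_
      rw [← mul_assoc]
      exact mul_le_mul_of_nonneg_right h1 (norm_nonneg _)
    · rw [norm_mul]
      refine (mul_le_mul ((h x hx).2 y hy) (h' y hy).1 (norm_nonneg _)
        ((norm_nonneg _).trans ((h x hx).2 y hy))).trans ?_
      rw [mul_right_comm]
      exact mul_le_mul_of_nonneg_right h2 (norm_nonneg _)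

theorem inv_one_sub (h : LipOn D b c G) (hb : b < 1) : LipOn D 1 c fun x => (1 - G x)⁻¹ :=
  fun x hx => by
  have n (x : K) (hx : x ∈ D) : ‖1 - G x‖ = 1 := norm_one_sub_of_lt ((h x hx).1.trans_lt hb)
  refine ⟨by rw [norm_inv, n x hx, inv_one], fun y hy => ?_⟩
  have h1 := one_sub_ne_zero_of_norm ((h x hx).1.trans_lt hb)
  have h2 := one_sub_ne_zero_of_norm ((h y hy).1.trans_lt hb)
  rw [inv_sub_inv h1 h2, norm_div, norm_mul, n x hx, n y hy, mul_one, div_one,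
    sub_sub_sub_cancel_left]
  exact (h x hx).2 y hy

theorem of_hasSum {G : ℕ → K → K} {S : K → K} (hb : 0 ≤ b) (hc : 0 ≤ c)
    (h : ∀ m, LipOn D b c (G m)) (hS : ∀ x ∈ D, HasSum (fun m => G m x) (S x)) :
    LipOn D b c S := fun x hx =>
  ⟨norm_le_of_hasSum hb (hS x hx) fun m => (h m x hx).1, fun y hy =>
    norm_le_of_hasSum (by positivity) ((hS x hx).sub (hS y hy)) fun m => (h m x hx).2 y hy⟩

/-- `z / (1 - z) ^ 2` -/
theorem div_sq (h : LipOn D b c G) (hb : b < 1) (hb0 : 0 ≤ b) (hc : 0 ≤ c) :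
    LipOn D b c fun x => G x / (1 - G x) ^ 2 := by
  have h1 := h.inv_one_sub hb
  have h2 : LipOn D 1 c _ := h1.mul h1 (by simp) (by simp) (by simp)
  refine (h.mul h2 (by simp) (mul_le_of_le_one_left hc hb.le) (by simp)).congr fun x _ => ?_
  rw [div_eq_mul_inv, ← inv_pow, sq]

/-- `z / (1 - z) ^ 3` -/
theorem div_cube (h : LipOn D b c G) (hb : b < 1) (hb0 : 0 ≤ b) (hc : 0 ≤ c) :
    LipOn D b c fun x => G x / (1 - G x) ^ 3 := by
  have h1 := h.inv_one_sub hb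
  refine ((h.div_sq hb hb0 hc).mul h1 (by simp) (mul_le_of_le_one_left hc hb.le)
    (by simp)).congr fun x _ => ?_
  rw [div_eq_mul_inv, div_eq_mul_inv, mul_assoc, ← inv_pow, ← inv_pow, ← pow_succ]

/-- `z ^ 2 / (1 - z) ^ 3` -/
theorem sq_div_cube (h : LipOn D b c G) (hb : b < 1) (hb0 : 0 ≤ b) (hc : 0 ≤ c) :
    LipOn D (b ^ 2) (b * c) fun x => G x ^ 2 / (1 - G x) ^ 3 := by
  refine (h.mul (h.div_cube hb hb0 hc) (sq b).ge le_rfl (mul_comm c b).le).congr fun x _ => ?_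
  rw [sq, mul_div_assoc]

end LipOn

theorem norm_sumS_one_le {q : K} (hq : ‖q‖ < 1) : ‖sumS 1 q‖ ≤ ‖q‖ :=
  norm_le_of_hasSum (norm_nonneg _) (hasSum_sumS_one hq) fun m => by
    rw [norm_div, norm_pow (1 - _), norm_one_sub_of_lt (norm_pow_succ_lt_one hq m), one_pow,
      div_one]
    exact norm_pow_succ_le hq m

theorem hasSum_xFun {q : K} (hq : ‖q‖ < 1) (hq0 : q ≠ 0) {u : K} (hu0 : u ≠ 0) :
    HasSum (fun m : ℕ => q ^ (m + 1) * u / (1 - q ^ (m + 1) * u) ^ 2 +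
      q ^ (m + 1) * u⁻¹ / (1 - q ^ (m + 1) * u⁻¹) ^ 2)
      (xFun q u + 2 * sumS 1 q - u / (1 - u) ^ 2) := by
  refine (hasSum_int_split (summable_xSum hq hq0 hu0)).congr' (fun m => ?_) ?_
  · rw [zpow_neg]
    norm_cast
    have h := pow_ne_zero (m + 1) hq0
    congr 1
    rw [show q ^ (m + 1) * u⁻¹ = ((q ^ (m + 1))⁻¹ * u)⁻¹ by rw [mul_inv, inv_inv]]
    set z := (q ^ (m + 1))⁻¹ * u
    have hz : z ≠ 0 := mul_ne_zero (inv_ne_zero h) hu0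
    rw [show 1 - z⁻¹ = (z - 1) / z by field_simp, div_pow, div_div_eq_mul_div,
      ← sub_sq_comm z 1]
    congr 1
    field_simp
  · rw [zpow_zero, one_mul, xFun, xSum]; ring

theorem hasSum_xFun_add_yFun {q : K} (hq : ‖q‖ < 1) (hq0 : q ≠ 0) {u : K} (hu0 : u ≠ 0)
    (h1 : ∀ m : ℕ, ‖q ^ (m + 1) * u‖ < 1) (h2 : ∀ m : ℕ, ‖q ^ (m + 1) * u⁻¹‖ < 1) (hu1 : u ≠ 1) :
    HasSum (fun m : ℕ => q ^ (m + 1) * u / (1 - q ^ (m + 1) * u) ^ 3 -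
      (q ^ (m + 1) * u⁻¹) ^ 2 / (1 - q ^ (m + 1) * u⁻¹) ^ 3)
      (xFun q u + yFun q u + sumS 1 q - u / (1 - u) ^ 3) := by
  refine (hasSum_int_split ((summable_xSum hq hq0 hu0).add
    (summable_ySum hq hq0 hu0))).congr' (fun m => ?_) ?_
  · rw [zpow_neg]
    norm_cast
    have h := pow_ne_zero (m + 1) hq0
    have n1 := one_sub_ne_zero_of_norm (h1 m)
    have n2 := one_sub_ne_zero_of_norm (h2 m)
    have e : (q ^ (m + 1))⁻¹ * u = (q ^ (m + 1) * u⁻¹)⁻¹ := by rw [mul_inv, inv_inv]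
    rw [e]
    have hz : q ^ (m + 1) * u⁻¹ ≠ 0 := mul_ne_zero h (inv_ne_zero hu0)
    set z := q ^ (m + 1) * u⁻¹
    set z' := q ^ (m + 1) * u
    rw [show 1 - z⁻¹ = -((1 - z) / z) by field_simp; ring, sub_eq_add_neg]
    field_simp; ring
  · rw [((summable_xSum hq hq0 hu0).tsum_add (summable_ySum hq hq0 hu0)), zpow_zero, one_mul, xFun,
      yFun, xSum, ySum]
    have : 1 - u ≠ 0 := sub_ne_zero.2 hu1.symm
    have e : u / (1 - u) ^ 3 = u / (1 - u) ^ 2 + u ^ 2 / (1 - u) ^ 3 := by field_simp; ring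
    rw [e]
    ring

theorem exists_fixedPoint {F : K → K} {u₀ : K} {r c : ℝ} (hr : 0 ≤ r) (hc0 : 0 ≤ c) (hc : c < 1)
    (hF : ∀ x, ‖x - u₀‖ ≤ r → ‖F x - u₀‖ ≤ r ∧ ∀ y, ‖y - u₀‖ ≤ r → ‖F x - F y‖ ≤ c * ‖x - y‖) :
    ∃ x, ‖x - u₀‖ ≤ r ∧ F x = x := by
  have hm : Set.MapsTo F (Metric.closedBall u₀ r) (Metric.closedBall u₀ r) := fun x hx => by
    rw [mem_closedBall_iff_norm] at hx ⊢
    exact (hF x hx).1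
  have hco : ContractingWith ⟨c, hc0⟩ (hm.restrict F _ _) := by
    refine ⟨hc, LipschitzWith.of_dist_le_mul fun x y => ?_⟩
    rw [Subtype.dist_eq, Subtype.dist_eq, dist_eq_norm, dist_eq_norm]
    exact (hF x (mem_closedBall_iff_norm.1 x.2)).2 y (mem_closedBall_iff_norm.1 y.2)
  obtain ⟨x, hx, h, -⟩ := hco.exists_fixedPoint' (Metric.isClosed_closedBall.isComplete) hm
    (Metric.mem_closedBall_self hr) (edist_ne_top _ _)
  exact ⟨x, mem_closedBall_iff_norm.1 hx, h⟩

theorem generic_of_norm {q u : K} (hq : ‖q‖ < 1) (hqu : ‖q‖ < ‖u‖) (hu : ‖u‖ ≤ 1) (hu1 : u ≠ 1) :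
    Generic q u := fun n h => by
  have h1 : u = q ^ (-n) := by rw [zpow_neg]; exact eq_inv_of_mul_eq_one_right h
  rcases lt_trichotomy n 0 with hn | rfl | hn
  · obtain ⟨k, hk⟩ := Int.eq_ofNat_of_zero_le (show 0 ≤ -n - 1 by omega)
    rw [show -n = ((k + 1 : ℕ) : ℤ) by push_cast; omega, zpow_natCast] at h1
    rw [h1] at hqu
    exact hqu.not_ge (norm_pow_succ_le hq k)
  · exact hu1 (by simpa using h1)
  · obtain ⟨k, rfl⟩ := Int.eq_ofNat_of_zero_le hn.le
    have h2 := congrArg norm h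
    rw [zpow_natCast, norm_mul, norm_pow, norm_one] at h2
    have h3 := pow_lt_one₀ (norm_nonneg q) hq (n := k) (by omega)
    have := mul_le_of_le_one_right (pow_nonneg (norm_nonneg q) k) hu
    linarith

theorem lipOn_xFun {q : K} (hq : ‖q‖ < 1) (hq0 : q ≠ 0) {D : Set K} {b c : ℝ}
    (hD : ∀ u ∈ D, u ≠ 0) (h1 : ∀ m : ℕ, LipOn D b c fun u => q ^ (m + 1) * u)
    (h2 : ∀ m : ℕ, LipOn D b c fun u => q ^ (m + 1) * u⁻¹) (hb : b < 1) (hqb : ‖q‖ ≤ b)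
    (hc : 0 ≤ c) : LipOn D b c fun u => xFun q u - u / (1 - u) ^ 2 := by
  have hb0 := (norm_nonneg q).trans hqb
  have h3 : LipOn D b c fun u => xFun q u + 2 * sumS 1 q - u / (1 - u) ^ 2 :=
    LipOn.of_hasSum hb0 hc (fun m => ((h1 m).div_sq hb hb0 hc).add ((h2 m).div_sq hb hb0 hc))
      fun u hu => hasSum_xFun hq hq0 (hD u hu)
  have h4 : ‖2 * sumS 1 q‖ ≤ b := by
    rw [mul_comm]
    refine (norm_le_of_mul ?_).trans ((norm_sumS_one_le hq).trans hqb)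
    exact_mod_cast norm_natCast_le_one' (K := K) 2
  exact (h3.sub (LipOn.const h4 hc)).congr fun u _ => by ring

theorem lipOn_xFun_add_yFun {q : K} (hq : ‖q‖ < 1) (hq0 : q ≠ 0) {D : Set K} {b c b' c' B C : ℝ}
    (hD : ∀ u ∈ D, u ≠ 0) (hD1 : ∀ u ∈ D, u ≠ 1)
    (h1 : ∀ m : ℕ, LipOn D b c fun u => q ^ (m + 1) * u)
    (h2 : ∀ m : ℕ, LipOn D b' c' fun u => q ^ (m + 1) * u⁻¹) (hb : b < 1) (hb' : b' < 1)
    (hb0 : 0 ≤ b) (hb0' : 0 ≤ b') (hc : 0 ≤ c) (hc' : 0 ≤ c') (hbB : b ≤ B) (hcC : c ≤ C)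
    (hbB' : b' ^ 2 ≤ B) (hcC' : b' * c' ≤ C) (hqB : ‖q‖ ≤ B) :
    LipOn D B C fun u => xFun q u + yFun q u - u / (1 - u) ^ 3 := by
  have hB0 := hb0.trans hbB
  have hC0 := hc.trans hcC
  have h3 : LipOn D B C fun u => xFun q u + yFun q u + sumS 1 q - u / (1 - u) ^ 3 :=
    LipOn.of_hasSum hB0 hC0 (fun m => (((h1 m).div_cube hb hb0 hc).mono hbB hcC).sub
      (((h2 m).sq_div_cube hb' hb0' hc').mono hbB' hcC'))
      fun u hu => hasSum_xFun_add_yFun hq hq0 (hD u hu) (fun m => (h1 m u hu).1.trans_lt hb)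
        (fun m => (h2 m u hu).1.trans_lt hb') (hD1 u hu)
  exact (h3.sub (LipOn.const ((norm_sumS_one_le hq).trans hqB) hC0)).congr fun u _ => by ring

/-- Points of the curve with `1 ≤ ‖x‖` have parameters of norm one. -/
theorem exists_param_of_one_le {q : K} (hq : ‖q‖ < 1) (hq0 : q ≠ 0) {x y : K} (hx : 1 ≤ ‖x‖)
    (h : y ^ 2 + x * y = x ^ 3 + a₄ q * x + a₆ q) :
    ∃ u : K, u ≠ 0 ∧ Generic q u ∧ xFun q u = x ∧ yFun q u = y := by
  have ha4 := norm_a₄_le hq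
  have ha6 := norm_a₆_le hq
  have hx0 : 0 < ‖x‖ := by linarith
  -- For `1 ≤ ‖x‖` the cubic term dominates the right-hand side y(x + y).
  have hprod : ‖y‖ * ‖x + y‖ = ‖x‖ ^ 3 := by
    rw [← norm_mul, ← norm_pow, show y * (x + y) = x ^ 3 + (a₄ q * x + a₆ q) by
      linear_combination h]
    have : ‖a₄ q * x + a₆ q‖ < ‖x ^ 3‖ := by
      refine (IsUltrametricDist.norm_add_le_max _ _).trans_lt (max_lt ?_ ?_)
      · rw [norm_mul, norm_pow]; nlinarith [mul_le_mul_of_nonneg_right ha4 hx0.le, sq_nonneg ‖x‖]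
      · rw [norm_pow]; nlinarith [one_le_pow₀ hx (n := 3)]
    rw [IsUltrametricDist.norm_add_eq_max_of_norm_ne_norm this.ne', max_eq_left this.le]
  -- If the norms differed, the larger would be `‖x‖`; then `hprod` makes the smaller one `‖x‖ ^ 2`,
  -- which is at least `‖x‖`.
  have heq : ‖x + y‖ = ‖y‖ := by
    by_contra hne
    have h1 := IsUltrametricDist.norm_add_eq_max_of_norm_ne_norm (x := x + y) (y := -y)
      (by rwa [norm_neg])
    rw [add_neg_cancel_right, norm_neg] at h1
    rcases le_total ‖x + y‖ ‖y‖ with h2 | h2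
    · rw [max_eq_right h2] at h1
      rw [h1] at hprod hx
      have : ‖x + y‖ = ‖y‖ ^ 2 := mul_left_cancel₀ (by linarith : ‖y‖ ≠ 0) (by rw [hprod]; ring)
      have := lt_of_le_of_ne h2 hne
      nlinarith
    · rw [max_eq_left h2] at h1
      rw [h1] at hprod hx
      have : ‖y‖ = ‖x + y‖ ^ 2 :=
        mul_right_cancel₀ (by linarith : ‖x + y‖ ≠ 0) (by rw [hprod]; ring)
      have := lt_of_le_of_ne h2 (Ne.symm hne)
      nlinarith
  rw [heq, ← sq] at hprod
  have hxy : ‖x‖ ≤ ‖y‖ := by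
    refine le_of_sq_le_sq ?_ (norm_nonneg _)
    rw [hprod]; nlinarith [sq_nonneg ‖x‖]
  have hy0 : 0 < ‖y‖ := hx0.trans_le hxy
  have hxy0 : x + y ≠ 0 := by rw [← norm_pos_iff, heq]; exact hy0
  -- For q = 0 the coordinates are u/(1 - u)² and u²/(1 - u)³, so u = y/(x + y). This is the first
  -- approximation.
  obtain ⟨u₀, hu₀⟩ : ∃ u₀, u₀ = y / (x + y) := ⟨_, rfl⟩
  have hu₀n : ‖u₀‖ = 1 := by rw [hu₀, norm_div, heq, div_self hy0.ne']
  have h1u : 1 - u₀ = x / (x + y) := by rw [hu₀]; field_simp; ring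
  have h1n : ‖1 - u₀‖ = ‖x‖ / ‖y‖ := by rw [h1u, norm_div, heq]
  have h1p : 0 < ‖1 - u₀‖ := by rw [h1n]; positivity
  have h1l : ‖1 - u₀‖ ≤ 1 := by rw [h1n]; exact div_le_one_of_le₀ hxy hy0.le
  let D : Set K := {u | ‖u‖ = 1 ∧ u ≠ 1}
  have hD : ∀ u ∈ D, u ≠ 0 := fun u hu h => by simp [h, D] at hu
  have lu : LipOn D 1 1 fun u => u := fun u hu => ⟨hu.1.le, fun v _ => (one_mul _).ge⟩
  have li : LipOn D 1 1 fun u => u⁻¹ := fun u hu => by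
    refine ⟨by rw [norm_inv, hu.1, inv_one], fun v hv => ?_⟩
    rw [inv_sub_inv (hD u hu) (hD v hv), norm_div, norm_mul, hu.1, hv.1, norm_sub_rev]
    simp
  have l1 (m : ℕ) : LipOn D ‖q‖ ‖q‖ fun u => q ^ (m + 1) * u :=
    (LipOn.const (norm_pow_succ_le hq m) le_rfl).mul lu (by simp) (by simp) (by simp)
  have l2 (m : ℕ) : LipOn D ‖q‖ ‖q‖ fun u => q ^ (m + 1) * u⁻¹ :=
    (LipOn.const (norm_pow_succ_le hq m) le_rfl).mul li (by simp) (by simp) (by simp)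
  have q0 := norm_nonneg q
  have lE := lipOn_xFun hq hq0 hD l1 l2 hq le_rfl q0
  have lV := lipOn_xFun_add_yFun hq hq0 hD (fun u hu => hu.2) l1 l2 hq hq q0 q0 q0 q0 le_rfl le_rfl
    (by nlinarith) (by nlinarith) le_rfl
  have lc : LipOn D 1 1 fun _ => u₀ := LipOn.const hu₀n.le zero_le_one
  have lone : LipOn D 1 1 fun u => 1 - u := (LipOn.const (by simp) zero_le_one).sub lu
  have lW := (lc.mul lV (B := ‖q‖) (C := ‖q‖) (by simp) (by simp) (by simp)).sub (lV.sub lE)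
  have lP := ((((lone.mul lone (B := 1) (C := 1) (by simp) (by simp) (by simp)).mul lone
    (B := 1) (C := 1) (by simp) (by simp) (by simp)).mul li (B := 1) (C := 1) (by simp) (by simp)
    (by simp)).mul lW (B := ‖q‖) (C := ‖q‖) (by simp) (by simp) (by simp))
  have hball {u : K} (hu : ‖u - u₀‖ ≤ ‖q‖ * ‖1 - u₀‖) : ‖1 - u‖ = ‖1 - u₀‖ ∧ u ∈ D := by
    have h1 : ‖-(u - u₀)‖ < ‖1 - u₀‖ := by rw [norm_neg]; nlinarith
    have h2 : ‖1 - u‖ = ‖1 - u₀‖ := by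
      rw [show 1 - u = (1 - u₀) + -(u - u₀) by ring,
        IsUltrametricDist.norm_add_eq_max_of_norm_ne_norm h1.ne', max_eq_left h1.le]
    refine ⟨h2, ?_, ?_⟩
    · have h3 : ‖u - u₀‖ < ‖u₀‖ := by rw [hu₀n]; rw [norm_neg] at h1; linarith
      rw [show u = u₀ + (u - u₀) by ring,
        IsUltrametricDist.norm_add_eq_max_of_norm_ne_norm h3.ne', max_eq_left h3.le, hu₀n]
    · rintro rfl
      rw [sub_self, norm_zero] at h2
      exact h1p.ne h2
  -- The map equals u + (1 - u)³ u⁻¹ (u₀ (X + Y) - Y), so its fixed points are the parameters of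
  -- points on the line y = u₀ (x + y). It contracts by `‖q‖` because the deviations from the case q
  -- = 0 have that size.
  obtain ⟨u, hu, hfix⟩ := exists_fixedPoint (F := fun u => u₀ + (1 - u) * (1 - u) * (1 - u) * u⁻¹ *
    (u₀ * (xFun q u + yFun q u - u / (1 - u) ^ 3) -
      (xFun q u + yFun q u - u / (1 - u) ^ 3 - (xFun q u - u / (1 - u) ^ 2))))
    (u₀ := u₀) (r := ‖q‖ * ‖1 - u₀‖) (by positivity) q0 hq (fun u hu => by
      obtain ⟨h1, hD'⟩ := hball hu
      refine ⟨?_, fun v hv => ?_⟩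
      · rw [add_sub_cancel_left, norm_mul, norm_mul, norm_mul, norm_mul, norm_inv, hD'.1, h1,
          inv_one, mul_one, mul_comm]
        have : ‖1 - u₀‖ * ‖1 - u₀‖ * ‖1 - u₀‖ ≤ ‖1 - u₀‖ := by
          nlinarith [mul_le_one₀ h1l h1p.le h1l]
        exact mul_le_mul (lW u hD').1 this (by positivity) q0
      · rw [add_sub_add_left_eq_sub]
        exact (lP u hD').2 v (hball hv).2)
  obtain ⟨hu1, hD'⟩ := hball hu
  have hu0 := hD u hD'
  have hu1' : 1 - u ≠ 0 := sub_ne_zero.2 hD'.2.symm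
  have hline : u₀ * (xFun q u + yFun q u) = yFun q u := by
    beta_reduce at hfix
    generalize xFun q u = X at hfix ⊢
    generalize yFun q u = Y at hfix ⊢
    field_simp at hfix
    refine mul_left_cancel₀ (pow_ne_zero 3 hu1') ?_
    linear_combination hfix
  have hX : 1 ≤ ‖xFun q u‖ := by
    have h1 : ‖xFun q u - u / (1 - u) ^ 2‖ < 1 := (lE u hD').1.trans_lt hq
    have h2 : 1 ≤ ‖u / (1 - u) ^ 2‖ := by
      rw [norm_div, hD'.1, norm_pow, hu1]
      exact (one_le_div (by positivity)).2 (pow_le_one₀ h1p.le h1l)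
    rw [show xFun q u = u / (1 - u) ^ 2 + (xFun q u - u / (1 - u) ^ 2) by ring,
      IsUltrametricDist.norm_add_eq_max_of_norm_ne_norm (h1.trans_le h2).ne']
    exact h2.trans (le_max_left _ _)
  have hgen : Generic q u := generic_of_norm hq (by rwa [hD'.1]) hD'.1.le hD'.2
  have heqn := equation hq hq0 hu0 hgen
  refine ⟨u, hu0, hgen, ?_⟩
  have hline' : u₀ * (x + y) = y := by rw [hu₀]; field_simp
  have hu₀1 : 1 - u₀ ≠ 0 := norm_pos_iff.1 h1p
  generalize xFun q u = X at *
  generalize yFun q u = Y at *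
  have hYX : Y = u₀ / (1 - u₀) * X := by field_simp; linear_combination -hline
  have hyx : y = u₀ / (1 - u₀) * x := by field_simp; linear_combination -hline'
  -- The line passes through (0, 0). Eliminating its slope between two intersections with X ≠ x
  -- gives x²X² = xX a₄ + a₆ (x + X), whose right-hand side is too small.
  have hXx : X = x := by
    by_contra hne
    have h1 : x ^ 2 * X ^ 2 = x * X * a₄ q + a₆ q * (x + X) := by
      refine mul_left_cancel₀ (sub_ne_zero.2 hne) ?_
      rw [hYX] at heqn
      rw [hyx] at h
      linear_combination (-x ^ 2) * heqn + X ^ 2 * h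
    have hX0 : 0 < ‖X‖ := by linarith
    have h2 : ‖x * X * a₄ q + a₆ q * (x + X)‖ ≤ ‖x‖ * ‖X‖ * ‖q‖ := by
      refine (IsUltrametricDist.norm_add_le_max _ _).trans (max_le ?_ ?_)
      · rw [norm_mul, norm_mul]; exact mul_le_mul_of_nonneg_left ha4 (by positivity)
      · rw [norm_mul, mul_comm]
        refine mul_le_mul ((IsUltrametricDist.norm_add_le_max _ _).trans (max_le ?_ ?_)) ha6
          (norm_nonneg _) (by positivity)
        · nlinarith
        · nlinarith
    rw [← h1, norm_mul, norm_pow, norm_pow] at h2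
    have : 1 ≤ ‖x‖ * ‖X‖ := one_le_mul_of_one_le_of_one_le hx hX
    nlinarith
  exact ⟨hXx, by rw [hYX, hyx, hXx]⟩

/-- Points of the curve with `‖x‖ < 1`, up to sign, have parameters with `‖q‖ < ‖u‖ < 1`. -/
theorem exists_param_of_lt_one {q : K} (hq : ‖q‖ < 1) (hq0 : q ≠ 0) {x y : K} (hx : ‖x‖ < 1)
    (h : y ^ 2 + x * y = x ^ 3 + a₄ q * x + a₆ q) (hy : ‖y‖ ≤ ‖x + y‖) :
    ∃ u : K, u ≠ 0 ∧ Generic q u ∧ xFun q u = x ∧ yFun q u = y := by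
  have ha4 := norm_a₄_le hq
  have q0 := norm_pos_iff.2 hq0
  -- `a₆ q` is -q up to order q², so it is not smaller than q.
  have ha6 : ‖q‖ ≤ ‖a₆ q‖ := by
    have h1 := norm_a₆_add_le hq
    have h2 : ‖q‖ ≤ max ‖a₆ q + q‖ ‖a₆ q‖ := by
      simpa using norm_sub_le_max' (a₆ q + q) (a₆ q)
    rcases le_max_iff.1 h2 with h3 | h3
    · nlinarith
    · exact h3
  -- For `‖q‖ < ‖u‖ < 1` the sum X + Y equals u up to smaller terms, so w = x + y is the first
  -- approximation to the parameter.
  obtain ⟨w, hw⟩ : ∃ w, w = x + y := ⟨_, rfl⟩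
  rw [← hw] at hy
  have hxw : ‖x‖ ≤ ‖w‖ := by
    rw [show x = w - y by rw [hw]; ring]
    exact (norm_sub_le_max' _ _).trans (max_le le_rfl hy)
  have hyw : y * w = x ^ 3 + a₄ q * x + a₆ q := by rw [hw]; linear_combination h
  have hw1 : ‖w‖ < 1 := by
    by_contra hw1
    rw [not_lt] at hw1
    have h1 : ‖-x‖ < ‖w‖ := by rw [norm_neg]; linarith
    have h2 : ‖y‖ = ‖w‖ := by
      rw [show y = w + -x by rw [hw]; ring,
        IsUltrametricDist.norm_add_eq_max_of_norm_ne_norm h1.ne', max_eq_left h1.le]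
    have h3 : ‖y * w‖ < 1 := by
      rw [hyw]
      refine (IsUltrametricDist.norm_add_le_max _ _).trans_lt (max_lt
        ((IsUltrametricDist.norm_add_le_max _ _).trans_lt (max_lt ?_ ?_))
        ((norm_a₆_le hq).trans_lt hq))
      · rw [norm_pow]; exact pow_lt_one₀ (norm_nonneg _) hx (by norm_num)
      · rw [norm_mul]; nlinarith [norm_nonneg x, norm_nonneg (a₄ q)]
    rw [norm_mul, h2] at h3
    nlinarith
  -- Otherwise every term of a₆ = yw - x³ - a₄x would be smaller than q. The bound keeps `q / u` at
  -- most of size `‖w‖` on the circle `‖u‖ = ‖w‖`.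
  have hqw : ‖q‖ ≤ ‖w‖ ^ 2 := by
    by_contra hlt
    rw [not_le] at hlt
    have h3 : ‖a₆ q‖ < ‖q‖ := by
      rw [show a₆ q = y * w + (-(x ^ 3) + -(a₄ q * x)) by rw [hyw]; ring]
      refine (IsUltrametricDist.norm_add_le_max _ _).trans_lt (max_lt ?_
        ((IsUltrametricDist.norm_add_le_max _ _).trans_lt (max_lt ?_ ?_)))
      · rw [norm_mul]; nlinarith [norm_nonneg w]
      · rw [norm_neg, norm_pow]
        nlinarith [pow_le_pow_left₀ (norm_nonneg x) hxw 2, norm_nonneg x, sq_nonneg ‖x‖]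
      · rw [norm_neg, norm_mul]; nlinarith [norm_nonneg x, norm_nonneg (a₄ q)]
    linarith
  have hw0 : 0 < ‖w‖ := (norm_nonneg w).lt_of_ne fun h0 => by rw [← h0] at hqw; nlinarith
  let D : Set K := {u | ‖u‖ = ‖w‖}
  have hD : ∀ u ∈ D, u ≠ 0 := fun u hu h => by
    simp only [D, Set.mem_ofPred_eq, h, norm_zero] at hu
    exact hw0.ne hu
  have hD1 : ∀ u ∈ D, u ≠ 1 := fun u hu h => by
    simp only [D, Set.mem_ofPred_eq, h, norm_one] at hu
    exact hw1.ne' hu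
  have lu : LipOn D ‖w‖ 1 fun u => u := fun u hu => ⟨le_of_eq hu, fun v _ => (one_mul _).ge⟩
  have l2 (m : ℕ) : LipOn D ‖w‖ 1 fun u => q ^ (m + 1) * u⁻¹ := fun u hu => by
    have hm := (norm_pow_succ_le hq m).trans hqw
    refine ⟨?_, fun v hv => ?_⟩
    · rw [norm_mul, norm_inv, show ‖u‖ = ‖w‖ from hu, ← div_eq_mul_inv, div_le_iff₀ hw0, ← sq]
      exact hm
    · rw [← mul_sub, inv_sub_inv (hD u hu) (hD v hv), norm_mul, norm_div, norm_mul,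
        show ‖u‖ = ‖w‖ from hu, show ‖v‖ = ‖w‖ from hv, norm_sub_rev, ← sq, one_mul, mul_div_assoc',
        div_le_iff₀ (by positivity), mul_comm]
      exact mul_le_mul_of_nonneg_left hm (norm_nonneg _)
  have hw2 : ‖w‖ ^ 2 ≤ ‖w‖ := by nlinarith
  have l1 (m : ℕ) : LipOn D (‖w‖ ^ 2) ‖w‖ fun u => q ^ (m + 1) * u :=
    (LipOn.const ((norm_pow_succ_le hq m).trans hqw) (le_refl (0 : ℝ))).mul lu (by nlinarith)
      (by nlinarith) (by nlinarith)
  have lE := lipOn_xFun hq hq0 hD (fun m => (l1 m).mono hw2 hw1.le) l2 hw1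
    (hqw.trans hw2) zero_le_one
  have lV := lipOn_xFun_add_yFun hq hq0 hD hD1 l1 l2 (by nlinarith) hw1 (by positivity)
    (norm_nonneg _) (norm_nonneg _) zero_le_one le_rfl le_rfl le_rfl (by simp) hqw
  have l3 := lu.inv_one_sub hw1
  have l4 : LipOn D 1 1 _ := (l3.mul l3 (B := 1) (C := 1) (by simp) (by simp) (by simp)).mul l3
    (by simp) (by simp) (by simp)
  have lc (n : ℕ) : LipOn D 1 1 fun _ => (n : K) :=
    LipOn.const (norm_natCast_le_one' n) zero_le_one
  have lu1 := lu.mono hw1.le le_rfl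
  have l5 : LipOn D 1 1 fun u => u * u - (3 : ℕ) * u + (3 : ℕ) :=
    ((lu1.mul lu1 (by simp) (by simp) (by simp)).sub
      ((lc 3).mul lu1 (by simp) (by simp) (by simp))).add (lc 3)
  have l6 := ((lu.mul lu (B := ‖w‖ ^ 2) (C := ‖w‖) (sq _).ge (by simp) (by simp)).mul
    (l5.mul l4 (B := 1) (C := 1) (by simp) (by simp) (by simp)) (B := ‖w‖ ^ 2) (C := ‖w‖)
    (by simp) (by simpa using hw2) (by simp)).neg
  have l7 := (l6.sub lV).congr (G' := fun u => u - (xFun q u + yFun q u)) fun u hu => by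
    have := sub_ne_zero.2 (hD1 u hu).symm
    push_cast
    field_simp
    ring
  have hball {u : K} (hu : ‖u - w‖ ≤ ‖w‖ ^ 2) : u ∈ D := by
    have h3 : ‖u - w‖ < ‖w‖ := by nlinarith
    change ‖u‖ = ‖w‖
    rw [show u = w + (u - w) by ring,
      IsUltrametricDist.norm_add_eq_max_of_norm_ne_norm h3.ne', max_eq_left h3.le]
  -- A fixed point satisfies X(u) + Y(u) = w. The difference u - (X + Y) has size `‖w‖ ^ 2` and
  -- Lipschitz constant `‖w‖` on the circle.
  obtain ⟨u, hu, hfix⟩ := exists_fixedPoint (F := fun u => w + (u - (xFun q u + yFun q u)))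
    (u₀ := w) (r := ‖w‖ ^ 2) (by positivity) hw0.le hw1 (fun u hu => by
      refine ⟨?_, fun v hv => ?_⟩
      · rw [add_sub_cancel_left]; exact (l7 u (hball hu)).1
      · rw [add_sub_add_left_eq_sub]; exact (l7 u (hball hu)).2 v (hball hv))
  have hD' := hball hu
  have hun : ‖u‖ = ‖w‖ := hD'
  have hgen : Generic q u := generic_of_norm hq (by rw [hun]; nlinarith) (by rw [hun]; exact hw1.le)
    (hD1 u hD')
  have hX : ‖xFun q u‖ ≤ ‖w‖ := by
    rw [show xFun q u = u / (1 - u) ^ 2 + (xFun q u - u / (1 - u) ^ 2) by ring]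
    refine (IsUltrametricDist.norm_add_le_max _ _).trans (max_le ?_ (lE u hD').1)
    rw [norm_div, norm_pow, norm_one_sub_of_lt (by rwa [hun]), one_pow, div_one, hun]
  have heqn := equation hq hq0 (hD u hD') hgen
  refine ⟨u, hD u hD', hgen, ?_⟩
  generalize xFun q u = X at *
  generalize yFun q u = Y at *
  -- Two points with the same value of x + y and different x would satisfy w = -(x² + xX + X² + a₄),
  -- which has norm at most `‖w‖ ^ 2`.
  have hXx : X = x := by
    by_contra hne
    have h1 : w = -(x * x + (x * X + (X * X + a₄ q))) := by
      refine mul_left_cancel₀ (sub_ne_zero.2 hne) ?_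
      have e1 : Y = w - X := by linear_combination -hfix
      have e2 : y = w - x := by rw [hw]; ring
      rw [e1] at heqn
      rw [e2] at h
      linear_combination h - heqn
    have h2 : ‖w‖ ≤ ‖w‖ ^ 2 := by
      conv_lhs => rw [h1, norm_neg]
      have m {a b : K} (ha : ‖a‖ ≤ ‖w‖) (hb : ‖b‖ ≤ ‖w‖) : ‖a * b‖ ≤ ‖w‖ ^ 2 := by
        rw [norm_mul, sq]; exact mul_le_mul ha hb (norm_nonneg _) hw0.le
      exact (IsUltrametricDist.norm_add_le_max _ _).trans (max_le (m hxw hxw)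
        ((IsUltrametricDist.norm_add_le_max _ _).trans (max_le (m hxw hX)
          ((IsUltrametricDist.norm_add_le_max _ _).trans (max_le (m hX hX) (ha4.trans hqw))))))
    nlinarith
  refine ⟨hXx, ?_⟩
  rw [hXx] at hfix
  linear_combination hw - hfix

/-- The uniformization is surjective. -/
theorem point_surjective {q : Kˣ} (hq : ‖(q : K)‖ < 1) : Function.Surjective (point q) := by
  have key : ∀ {x y : K} (h : (curve q).Nonsingular x y), (∃ u : K, u ≠ 0 ∧ Generic (q : K) u ∧
      xFun (q : K) u = x ∧ yFun (q : K) u = y) → ∃ u, point q u = .some x y h := by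
    rintro x y h ⟨u, hu, hg, rfl, rfl⟩
    exact ⟨Units.mk0 u hu, point_eq_some hq (u := Units.mk0 u hu) hg⟩
  rintro (_ | ⟨x, y, h⟩)
  · exact ⟨1, (point_eq_zero_iff hq).2 (one_mem _)⟩
  · have heq := (WeierstrassCurve.Affine.equation_iff _ _).1 h.1
    change y ^ 2 + 1 * x * y + 0 * y = x ^ 3 + 0 * x ^ 2 + a₄ (q : K) * x + a₆ (q : K) at heq
    replace heq : y ^ 2 + x * y = x ^ 3 + a₄ (q : K) * x + a₆ (q : K) := by
      linear_combination heq
    rcases le_or_gt 1 ‖x‖ with hx | hx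
    · exact key h (exists_param_of_one_le hq q.ne_zero hx heq)
    rcases le_total ‖y‖ ‖x + y‖ with hy | hy
    · exact key h (exists_param_of_lt_one hq q.ne_zero hx heq hy)
    -- Negation y ↦ -y - x exchanges the norms of y and x + y, and replaces u by u⁻¹.
    · obtain ⟨u, hu0, hu, hX, hY⟩ := exists_param_of_lt_one hq q.ne_zero hx (y := -y - x)
        (by linear_combination heq) (by
          rwa [show -y - x = -(x + y) by ring, show x + -(x + y) = -y by ring, norm_neg, norm_neg])
      refine key h ⟨u⁻¹, inv_ne_zero hu0, hu.inv, ?_, ?_⟩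
      · rw [xFun_inv q.ne_zero hu0 hu, hX]
      · rw [yFun_inv hq q.ne_zero hu0 hu, hX, hY]; ring

end Analytic

end TateCurve

/-! ### Leading coefficients with respect to a local parameter -/

namespace ValuationSubring

variable {k F : Type*} [Field k] [Field F] [Algebra k F] {R : ValuationSubring F}

/-- `f = (c + ε) t ^ n` with `ε` in the maximal ideal of `R`. -/
def HasLead (R : ValuationSubring F) (t f : F) (n : ℤ) (c : kˣ) : Prop :=
  f / t ^ n - algebraMap k F c ∈ R.nonunits

/-- `R` contains the field of constants. -/
def ContainsConstants (k : Type*) [Field k] [Algebra k F] (R : ValuationSubring F) : Prop :=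
  ∀ c : k, algebraMap k F c ∈ R

theorem valuation_algebraMap (hR : R.ContainsConstants k) (c : kˣ) :
    R.valuation (algebraMap k F c) = 1 := by
  refine le_antisymm ((R.valuation_le_one_iff _).2 (hR c)) ?_
  have h := (R.valuation_le_one_iff _).2 (hR (c⁻¹ : kˣ))
  rw [Units.val_inv_eq_inv_val, map_inv₀, map_inv₀] at h
  have h0 : R.valuation (algebraMap k F c) ≠ 0 :=
    (Valuation.ne_zero_iff _).2 (by simp)
  exact (inv_le_one₀ (zero_lt_iff.2 h0)).1 h

theorem mul_mem_nonunits {a b : F} (ha : a ∈ R) (hb : b ∈ R.nonunits) : a * b ∈ R.nonunits := by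
  rw [mem_nonunits_iff, map_mul] at *
  exact (mul_le_of_le_one_left' ((R.valuation_le_one_iff a).2 ha)).trans_lt hb

theorem algebraMap_notMem_nonunits (hR : R.ContainsConstants k) (c : kˣ) :
    algebraMap k F c ∉ R.nonunits := by
  rw [mem_nonunits_iff, valuation_algebraMap hR]; exact lt_irrefl _

namespace HasLead

variable {t f g : F} {n m : ℤ} {c d : kˣ}

theorem valuation_eq (hR : R.ContainsConstants k) (h : R.HasLead t f n c) :
    R.valuation (f / t ^ n) = 1 := by
  rw [HasLead, mem_nonunits_iff, ← valuation_algebraMap hR c] at h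
  rw [← sub_add_cancel (f / t ^ n) (algebraMap k F c),
    Valuation.map_add_eq_of_lt_right _ h, valuation_algebraMap hR]

theorem mem (hR : R.ContainsConstants k) (h : R.HasLead t f n c) : f / t ^ n ∈ R :=
  (R.valuation_le_one_iff _).1 (h.valuation_eq hR).le

theorem valuation_eq_zpow (hR : R.ContainsConstants k) (ht : t ≠ 0) (h : R.HasLead t f n c) :
    R.valuation f = R.valuation t ^ n := by
  have := h.valuation_eq hR
  rwa [map_div₀, map_zpow₀, div_eq_one_iff_eq] at this
  exact zpow_ne_zero _ ((Valuation.ne_zero_iff _).2 ht)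

theorem mul (hR : R.ContainsConstants k) (h : R.HasLead t f n c) (h' : R.HasLead t g m d)
    (ht : t ≠ 0) : R.HasLead t (f * g) (n + m) (c * d) := by
  have e : f * g / t ^ (n + m) - algebraMap k F (c * d : kˣ) =
      f / t ^ n * (g / t ^ m - algebraMap k F d) +
        algebraMap k F d * (f / t ^ n - algebraMap k F c) := by
    rw [zpow_add₀ ht, Units.val_mul, map_mul, mul_div_mul_comm]; ring
  rw [HasLead, e]
  exact AddMemClass.add_mem (mul_mem_nonunits (h.mem hR) h') (mul_mem_nonunits (hR _) h)

theorem inv (hR : R.ContainsConstants k) (h : R.HasLead t f n c) :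
    R.HasLead t f⁻¹ (-n) c⁻¹ := by
  have h1 := h.valuation_eq hR
  have h0 : f / t ^ n ≠ 0 := fun h => by simp [h] at h1
  have hc : algebraMap k F c ≠ 0 := by simp
  have h2 : (f / t ^ n)⁻¹ * algebraMap k F (c⁻¹ : kˣ) ∈ R := MulMemClass.mul_mem
    ((R.valuation_le_one_iff _).1 (by rw [map_inv₀, h1, inv_one])) (hR _)
  have e : f⁻¹ / t ^ (-n) - algebraMap k F (c⁻¹ : kˣ) =
      (f / t ^ n)⁻¹ * algebraMap k F (c⁻¹ : kˣ) * -(f / t ^ n - algebraMap k F c) := by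
    rw [Units.val_inv_eq_inv_val, map_inv₀, zpow_neg, div_inv_eq_mul, inv_div]
    rw [div_ne_zero_iff] at h0
    obtain ⟨h3, h4⟩ := h0
    field_simp
    ring
  rw [HasLead, e]
  exact mul_mem_nonunits h2 (NegMemClass.neg_mem h)

theorem div (hR : R.ContainsConstants k) (h : R.HasLead t f n c) (h' : R.HasLead t g m d)
    (ht : t ≠ 0) : R.HasLead t (f / g) (n - m) (c / d) := by
  rw [div_eq_mul_inv, div_eq_mul_inv, sub_eq_add_neg]
  exact h.mul hR (h'.inv hR) ht

theorem const (c : kˣ) : R.HasLead t (algebraMap k F c) 0 c := by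
  rw [HasLead, zpow_zero, div_one, sub_self]; exact ZeroMemClass.zero_mem _

theorem pow (hR : R.ContainsConstants k) (h : R.HasLead t f n c) (ht : t ≠ 0) (j : ℕ) :
    R.HasLead t (f ^ j) (j * n) (c ^ j) := by
  induction j with
  | zero => simpa using const (k := k) (R := R) (t := t) 1
  | succ j ih =>
    have := ih.mul hR h ht
    rwa [← pow_succ, ← pow_succ, show (j : ℤ) * n + n = ((j + 1 : ℕ) : ℤ) * n by push_cast; ring]
      at this

theorem prod (hR : R.ContainsConstants k) (ht : t ≠ 0) {ι : Type*} (s : Finset ι) {f : ι → F}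
    {n : ι → ℤ} {c : ι → kˣ} (h : ∀ i ∈ s, R.HasLead t (f i) (n i) (c i)) :
    R.HasLead t (∏ i ∈ s, f i) (∑ i ∈ s, n i) (∏ i ∈ s, c i) := by
  classical
  induction s using Finset.induction_on with
  | empty => simpa using const (k := k) (R := R) (t := t) 1
  | insert i s hi ih =>
    rw [Finset.prod_insert hi, Finset.sum_insert hi, Finset.prod_insert hi]
    exact (h i (Finset.mem_insert_self i s)).mul hR
      (ih fun j hj => h j (Finset.mem_insert_of_mem hj)) ht

theorem self (ht : t ≠ 0) : R.HasLead t t 1 (1 : kˣ) := by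
  rw [HasLead, zpow_one, div_self ht, Units.val_one, map_one, sub_self]; exact ZeroMemClass.zero_mem _

/-- Adding an element of larger order. -/
theorem add (ht : t ≠ 0) (hR : R.ContainsConstants k) (htR : t ∈ R.nonunits)
    (h : R.HasLead t f n c) (h' : R.HasLead t g m d) (hnm : n < m) :
    R.HasLead t (f + g) n c := by
  have e : (f + g) / t ^ n - algebraMap k F c =
      (f / t ^ n - algebraMap k F c) + g / t ^ m * t ^ (m - n - 1).toNat * t := by
    have : t ^ m = t ^ n * (t ^ (m - n - 1).toNat * t) := by
      rw [← pow_succ, ← zpow_natCast, ← zpow_add₀ ht]; congr 1; omega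
    rw [this]
    have := zpow_ne_zero n ht
    field_simp
    ring
  rw [HasLead, e]
  exact AddMemClass.add_mem h (mul_mem_nonunits (MulMemClass.mul_mem (h'.mem hR)
    (_root_.pow_mem (nonunits_subset htR) _)) htR)

end HasLead

/-- A valuation ring all of whose elements have leading coefficients is discrete. -/
theorem isDVR_of_hasLead (hR : R.ContainsConstants k) {t : F} (ht : t ≠ 0) (htR : t ∈ R.nonunits)
    (h : ∀ f : F, f ≠ 0 → ∃ n : ℤ, ∃ c : kˣ, R.HasLead t f n c) :
    IsDiscreteValuationRing R := by
  have ht1 : R.valuation t < 1 := R.mem_nonunits_iff.1 htR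
  have ht0 : 0 < R.valuation t := zero_lt_iff.2 ((Valuation.ne_zero_iff _).2 ht)
  have key : ∀ x : R, x ≠ 0 → ∃ n : ℕ, R.valuation (x : F) = R.valuation t ^ n := by
    intro x hx
    have hx0 : (x : F) ≠ 0 := fun h => hx (Subtype.ext h)
    obtain ⟨n, c, hn⟩ := h x hx0
    have h1 := hn.valuation_eq_zpow hR ht
    have h2 := (R.valuation_le_one_iff _).2 x.2
    rw [h1] at h2
    have h3 : 0 ≤ n := by
      by_contra hlt
      exact h2.not_gt (one_lt_zpow_of_neg₀ ht0 ht1 (not_le.1 hlt))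
    obtain ⟨j, rfl⟩ := Int.eq_ofNat_of_zero_le h3
    exact ⟨j, by rw [h1, zpow_natCast]⟩
  have hunit : ∀ x : R, R.valuation (x : F) = 1 → IsUnit x := fun x hx => by
    exact (R.valuation_eq_one_iff x).2 hx
  let T : R := ⟨t, nonunits_subset htR⟩
  refine IsDiscreteValuationRing.ofHasUnitMulPowIrreducibleFactorization ⟨T, ⟨?_, ?_⟩, ?_⟩
  · intro hT
    exact ht1.ne ((R.valuation_eq_one_iff T).1 hT)
  · intro a b hab
    have hT0 : T ≠ 0 := fun h => ht (congrArg Subtype.val h)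
    rw [hab] at hT0
    obtain ⟨i, hi⟩ := key a (left_ne_zero_of_mul hT0)
    obtain ⟨j, hj⟩ := key b (right_ne_zero_of_mul hT0)
    have h1 : R.valuation t ^ 1 = R.valuation t ^ (i + j) := by
      rw [pow_add, ← hi, ← hj, ← map_mul, pow_one]
      exact congrArg (fun x : R => R.valuation (x : F)) hab
    have h2 : 1 = i + j := (pow_right_strictAnti₀ ht0 ht1).injective h1
    rcases (show i = 0 ∨ j = 0 by omega) with rfl | rfl
    · exact Or.inl (hunit a (by rw [hi, pow_zero]))
    · exact Or.inr (hunit b (by rw [hj, pow_zero]))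
  · intro x hx
    obtain ⟨n, hn⟩ := key x hx
    have hv : R.valuation ((x : F) / t ^ n) = 1 := by
      rw [map_div₀, map_pow, hn, div_self (pow_ne_zero _ ht0.ne')]
    let w : R := ⟨x / t ^ n, (R.valuation_le_one_iff _).1 hv.le⟩
    refine ⟨n, (hunit w hv).unit, Subtype.ext ?_⟩
    change t ^ n * ((x : F) / t ^ n) = x
    field_simp

end ValuationSubring

/-! ### Orders of vanishing, parameters and residue fields at closed points -/

namespace CurvePoint

variable {k F : Type*} [Field k] [Field F] [Algebra k F]

theorem containsConstants (Q : CurvePoint k F) : Q.ring.ContainsConstants k := Q.algebraMap_mem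

theorem ext_ring {Q Q' : CurvePoint k F} (h : Q.ring = Q'.ring) : Q = Q' := by
  cases Q; cases Q'; cases h; rfl

variable (Q : CurvePoint k F)

theorem valuation_ne_zero (f : Fˣ) :
    (IsDiscreteValuationRing.maximalIdeal Q.ring).valuation F (f : F) ≠ 0 :=
  (Valuation.ne_zero_iff _).2 f.ne_zero

theorem ord_mul (f g : Fˣ) : Q.ord (f * g) = Q.ord f + Q.ord g := by
  rw [ord, ord, ord, Units.val_mul, map_mul, WithZero.log_mul (Q.valuation_ne_zero f)
    (Q.valuation_ne_zero g), neg_add]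

/-- The order of vanishing as a homomorphism. -/
noncomputable def ordHom : Fˣ →* Multiplicative ℤ :=
  MonoidHom.mk' (fun f => Multiplicative.ofAdd (Q.ord f)) fun f g => by rw [Q.ord_mul]; rfl

theorem ord_one : Q.ord 1 = 0 := congrArg Multiplicative.toAdd (map_one Q.ordHom)

theorem ord_inv (f : Fˣ) : Q.ord f⁻¹ = -Q.ord f :=
  congrArg Multiplicative.toAdd (map_inv Q.ordHom f)

theorem ord_div (f g : Fˣ) : Q.ord (f / g) = Q.ord f - Q.ord g :=
  congrArg Multiplicative.toAdd (map_div Q.ordHom f g)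

theorem ord_zpow (f : Fˣ) (n : ℤ) : Q.ord (f ^ n) = n * Q.ord f :=
  (congrArg Multiplicative.toAdd (map_zpow Q.ordHom f n)).trans (by
    rw [toAdd_zpow, smul_eq_mul]; rfl)

theorem ord_pow (f : Fˣ) (n : ℕ) : Q.ord (f ^ n) = n * Q.ord f := by
  rw [← zpow_natCast, ord_zpow]

theorem ord_prod {ι : Type*} (s : Finset ι) (f : ι → Fˣ) :
    Q.ord (∏ i ∈ s, f i) = ∑ i ∈ s, Q.ord (f i) :=
  (congrArg Multiplicative.toAdd (map_prod Q.ordHom f s)).trans (toAdd_prod _ _)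

theorem ord_uniformizer {π : Q.ring} (hπ : Irreducible π) (f : Fˣ) (hf : (f : F) = π) :
    Q.ord f = 1 := by
  rw [ord, hf, Q.valuation_irreducible hπ, WithZero.log_exp, neg_neg]

theorem mem_ring_iff (f : Fˣ) : (f : F) ∈ Q.ring ↔ 0 ≤ Q.ord f := by
  have h0 := Q.valuation_ne_zero f
  rw [ord, Left.nonneg_neg_iff, WithZero.log_le_iff_le_exp h0, WithZero.exp_zero]
  constructor
  · intro h
    exact IsDedekindDomain.HeightOneSpectrum.valuation_le_one
      (IsDiscreteValuationRing.maximalIdeal Q.ring) (⟨f, h⟩ : Q.ring)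
  · intro h
    obtain ⟨a, ha⟩ := IsDiscreteValuationRing.exists_lift_of_le_one h
    rw [← ha]
    exact a.2

theorem mem_nonunits_iff (f : Fˣ) : (f : F) ∈ Q.ring.nonunits ↔ 0 < Q.ord f := by
  rw [ValuationSubring.mem_nonunits_iff_or, or_iff_right f.ne_zero, ← Units.val_inv_eq_inv_val,
    mem_ring_iff, ord_inv]
  omega

theorem ord_eq_of_hasLead {t f : Fˣ} {n : ℤ} {c : kˣ} (h : Q.ring.HasLead (t : F) f n c) :
    Q.ord f = n * Q.ord t := by
  have h1 := h.valuation_eq Q.containsConstants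
  have h2 : ((f / t ^ n : Fˣ) : F) ∈ Q.ring := by
    push_cast
    exact (Q.ring.valuation_le_one_iff _).1 h1.le
  have h3 : ((f / t ^ n : Fˣ)⁻¹ : Fˣ).val ∈ Q.ring := by
    push_cast
    exact (Q.ring.valuation_le_one_iff _).1 (by rw [map_inv₀, h1, inv_one])
  rw [mem_ring_iff, ord_div, ord_zpow] at h2
  rw [mem_ring_iff, ord_inv, ord_div, ord_zpow] at h3
  omega

/-- `t` is a parameter at `Q`, every function has a leading coefficient in `k`. -/
structure IsParameter (t : Fˣ) : Prop where
  mem_nonunits : (t : F) ∈ Q.ring.nonunits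
  exists_lead : ∀ f : Fˣ, ∃ n : ℤ, ∃ c : kˣ, Q.ring.HasLead (t : F) f n c

variable {Q} {t : Fˣ}

theorem IsParameter.ord_eq_one (h : Q.IsParameter t) : Q.ord t = 1 := by
  have h0 : (Q.uniformizer : F) ≠ 0 := fun h => Q.uniformizer_irreducible.ne_zero (Subtype.ext h)
  have h1 := Q.ord_uniformizer Q.uniformizer_irreducible (Units.mk0 _ h0) rfl
  obtain ⟨n, c, hn⟩ := h.exists_lead (Units.mk0 _ h0)
  rw [Q.ord_eq_of_hasLead hn] at h1
  exact Int.eq_one_of_mul_eq_one_left ((Q.mem_nonunits_iff t).1 h.mem_nonunits).le h1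

theorem IsParameter.ord_eq (h : Q.IsParameter t) {f : Fˣ} {n : ℤ} {c : kˣ}
    (hf : Q.ring.HasLead (t : F) f n c) : Q.ord f = n := by
  rw [Q.ord_eq_of_hasLead hf, h.ord_eq_one, mul_one]

theorem residue_eq (Q : CurvePoint k F) {a : Q.ring} {c : k}
    (h : (a : F) - algebraMap k F c ∈ Q.ring.nonunits) :
    IsLocalRing.residue Q.ring a = algebraMap k Q.residueField c := by
  change _ = IsLocalRing.residue Q.ring (Q.constants c)
  rw [← sub_eq_zero, ← map_sub, IsLocalRing.residue_eq_zero_iff]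
  exact ValuationSubring.coe_mem_nonunits_iff.1 h

/-- The residue of a unit is its leading coefficient, which lies in k. Hence the norms in the
definition of the pairing are trivial at such points. -/
theorem IsParameter.bijective (h : Q.IsParameter t) :
    Function.Bijective (algebraMap k Q.residueField) := by
  refine ⟨(algebraMap k Q.residueField).injective, fun r => ?_⟩
  obtain ⟨a, rfl⟩ := IsLocalRing.residue_surjective r
  by_cases ha : a ∈ IsLocalRing.maximalIdeal Q.ring
  · exact ⟨0, by rw [map_zero, (IsLocalRing.residue_eq_zero_iff a).2 ha]⟩
  have ha0 : (a : F) ≠ 0 := fun h0 => ha (by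
    rw [show a = 0 from Subtype.ext h0]; exact zero_mem _)
  obtain ⟨n, c, hn⟩ := h.exists_lead (Units.mk0 _ ha0)
  have hord : Q.ord (Units.mk0 _ ha0) = 0 := by
    have h1 := (Q.mem_ring_iff (Units.mk0 _ ha0)).1 a.2
    have h2 := mt (Q.mem_nonunits_iff (Units.mk0 _ ha0)).2
      (mt ValuationSubring.coe_mem_nonunits_iff.1 ha)
    omega
  rw [h.ord_eq hn] at hord
  rw [ValuationSubring.HasLead, hord, zpow_zero, div_one] at hn
  exact ⟨c, (Q.residue_eq hn).symm⟩

theorem IsParameter.norm_algebraMap (h : Q.IsParameter t) (c : k) :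
    Algebra.norm k (algebraMap k Q.residueField c) = c := by
  rw [Algebra.norm_algebraMap, finrank_eq_one (1 : Q.residueField) one_ne_zero fun w => ?_, pow_one]
  obtain ⟨c, rfl⟩ := h.bijective.2 w
  exact ⟨c, by rw [Algebra.smul_def, mul_one]⟩

end CurvePoint

/-! ### The group of values and the pairing -/

section UnitTmul

variable {K : Type*} [Field K]

theorem unitTmul_mul (x y : Kˣ) (n : ℕ) : unitTmul (x * y) n = unitTmul x n + unitTmul y n := by
  rw [unitTmul, ofMul_mul, TensorProduct.add_tmul]; rfl

theorem unitTmul_one (n : ℕ) : unitTmul (1 : Kˣ) n = 0 := by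
  rw [unitTmul, ofMul_one, TensorProduct.zero_tmul]

theorem unitTmul_zpow (x : Kˣ) (j : ℤ) (n : ℕ) : unitTmul (x ^ j) n = j • unitTmul x n := by
  rw [unitTmul, ofMul_zpow]
  exact (TensorProduct.smul_tmul' j (Additive.ofMul x) _).symm

theorem unitTmul_inv (x : Kˣ) (n : ℕ) : unitTmul x⁻¹ n = -unitTmul x n := by
  rw [← zpow_neg_one, unitTmul_zpow, neg_one_smul]

theorem unitTmul_div (x y : Kˣ) (n : ℕ) : unitTmul (x / y) n = unitTmul x n - unitTmul y n := by
  rw [div_eq_mul_inv, unitTmul_mul, unitTmul_inv, sub_eq_add_neg]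

theorem unitTmul_pow_mul (x : Kˣ) {d : ℕ} (hd : 0 < d) (n : ℕ) :
    unitTmul (x ^ d) (d * n) = unitTmul x n := by
  have hd' : (d : ℚ) ≠ 0 := by positivity
  rw [unitTmul, ofMul_pow, ← TensorProduct.smul_tmul', ← TensorProduct.tmul_smul,
    ← QuotientAddGroup.mk_nsmul, unitTmul, nsmul_eq_mul, Nat.cast_mul, mul_one_div,
    div_mul_eq_div_div, div_self hd']

theorem unitTmul_pow_self (x : Kˣ) {n : ℕ} (hn : 0 < n) : unitTmul (x ^ n) n = 0 := by
  have := unitTmul_pow_mul x hn 1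
  rw [mul_one] at this
  rw [this, unitTmul]
  have : (QuotientAddGroup.mk (1 / ((1 : ℕ) : ℚ)) : QModZ) = 0 := by
    rw [QuotientAddGroup.eq_zero_iff]
    exact ⟨1, by simp⟩
  rw [this, TensorProduct.tmul_zero]

theorem unitTmul_zpow_mul_self (x : Kˣ) {n : ℕ} (hn : 0 < n) (j : ℤ) :
    unitTmul (x ^ (n * j)) n = 0 := by
  rw [mul_comm, zpow_mul', unitTmul_zpow, zpow_natCast, unitTmul_pow_self x hn, smul_zero]

end UnitTmul

namespace ValuationSubring

variable {k F : Type*} [Field k] [Field F] [Algebra k F] {R : ValuationSubring F}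

theorem HasLead.unique (hR : R.ContainsConstants k) {t f : F} {n : ℤ} {c d : kˣ}
    (h : R.HasLead t f n c) (h' : R.HasLead t f n d) : c = d := by
  have h1 := sub_mem h' h
  rw [sub_sub_sub_cancel_left, ← map_sub] at h1
  by_contra hne
  have h2 : (c : k) - d ≠ 0 := sub_ne_zero.2 fun h => hne (Units.ext h)
  exact algebraMap_notMem_nonunits hR (Units.mk0 _ h2) h1

end ValuationSubring

namespace CurvePoint

variable {k F : Type*} [Field k] [Field F] [Algebra k F] {Q : CurvePoint k F} {t : Fˣ}

theorem norm_unitTmul (Q : CurvePoint k F) (x : Q.residueFieldˣ) (N : ℕ) :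
    Q.norm (unitTmul x N) = unitTmul (Units.map (Algebra.norm k : Q.residueField →* k) x) N := rfl

/-- Passing from the chosen uniformizer to the parameter t multiplies the leading value by the n-th
power of a unit. As N divides n, this is an N-th power and dies in the tensor product with 1/N. -/
theorem IsParameter.norm_lc (h : Q.IsParameter t) {f : Fˣ} {n : ℤ} {c : kˣ} {N : ℕ}
    (hN : 0 < N) (hf : Q.ring.HasLead (t : F) f n c) (hn : (N : ℤ) ∣ n) :
    Q.norm (Q.lc f N) = unitTmul c N := by
  obtain ⟨j, rfl⟩ := hn
  have hord := h.ord_eq hf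
  obtain ⟨u, hu⟩ : ∃ u, u = (Q.exists_unit Q.uniformizer_irreducible f).choose := ⟨_, rfl⟩
  have hu' := (Q.exists_unit Q.uniformizer_irreducible f).choose_spec
  rw [← hu, hord] at hu'
  have h0 : (Q.uniformizer : F) ≠ 0 := fun h => Q.uniformizer_irreducible.ne_zero (Subtype.ext h)
  obtain ⟨p, hp⟩ : ∃ p : Fˣ, (p : F) = Q.uniformizer := ⟨Units.mk0 _ h0, rfl⟩
  have hp1 : Q.ord p = 1 := Q.ord_uniformizer Q.uniformizer_irreducible p hp
  -- the ratio of the two parameters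
  have hr : Q.ord (t / p) = 0 := by rw [ord_div, h.ord_eq_one, hp1, sub_self]
  have hr1 : ((t / p : Fˣ) : F) ∈ Q.ring := (Q.mem_ring_iff _).2 hr.ge
  have hr2 : (((t / p)⁻¹ : Fˣ) : F) ∈ Q.ring := (Q.mem_ring_iff _).2 (by rw [ord_inv, hr, neg_zero])
  let r : Q.ringˣ := ⟨⟨_, hr1⟩, ⟨_, hr2⟩, Subtype.ext (Units.mul_inv (t / p)),
    Subtype.ext (Units.inv_mul (t / p))⟩
  have hw := hf.mem Q.containsConstants
  have e : (u : Q.ring) = ⟨_, hw⟩ * ((r ^ j) ^ N : Q.ringˣ) := by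
    apply Subtype.ext
    have h1 : ((((r ^ j) ^ N : Q.ringˣ) : Q.ring) : F) = (((t / p) ^ j) ^ N : Fˣ) := by
      have : ∀ x : Q.ringˣ, ((x : Q.ring) : F) =
        (Units.map (Q.ring.subtype : Q.ring →* F) x : Fˣ) := fun _ => rfl
      rw [this, map_pow, map_zpow]
      congr 3
    rw [hu', MulMemClass.coe_mul, h1, ← hp, ← zpow_natCast ((t / p) ^ j), ← zpow_mul, mul_comm j,
      Units.val_zpow_eq_zpow_val, Units.val_div_eq_div_val, div_zpow]
    have := zpow_ne_zero (N * j) t.ne_zero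
    field_simp
  have hc : Units.map (IsLocalRing.residue Q.ring).toMonoidHom u =
      Units.map (algebraMap k Q.residueField).toMonoidHom c *
        (Units.map (IsLocalRing.residue Q.ring).toMonoidHom (r ^ j)) ^ N := by
    apply Units.ext
    change IsLocalRing.residue Q.ring u = _
    rw [e, map_mul, Q.residue_eq hf, Units.val_mul, ← map_pow]
    rfl
  rw [lc, leadingValue, ← hu, hc, unitTmul_mul, unitTmul_pow_self _ hN, add_zero, norm_unitTmul]
  congr 1
  exact Units.ext (h.norm_algebraMap c)

/-- The pairing of a divisor with torsion class and the difference of two rational points. -/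
theorem divisorPairing_eq
    (hconst : ∀ f : Fˣ, (∀ Q : CurvePoint k F, Q.ord f = 0) → ∃ c : kˣ, (f : F) = algebraMap k F c)
    {Q₁ Q₀ : CurvePoint k F} {t₁ t₀ : Fˣ} (h₁ : Q₁.IsParameter t₁) (h₀ : Q₀.IsParameter t₀)
    {D : CurveDivisor k F} {n : ℕ} (hn : 0 < n) {f : Fˣ}
    (hf : ∀ Q : CurvePoint k F, Q.ord f = n * D Q) {n₁ n₀ : ℤ} {c₁ c₀ : kˣ}
    (hc₁ : Q₁.ring.HasLead (t₁ : F) f n₁ c₁) (hc₀ : Q₀.ring.HasLead (t₀ : F) f n₀ c₀) :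
    divisorPairing D (Finsupp.single Q₁ 1 - Finsupp.single Q₀ 1) = unitTmul (c₁ / c₀) n := by
  have hex : ∃ nf : ℕ × Fˣ, 0 < nf.1 ∧ ∀ Q : CurvePoint k F, Q.ord nf.2 = nf.1 * D Q :=
    ⟨(n, f), hn, hf⟩
  rw [divisorPairing, dif_pos hex]
  obtain ⟨hN, hg⟩ := hex.choose_spec
  generalize hex.choose = nf at *
  obtain ⟨N, g⟩ := nf
  simp only at hN hg ⊢
  obtain ⟨m₁, d₁, hd₁⟩ := h₁.exists_lead g
  obtain ⟨m₀, d₀, hd₀⟩ := h₀.exists_lead g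
  rw [Finsupp.sum_sub_index fun Q a b => sub_smul a b _, Finsupp.sum_single_index (by rw [zero_smul]),
    Finsupp.sum_single_index (by rw [zero_smul]), one_smul, one_smul,
    h₁.norm_lc hN hd₁ ⟨D Q₁, by rw [← hg, h₁.ord_eq hd₁]⟩,
    h₀.norm_lc hN hd₀ ⟨D Q₀, by rw [← hg, h₀.ord_eq hd₀]⟩, ← unitTmul_div]
  -- The definition uses an unknown pair (N, g). Both f^N and g^n have divisor nND, so they differ
  -- by a constant, which cancels between the two points.
  obtain ⟨c, hc⟩ := hconst (f ^ N / g ^ n) fun Q => by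
    rw [ord_div, ord_pow, ord_pow, hf, hg]; ring
  have key {Q : CurvePoint k F} {t : Fˣ} (h : Q.IsParameter t) {i j : ℤ} {a b : kˣ}
      (ha : Q.ring.HasLead (t : F) f i a) (hb : Q.ring.HasLead (t : F) g j b) :
      a ^ N / b ^ n = c := by
    have hQ := Q.containsConstants
    have h1 := (ha.pow hQ t.ne_zero N).div hQ (hb.pow hQ t.ne_zero n) t.ne_zero
    have h2 : (N : ℤ) * i - n * j = 0 := by
      rw [← h.ord_eq ha, ← h.ord_eq hb, hf, hg]; ring
    rw [h2] at h1
    refine h1.unique hQ ?_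
    have : (f : F) ^ N / (g : F) ^ n = algebraMap k F c := by rw [← hc]; push_cast; rfl
    rw [this]
    exact ValuationSubring.HasLead.const c
  have e : (c₁ / c₀) ^ N = (d₁ / d₀) ^ n := by
    have := (key h₁ hc₁ hd₁).trans (key h₀ hc₀ hd₀).symm
    rw [div_eq_div_iff_mul_eq_mul] at this
    rw [div_pow, div_pow, div_eq_div_iff_mul_eq_mul, this, mul_comm]
  rw [← unitTmul_pow_mul (c₁ / c₀) hN, e, mul_comm, unitTmul_pow_mul _ hn]

end CurvePoint

/-! ### The point at infinity -/

namespace CurvePoint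

variable {k F : Type*} [Field k] [Field F] [Algebra k F]

/-- A condition on valuation rings that determines all leading coefficients determines a point. -/
theorem exists_isParameter {p : ValuationSubring F → Prop}
    (hp : ∀ R, p R → R.ContainsConstants k) (hex : ∃ R, p R) {t : Fˣ}
    (ht : ∀ R, p R → (t : F) ∈ R.nonunits)
    (h : ∀ f : Fˣ, ∃ n : ℤ, ∃ c : kˣ, ∀ R, p R → R.HasLead (t : F) f n c) :
    ∃ Q : CurvePoint k F, p Q.ring ∧ Q.IsParameter t ∧
      ∀ Q' : CurvePoint k F, p Q'.ring → Q' = Q := by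
  obtain ⟨R, hR⟩ := hex
  let Q : CurvePoint k F := ⟨R, hp R hR, ValuationSubring.isDVR_of_hasLead (hp R hR) t.ne_zero
    (ht R hR) fun f hf => by
      obtain ⟨n, c, hc⟩ := h (Units.mk0 f hf)
      exact ⟨n, c, hc R hR⟩⟩
  have hpar : ∀ Q : CurvePoint k F, p Q.ring → Q.IsParameter t := fun Q hQ =>
    ⟨ht _ hQ, fun f => by
      obtain ⟨n, c, hc⟩ := h f
      exact ⟨n, c, hc _ hQ⟩⟩
  refine ⟨Q, hR, hpar Q hR, fun Q' hQ' => ext_ring (SetLike.ext fun f => ?_)⟩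
  by_cases hf : f = 0
  · rw [hf]; exact iff_of_true (zero_mem _) (zero_mem _)
  obtain ⟨n, c, hc⟩ := h (Units.mk0 f hf)
  have h1 := Q.mem_ring_iff (Units.mk0 f hf)
  have h2 := Q'.mem_ring_iff (Units.mk0 f hf)
  rw [(hpar Q hR).ord_eq (hc _ hR)] at h1
  rw [(hpar Q' hQ').ord_eq (hc _ hQ')] at h2
  exact h2.trans h1.symm

end CurvePoint

namespace WeierstrassCurve.Affine

open Polynomial
open scoped Polynomial.Bivariate

variable {k : Type*} [Field k]

namespace FunctionField

variable (W : Affine k)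

/-- The coordinate function `x`. -/
noncomputable def x : W.FunctionField :=
  algebraMap W.CoordinateRing W.FunctionField (CoordinateRing.mk W (C X))

/-- The coordinate function `y`. -/
noncomputable def y : W.FunctionField :=
  algebraMap W.CoordinateRing W.FunctionField (CoordinateRing.mk W Y)

variable {W}

theorem algebraMap_injective :
    Function.Injective (algebraMap W.CoordinateRing W.FunctionField) :=
  IsFractionRing.injective _ _

theorem algebraMap_eq (c : k) : algebraMap k W.FunctionField c =
    algebraMap W.CoordinateRing W.FunctionField (CoordinateRing.mk W (C (C c))) := rfl

theorem equation : y W ^ 2 + algebraMap k _ W.a₁ * x W * y W + algebraMap k _ W.a₃ * y W =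
    x W ^ 3 + algebraMap k _ W.a₂ * x W ^ 2 + algebraMap k _ W.a₄ * x W + algebraMap k _ W.a₆ := by
  have h : CoordinateRing.mk W (Y ^ 2 + C (C W.a₁ * X + C W.a₃) * Y -
      C (X ^ 3 + C W.a₂ * X ^ 2 + C W.a₄ * X + C W.a₆)) = 0 :=
    AdjoinRoot.mk_eq_zero.2 ⟨1, by rw [mul_one, WeierstrassCurve.Affine.polynomial]⟩
  have h1 := congrArg (algebraMap W.CoordinateRing W.FunctionField) h
  simp only [map_sub, map_add, map_mul, map_pow, map_zero, ← algebraMap_eq] at h1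
  change y W ^ 2 + (algebraMap k _ W.a₁ * x W + algebraMap k _ W.a₃) * y W -
    (x W ^ 3 + algebraMap k _ W.a₂ * x W ^ 2 + algebraMap k _ W.a₄ * x W +
      algebraMap k _ W.a₆) = 0 at h1
  linear_combination h1

theorem algebraMap_C (p : k[X]) :
    algebraMap W.CoordinateRing W.FunctionField (CoordinateRing.mk W (C p)) = aeval (x W) p := by
  induction p using Polynomial.induction_on' with
  | add p q hp hq => rw [C_add, map_add, map_add, hp, hq, map_add]
  | monomial n c =>
    rw [aeval_monomial, ← C_mul_X_pow_eq_monomial, C_mul, C_pow, map_mul, map_mul, map_pow, map_pow]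
    rfl

theorem algebraMap_smul_basis (p q : k[X]) :
    algebraMap W.CoordinateRing W.FunctionField
      (p • (1 : W.CoordinateRing) + q • CoordinateRing.mk W Y) =
      aeval (x W) p + aeval (x W) q * y W := by
  rw [CoordinateRing.smul, CoordinateRing.smul, map_add, map_mul, map_mul, map_one, mul_one,
    algebraMap_C, algebraMap_C]
  rfl

theorem aeval_x_ne_zero {p : k[X]} (hp : p ≠ 0) : aeval (x W) p ≠ 0 := by
  rw [← algebraMap_C]
  intro h
  have h1 := algebraMap_injective (h.trans (map_zero _).symm)
  have h2 : p • (1 : W.CoordinateRing) + (0 : k[X]) • CoordinateRing.mk W Y = 0 := by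
    rw [CoordinateRing.smul, h1, zero_mul, zero_smul, add_zero]
  exact hp (CoordinateRing.smul_basis_eq_zero h2).1

theorem x_ne_zero : x W ≠ 0 := by
  have := aeval_x_ne_zero (W := W) (X_ne_zero (R := k))
  rwa [aeval_X] at this

theorem y_ne_zero : y W ≠ 0 := by
  intro h
  have h1 := algebraMap_injective (h.trans (map_zero _).symm)
  have h2 : (0 : k[X]) • (1 : W.CoordinateRing) + (1 : k[X]) • CoordinateRing.mk W Y = 0 := by
    rw [zero_smul, one_smul, zero_add, h1]
  exact one_ne_zero (CoordinateRing.smul_basis_eq_zero h2).2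

variable (W) in
/-- The parameter `x / y` at infinity. -/
noncomputable def t : W.FunctionFieldˣ := Units.mk0 (x W / y W) (div_ne_zero x_ne_zero y_ne_zero)

theorem coe_t : (t W : W.FunctionField) = x W / y W := rfl

/-- `R` is centred at infinity. -/
def AtInfinity (R : ValuationSubring W.FunctionField) : Prop :=
  R.ContainsConstants k ∧ x W ∉ R

section

variable {R : ValuationSubring W.FunctionField} (hR : AtInfinity R)

include hR

theorem inv_x_mem : (x W)⁻¹ ∈ R.nonunits := by
  rw [ValuationSubring.inv_mem_nonunits_iff]
  exact Or.inr hR.2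

theorem t_mem : (t W : W.FunctionField) ∈ R.nonunits := by
  have hx := x_ne_zero (W := W)
  rw [coe_t, ← inv_div, ValuationSubring.inv_mem_nonunits_iff]
  refine Or.inr fun hw => hR.2 ?_
  have hu := ValuationSubring.nonunits_subset (inv_x_mem hR)
  have e : x W = (y W / x W) ^ 2 + algebraMap k _ W.a₁ * (y W / x W) +
      algebraMap k _ W.a₃ * (x W)⁻¹ * (y W / x W) - algebraMap k _ W.a₂ -
      algebraMap k _ W.a₄ * (x W)⁻¹ - algebraMap k _ W.a₆ * (x W)⁻¹ ^ 2 := by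
    field_simp
    linear_combination -equation (W := W)
  rw [e]
  exact sub_mem (sub_mem (sub_mem (add_mem (add_mem (pow_mem hw 2) (mul_mem (hR.1 _) hw))
    (mul_mem (mul_mem (hR.1 _) hu) hw)) (hR.1 _)) (mul_mem (hR.1 _) hu))
    (mul_mem (hR.1 _) (pow_mem hu 2))

theorem hasLead_x : R.HasLead (t W : W.FunctionField) (x W) (-2) (1 : kˣ) := by
  have hx := x_ne_zero (W := W)
  have hy := y_ne_zero (W := W)
  have ht := t_mem hR
  have ht' := ValuationSubring.nonunits_subset ht
  have hu := ValuationSubring.nonunits_subset (inv_x_mem hR)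
  have e : x W / (t W : W.FunctionField) ^ (-2 : ℤ) - algebraMap k _ ((1 : kˣ) : k) =
      (algebraMap k _ W.a₁ + algebraMap k _ W.a₃ * (x W)⁻¹ - algebraMap k _ W.a₂ * t W -
        algebraMap k _ W.a₄ * (x W)⁻¹ * t W - algebraMap k _ W.a₆ * (x W)⁻¹ ^ 2 * t W) * t W := by
    rw [zpow_neg, div_inv_eq_mul, Units.val_one, map_one, coe_t, zpow_ofNat]
    field_simp
    linear_combination -equation (W := W)
  rw [ValuationSubring.HasLead, e]
  refine ValuationSubring.mul_mem_nonunits ?_ ht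
  exact sub_mem (sub_mem (sub_mem (add_mem (hR.1 _) (mul_mem (hR.1 _) hu))
    (mul_mem (hR.1 _) ht')) (mul_mem (mul_mem (hR.1 _) hu) ht'))
    (mul_mem (mul_mem (hR.1 _) (pow_mem hu 2)) ht')

theorem hasLead_y : R.HasLead (t W : W.FunctionField) (y W) (-3) (1 : kˣ) := by
  have h := (hasLead_x hR).div hR.1 (ValuationSubring.HasLead.self (k := k) (R := R) (t W).ne_zero)
    (t W).ne_zero
  rw [coe_t, div_div_cancel₀ x_ne_zero, div_one, ← coe_t] at h
  exact h

theorem hasLead_aeval {p : k[X]} (hp : p ≠ 0) : R.HasLead (t W : W.FunctionField) (aeval (x W) p)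
    (-2 * p.natDegree) (Units.mk0 _ (leadingCoeff_ne_zero.2 hp)) := by
  induction hn : p.natDegree using Nat.strong_induction_on generalizing p with
  | _ n ih =>
  subst hn
  have h1 := (ValuationSubring.HasLead.const (Units.mk0 _ (leadingCoeff_ne_zero.2 hp))).mul hR.1
    ((hasLead_x hR).pow hR.1 (t W).ne_zero p.natDegree) (t W).ne_zero
  have e : aeval (x W) p = algebraMap k _ p.leadingCoeff * x W ^ p.natDegree +
      aeval (x W) p.eraseLead := by
    conv_lhs => rw [← eraseLead_add_monomial_natDegree_leadingCoeff p, map_add, aeval_monomial,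
      add_comm]
  rw [one_pow, mul_one, zero_add, mul_comm (p.natDegree : ℤ)] at h1
  rw [e]
  rcases eq_or_ne p.eraseLead 0 with h0 | h0
  · rw [h0, map_zero, add_zero]; exact h1
  have hlt : p.eraseLead.natDegree < p.natDegree :=
    (eraseLead_natDegree_lt_or_eraseLead_eq_zero p).resolve_right h0
  exact h1.add (t W).ne_zero hR.1 (t_mem hR) (ih _ hlt h0 rfl) (by omega)

end

/-- The summands p and q·y have pole orders 2 deg p and 2 deg q + 3 at infinity. Their parities
differ, so one dominates and no cancellation can occur; the degree of the norm is the larger order.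
-/
theorem natDegree_norm_smul_basis {p q : k[X]} (h : p ≠ 0 ∨ q ≠ 0) :
    ((Algebra.norm k[X] (p • (1 : W.CoordinateRing) + q • CoordinateRing.mk W Y)).natDegree = 
      2 * p.natDegree ∧ p ≠ 0 ∧ (q = 0 ∨ 2 * q.natDegree + 3 < 2 * p.natDegree)) ∨
    ((Algebra.norm k[X] (p • (1 : W.CoordinateRing) + q • CoordinateRing.mk W Y)).natDegree = 
      2 * q.natDegree + 3 ∧ q ≠ 0 ∧ (p = 0 ∨ 2 * p.natDegree < 2 * q.natDegree + 3)) := by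
  have h1 := CoordinateRing.degree_norm_smul_basis (W' := W) p q
  by_cases hp : p = 0
  · have hq : q ≠ 0 := h.resolve_left (not_not.2 hp)
    right
    refine ⟨?_, hq, Or.inl hp⟩
    rw [hp, degree_zero, degree_eq_natDegree hq] at h1
    apply natDegree_eq_of_degree_eq_some
    rw [hp, h1, max_eq_right]
    · norm_cast
    · exact bot_le
  by_cases hq : q = 0
  · left
    refine ⟨?_, hp, Or.inl hq⟩
    rw [hq, degree_zero, degree_eq_natDegree hp] at h1
    apply natDegree_eq_of_degree_eq_some
    rw [hq, h1, max_eq_left]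
    · norm_cast
    · exact bot_le
  rw [degree_eq_natDegree hp, degree_eq_natDegree hq] at h1
  have h2 : (Algebra.norm k[X] (p • (1 : W.CoordinateRing) + q • CoordinateRing.mk W Y)).natDegree =
      max (2 * p.natDegree) (2 * q.natDegree + 3) := by
    apply natDegree_eq_of_degree_eq_some
    rw [h1]
    norm_cast
  rcases lt_or_gt_of_ne (show 2 * p.natDegree ≠ 2 * q.natDegree + 3 by omega) with hlt | hlt
  · exact Or.inr ⟨by rw [h2, max_eq_right hlt.le], hq, Or.inr hlt⟩
  · exact Or.inl ⟨by rw [h2, max_eq_left hlt.le], hp, Or.inr hlt⟩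

/-- The leading term at infinity of a regular function. -/
theorem exists_hasLead_infinity {a : W.CoordinateRing} (ha : a ≠ 0) :
    ∃ c : kˣ, ∀ R : ValuationSubring W.FunctionField, AtInfinity R →
      R.HasLead (t W : W.FunctionField) (algebraMap _ W.FunctionField a)
        (-(Algebra.norm k[X] a).natDegree) c := by
  obtain ⟨p, q, rfl⟩ := CoordinateRing.exists_smul_basis_eq a
  have hpq : p ≠ 0 ∨ q ≠ 0 := by
    by_contra! h
    exact ha (by rw [h.1, h.2, zero_smul, zero_smul, add_zero])
  have hq' (hq : q ≠ 0) (R : ValuationSubring W.FunctionField) (hR : AtInfinity R) :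
      R.HasLead (t W : W.FunctionField) (aeval (x W) q * y W) (-(2 * q.natDegree + 3 : ℕ))
        (Units.mk0 _ (leadingCoeff_ne_zero.2 hq)) := by
    have := (hasLead_aeval hR hq).mul hR.1 (hasLead_y hR) (t W).ne_zero
    rw [mul_one] at this
    rwa [show (-(2 * q.natDegree + 3 : ℕ) : ℤ) = -2 * q.natDegree + -3 by push_cast; ring]
  have hp' (hp : p ≠ 0) (R : ValuationSubring W.FunctionField) (hR : AtInfinity R) :
      R.HasLead (t W : W.FunctionField) (aeval (x W) p) (-(2 * p.natDegree : ℕ))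
        (Units.mk0 _ (leadingCoeff_ne_zero.2 hp)) := by
    have := hasLead_aeval hR hp
    rwa [show (-(2 * p.natDegree : ℕ) : ℤ) = -2 * p.natDegree by push_cast; ring]
  rw [algebraMap_smul_basis]
  rcases natDegree_norm_smul_basis (W := W) hpq with ⟨hd, hp, h⟩ | ⟨hd, hq, h⟩
  · refine ⟨Units.mk0 _ (leadingCoeff_ne_zero.2 hp), fun R hR => ?_⟩
    rw [hd]
    rcases eq_or_ne q 0 with hq | hq
    · rw [hq, map_zero, zero_mul, add_zero]
      exact hp' hp R hR
    · exact (hp' hp R hR).add (t W).ne_zero hR.1 (t_mem hR) (hq' hq R hR)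
        (by have := h.resolve_left hq; omega)
  · refine ⟨Units.mk0 _ (leadingCoeff_ne_zero.2 hq), fun R hR => ?_⟩
    rw [hd]
    rcases eq_or_ne p 0 with hp | hp
    · rw [hp, map_zero, zero_add]
      exact hq' hq R hR
    · rw [add_comm (aeval _ p)]
      exact (hq' hq R hR).add (t W).ne_zero hR.1 (t_mem hR) (hp' hp R hR)
        (by have := h.resolve_left hp; omega)

/-- Were x in every valuation ring containing k, it would be integral over k, whereas x is
transcendental. -/
theorem exists_atInfinity : ∃ R : ValuationSubring W.FunctionField, AtInfinity R := by
  by_contra! h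
  have h1 : x W ∈ (⨅ V : {V : ValuationSubring W.FunctionField //
      Set.range (algebraMap k W.FunctionField) ⊆ V.toSubring}, V.1.toSubring) := by
    rw [Subring.mem_iInf]
    rintro ⟨V, hV⟩
    by_contra hx
    exact h V ⟨fun c => hV ⟨c, rfl⟩, hx⟩
  rw [iInf_valuationSubring_superset] at h1
  have e : Subring.closure (Set.range (algebraMap k W.FunctionField)) =
      (algebraMap k W.FunctionField).range :=
    Subring.closure_eq (algebraMap k W.FunctionField).range
  rw [e] at h1
  obtain ⟨p, hp, hp0⟩ := h1
  obtain ⟨p', rfl, -, hm⟩ := Polynomial.lifts_and_natDegree_eq_and_monic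
    (f := (algebraMap k W.FunctionField).rangeRestrict) (p := p)
    (Polynomial.mem_lifts _ |>.2 (by
      obtain ⟨r, hr⟩ := Polynomial.map_surjective _
        (algebraMap k W.FunctionField).rangeRestrict_surjective p
      exact ⟨r, hr⟩)) hp
  refine aeval_x_ne_zero (W := W) hm.ne_zero ?_
  rw [Polynomial.eval₂_map] at hp0
  exact hp0

end FunctionField

end WeierstrassCurve.Affine

/-! ### Affine points, and the divisor of a point -/

namespace WeierstrassCurve.Affine

open Polynomial
open scoped Polynomial.Bivariate

variable {k : Type*} [Field k] {W : Affine k}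

namespace CoordinateRing

/-- The value of a regular function at an affine point. -/
noncomputable def evalAt {x₀ y₀ : k} (h : W.Equation x₀ y₀) : W.CoordinateRing →ₐ[k] k :=
  (quotientXYIdealEquiv (W' := W) (x := x₀) (y := C y₀) h).toAlgHom.comp
    (Ideal.Quotient.mkₐ k (XYIdeal W x₀ (C y₀)))

variable {x₀ y₀ : k} (h : W.Equation x₀ y₀)

theorem evalAt_eq_zero_iff {a : W.CoordinateRing} :
    evalAt h a = 0 ↔ a ∈ XYIdeal W x₀ (C y₀) := by
  rw [← Ideal.Quotient.eq_zero_iff_mem]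
  exact EmbeddingLike.map_eq_zero_iff (f := quotientXYIdealEquiv (W' := W) (x := x₀) (y := C y₀) h)

theorem sub_evalAt_mem (a : W.CoordinateRing) :
    a - algebraMap k _ (evalAt h a) ∈ XYIdeal W x₀ (C y₀) := by
  rw [← evalAt_eq_zero_iff h, map_sub, AlgHom.commutes]
  exact sub_self _

include h in
theorem isPrime_XYIdeal : (XYIdeal W x₀ (C y₀)).IsPrime := by
  have : XYIdeal W x₀ (C y₀) = RingHom.ker (evalAt h) := by
    ext a; rw [RingHom.mem_ker, evalAt_eq_zero_iff]
  rw [this]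
  exact RingHom.ker_isPrime _

/-- A local generator of the ideal of a nonsingular point. -/
theorem exists_local_generator (hns : W.Nonsingular x₀ y₀) :
    ∃ t ∈ XYIdeal W x₀ (C y₀), t ≠ 0 ∧ ∃ s ∉ XYIdeal W x₀ (C y₀),
      ∀ a ∈ XYIdeal W x₀ (C y₀), t ∣ s * a := by
  have hI := isPrime_XYIdeal hns.left
  have hmul := XYIdeal_neg_mul hns
  have hX := XClass_ne_zero (W' := W) x₀
  have hdvd : ∀ b ∈ XYIdeal W x₀ (C (W.negY x₀ y₀)), ∀ a ∈ XYIdeal W x₀ (C y₀),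
      XClass W x₀ ∣ b * a := fun b hb a ha => by
    rw [← Ideal.mem_span_singleton]
    exact hmul.le (Ideal.mul_mem_mul hb ha)
  -- The ideals of the point and of its negative multiply to (x - x₀). If every r lay in the ideal I
  -- of the point, then (x - x₀) ⊆ (x - x₀) I, forcing 1 ∈ I. So some r is invertible at the point,
  -- and a generates I locally.
  obtain ⟨b, hb, a, ha, r, hr, e⟩ : ∃ b ∈ XYIdeal W x₀ (C (W.negY x₀ y₀)),
      ∃ a ∈ XYIdeal W x₀ (C y₀), ∃ r ∉ XYIdeal W x₀ (C y₀), b * a = XClass W x₀ * r := by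
    by_contra! hcon
    have hle : XYIdeal W x₀ (C (W.negY x₀ y₀)) * XYIdeal W x₀ (C y₀) ≤
        Ideal.span {XClass W x₀} * XYIdeal W x₀ (C y₀) := by
      refine Ideal.mul_le.2 fun b hb a ha => ?_
      obtain ⟨r, hr⟩ := hdvd b hb a ha
      rw [hr]
      refine Ideal.mul_mem_mul (Ideal.mem_span_singleton_self _) ?_
      by_contra hrI
      exact hcon b hb a ha r hrI hr
    rw [hmul] at hle
    obtain ⟨z, hz, hz1⟩ := Ideal.mem_span_singleton_mul.1 (hle (Ideal.mem_span_singleton_self _))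
    rw [mul_eq_left₀ hX] at hz1
    exact hI.ne_top ((Ideal.eq_top_iff_one _).2 (hz1 ▸ hz))
  refine ⟨a, ha, ?_, r, hr, fun c hc => ?_⟩
  · rintro rfl
    rw [mul_zero, eq_comm, mul_eq_zero] at e
    exact hr (e.resolve_left hX ▸ zero_mem _)
  · obtain ⟨r', hr'⟩ := hdvd b hb c hc
    refine ⟨r', mul_left_cancel₀ hX ?_⟩
    linear_combination a * hr' - c * e

/-- The order of vanishing at a nonsingular point, in algebraic form. -/
theorem exists_mul_eq_pow_mul (hns : W.Nonsingular x₀ y₀) :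
    ∃ t ∈ XYIdeal W x₀ (C y₀), t ≠ 0 ∧ ∀ a : W.CoordinateRing, a ≠ 0 →
      ∃ n : ℕ, ∃ s ∉ XYIdeal W x₀ (C y₀), ∃ b ∉ XYIdeal W x₀ (C y₀), s * a = t ^ n * b := by
  obtain ⟨t, htI, ht0, s, hs, hst⟩ := exists_local_generator hns
  have hI := isPrime_XYIdeal hns.left
  refine ⟨t, htI, ht0, fun a ha => ?_⟩
  generalize XYIdeal W x₀ (C y₀) = I at *
  have hle : I.primeCompl ≤ nonZeroDivisors W.CoordinateRing := I.primeCompl_le_nonZeroDivisors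
  have hinj := IsLocalization.injective (Localization.AtPrime I) hle
  have : IsDomain (Localization.AtPrime I) := IsLocalization.isDomain_localization hle
  have : IsNoetherianRing (Localization.AtPrime I) :=
    IsLocalization.isNoetherianRing I.primeCompl _ inferInstance
  have hunit (z : W.CoordinateRing) :
      IsUnit (algebraMap _ (Localization.AtPrime I) z) ↔ z ∈ I.primeCompl :=
    IsLocalization.AtPrime.isUnit_to_map_iff (Localization.AtPrime I) I z
  have hnu : ¬IsUnit (algebraMap _ (Localization.AtPrime I) t) := by
    rw [hunit]; exact fun h => h htI
  -- In the Noetherian local ring of the point, extract the largest power of t. The cofactor is a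
  -- unit because t divides every element of the maximal ideal up to a unit.
  obtain ⟨n, x, hx, hax⟩ := WfDvdMonoid.max_power_factor'
    ((map_ne_zero_iff (algebraMap _ (Localization.AtPrime I)) hinj).2 ha) hnu
  obtain ⟨b, c, rfl⟩ := IsLocalization.exists_mk'_eq I.primeCompl x
  refine ⟨n, c, c.2, b, fun hb => hx ?_, hinj ?_⟩
  · obtain ⟨d, hd⟩ := hst b hb
    refine ⟨IsLocalization.mk' _ d (⟨s, hs⟩ * c : I.primeCompl), ?_⟩
    have hs' : s ∈ I.primeCompl := hs
    have hsc : IsUnit (algebraMap _ (Localization.AtPrime I) (s * c)) :=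
      (hunit _).2 (mul_mem hs' c.2)
    have h1 := IsLocalization.mk'_spec' (Localization.AtPrime I) b c
    have h2 := IsLocalization.mk'_spec' (Localization.AtPrime I) d (⟨s, hs'⟩ * c : I.primeCompl)
    refine hsc.mul_left_cancel ?_
    have h3 := congrArg (algebraMap _ (Localization.AtPrime I)) hd
    rw [map_mul, map_mul] at h3
    rw [Submonoid.coe_mul] at h2
    rw [mul_left_comm, h2, map_mul, mul_assoc, h1, h3]
  · rw [map_mul, hax, map_mul, map_pow, mul_left_comm, IsLocalization.mk'_spec']

end CoordinateRing

namespace FunctionField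

/-- `R` is centred at the affine point `(x₀, y₀)`. -/
def AtPoint (x₀ y₀ : k) (R : ValuationSubring W.FunctionField) : Prop :=
  R.ContainsConstants k ∧
    algebraMap W.CoordinateRing W.FunctionField (CoordinateRing.XClass W x₀) ∈ R.nonunits ∧
    algebraMap W.CoordinateRing W.FunctionField (CoordinateRing.YClass W (C y₀)) ∈ R.nonunits

variable {x₀ y₀ : k} {R : ValuationSubring W.FunctionField}

theorem x_sub (x₀ : k) : algebraMap W.CoordinateRing W.FunctionField (CoordinateRing.XClass W x₀) =
    x W - algebraMap k _ x₀ := by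
  rw [CoordinateRing.XClass, C_sub, map_sub, map_sub]
  rfl

theorem y_sub (y₀ : k) :
    algebraMap W.CoordinateRing W.FunctionField (CoordinateRing.YClass W (C y₀)) =
      y W - algebraMap k _ y₀ := by
  rw [CoordinateRing.YClass, map_sub, map_sub]
  rfl

theorem algebraMap_mem_of_mem (hk : R.ContainsConstants k) (hx : x W ∈ R) (hy : y W ∈ R)
    (a : W.CoordinateRing) : algebraMap _ W.FunctionField a ∈ R := by
  obtain ⟨p, q, rfl⟩ := CoordinateRing.exists_smul_basis_eq a
  have haeval (p : k[X]) : aeval (x W) p ∈ R := by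
    rw [aeval_eq_sum_range]
    refine sum_mem fun i _ => ?_
    rw [Algebra.smul_def]
    exact mul_mem (hk _) (pow_mem hx i)
  rw [algebraMap_smul_basis]
  exact add_mem (haeval p) (mul_mem (haeval q) hy)

namespace AtPoint

variable (hR : AtPoint x₀ y₀ R)

include hR

theorem x_mem : x W ∈ R := by
  have := ValuationSubring.nonunits_subset hR.2.1
  rw [x_sub] at this
  simpa using add_mem this (hR.1 x₀)

theorem y_mem : y W ∈ R := by
  have := ValuationSubring.nonunits_subset hR.2.2
  rw [y_sub] at this
  simpa using add_mem this (hR.1 y₀)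

theorem algebraMap_mem (a : W.CoordinateRing) : algebraMap _ W.FunctionField a ∈ R :=
  algebraMap_mem_of_mem hR.1 hR.x_mem hR.y_mem a

theorem algebraMap_mem_nonunits {a : W.CoordinateRing}
    (ha : a ∈ CoordinateRing.XYIdeal W x₀ (C y₀)) : algebraMap _ W.FunctionField a ∈ R.nonunits := by
  rw [CoordinateRing.XYIdeal, Ideal.mem_span_pair] at ha
  obtain ⟨u, v, rfl⟩ := ha
  rw [map_add, map_mul, map_mul]
  exact add_mem (ValuationSubring.mul_mem_nonunits (hR.algebraMap_mem u) hR.2.1)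
    (ValuationSubring.mul_mem_nonunits (hR.algebraMap_mem v) hR.2.2)

theorem hasLead_of_notMem (heq : W.Equation x₀ y₀) {t : W.FunctionField} {a : W.CoordinateRing}
    (ha : CoordinateRing.evalAt heq a ≠ 0) :
    R.HasLead t (algebraMap _ W.FunctionField a) 0 (Units.mk0 _ ha) := by
  rw [ValuationSubring.HasLead, zpow_zero, div_one]
  have := hR.algebraMap_mem_nonunits (CoordinateRing.sub_evalAt_mem heq a)
  rw [map_sub] at this
  exact this

end AtPoint

/-- The ideal of the point is proper in the image of the coordinate ring, hence is contained in the
nonunits of some valuation ring above that image. -/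
theorem exists_atPoint (heq : W.Equation x₀ y₀) :
    ∃ R : ValuationSubring W.FunctionField, AtPoint x₀ y₀ R := by
  let A := (algebraMap W.CoordinateRing W.FunctionField).range
  let e : W.CoordinateRing ≃+* A := RingEquiv.ofBijective
    (algebraMap W.CoordinateRing W.FunctionField).rangeRestrict
    ⟨fun a b h => algebraMap_injective (congrArg Subtype.val h),
      (algebraMap W.CoordinateRing W.FunctionField).rangeRestrict_surjective⟩
  have hI := CoordinateRing.isPrime_XYIdeal heq
  obtain ⟨R, hA, hR⟩ := Ideal.image_subset_nonunits_valuationSubring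
    ((CoordinateRing.XYIdeal W x₀ (C y₀)).comap (e.symm : A →+* W.CoordinateRing))
    (Ideal.comap_ne_top _ hI.ne_top)
  have key (a : W.CoordinateRing) (ha : a ∈ CoordinateRing.XYIdeal W x₀ (C y₀)) :
      algebraMap _ W.FunctionField a ∈ R.nonunits := by
    refine hR ⟨e a, ?_, rfl⟩
    change e.symm (e a) ∈ CoordinateRing.XYIdeal W x₀ (C y₀)
    rwa [e.symm_apply_apply]
  exact ⟨R, fun c => hA ⟨_, (algebraMap_eq c).symm⟩,
    key _ (Ideal.subset_span (Set.mem_insert _ _)),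
    key _ (Ideal.subset_span (Set.mem_insert_of_mem _ rfl))⟩

end FunctionField

open FunctionField

theorem isAt_zero_iff {Q : CurvePoint k W.FunctionField} :
    IsAt W Q 0 ↔ AtInfinity Q.ring := ⟨fun h => ⟨Q.containsConstants, h⟩, fun h => h.2⟩

theorem isAt_some_iff {Q : CurvePoint k W.FunctionField} {x₀ y₀ : k} {h : W.Nonsingular x₀ y₀} :
    IsAt W Q (.some x₀ y₀ h) ↔ AtPoint x₀ y₀ Q.ring :=
  ⟨fun h => ⟨Q.containsConstants, h⟩, fun h => h.2⟩

theorem exists_lead_of_regular {p : ValuationSubring W.FunctionField → Prop}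
    (hp : ∀ R, p R → R.ContainsConstants k) {t : W.FunctionFieldˣ}
    (h : ∀ a : W.CoordinateRing, a ≠ 0 → ∃ n : ℤ, ∃ c : kˣ, ∀ R, p R →
      R.HasLead (t : W.FunctionField) (algebraMap _ W.FunctionField a) n c)
    (f : W.FunctionFieldˣ) :
    ∃ n : ℤ, ∃ c : kˣ, ∀ R, p R → R.HasLead (t : W.FunctionField) f n c := by
  obtain ⟨a, b, hb, hf⟩ := IsFractionRing.div_surjective (A := W.CoordinateRing) (f : W.FunctionField)
  have hb0 := nonZeroDivisors.ne_zero hb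
  have ha0 : a ≠ 0 := by
    rintro rfl
    rw [map_zero, zero_div] at hf
    exact f.ne_zero hf.symm
  obtain ⟨n, c, hc⟩ := h a ha0
  obtain ⟨m, d, hd⟩ := h b hb0
  refine ⟨n - m, c / d, fun R hR => ?_⟩
  rw [← hf]
  exact (hc R hR).div (hp R hR) (hd R hR) t.ne_zero

/-- The closed point at a rational point exists, is unique, and has a parameter with respect to
which every function has a leading coefficient in `k`. -/
theorem exists_isAt (P : W.Point) : ∃ Q : CurvePoint k W.FunctionField, IsAt W Q P ∧
    (∃ t, Q.IsParameter t ∧ (P = 0 → t = FunctionField.t W) ∧ ∀ x₀ y₀ h, P = .some x₀ y₀ h →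
      ∃ a ∈ CoordinateRing.XYIdeal W x₀ (C y₀), (t : W.FunctionField) = algebraMap _ _ a) ∧
    ∀ Q', IsAt W Q' P → Q' = Q := by
  rcases P with _ | ⟨x₀, y₀, hns⟩
  · obtain ⟨Q, hQ, ht, hu⟩ := CurvePoint.exists_isParameter (k := k) (p := AtInfinity (W := W))
      (fun R hR => hR.1) exists_atInfinity (t := FunctionField.t W) (fun R hR => t_mem hR)
      (exists_lead_of_regular (fun R hR => hR.1) fun a ha => by
        obtain ⟨c, hc⟩ := exists_hasLead_infinity ha
        exact ⟨_, c, hc⟩)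
    exact ⟨Q, isAt_zero_iff.2 hQ, ⟨_, ht, fun _ => rfl, fun _ _ _ h => by cases h⟩, fun Q' hQ' => hu Q' (isAt_zero_iff.1 hQ')⟩
  · obtain ⟨t, htI, ht0, ht⟩ := CoordinateRing.exists_mul_eq_pow_mul hns
    have ht0' : algebraMap W.CoordinateRing W.FunctionField t ≠ 0 :=
      (map_ne_zero_iff _ algebraMap_injective).2 ht0
    obtain ⟨Q, hQ, ht, hu⟩ := CurvePoint.exists_isParameter (k := k)
      (p := AtPoint (W := W) x₀ y₀) (fun R hR => hR.1) (exists_atPoint hns.left)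
      (t := Units.mk0 _ ht0') (fun R hR => hR.algebraMap_mem_nonunits htI)
      (exists_lead_of_regular (fun R hR => hR.1) fun a ha => by
        obtain ⟨n, s, hs, b, hb, e⟩ := ht a ha
        rw [← CoordinateRing.evalAt_eq_zero_iff hns.left] at hs hb
        refine ⟨n * 1 + 0 - 0, 1 ^ n * Units.mk0 _ hb / Units.mk0 _ hs, fun R hR => ?_⟩
        have hs0 : algebraMap W.CoordinateRing W.FunctionField s ≠ 0 := by
          rw [map_ne_zero_iff _ algebraMap_injective]
          rintro rfl
          exact hs (map_zero _)
        have e' : algebraMap W.CoordinateRing W.FunctionField a =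
            algebraMap _ _ t ^ n * algebraMap _ _ b / algebraMap _ _ s := by
          rw [eq_div_iff hs0, ← map_mul, mul_comm, e, map_mul, map_pow]
        rw [e']
        have h1 := (ValuationSubring.HasLead.self (k := k) (R := R) ht0').pow hR.1 ht0' n
        exact (h1.mul hR.1 (hR.hasLead_of_notMem hns.left hb) ht0').div hR.1
          (hR.hasLead_of_notMem hns.left hs) ht0')
    exact ⟨Q, isAt_some_iff.2 hQ, ⟨_, ht, fun h => (Point.some_ne_zero _ h).elim, fun _ _ _ h => by
      cases h
      exact ⟨_, htI, rfl⟩⟩,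
      fun Q' hQ' => hu Q' (isAt_some_iff.1 hQ')⟩

variable (W) in
/-- The closed point at a rational point. -/
noncomputable def closedPoint (P : W.Point) : CurvePoint k W.FunctionField := (exists_isAt P).choose

theorem isAt_closedPoint (P : W.Point) : IsAt W (closedPoint W P) P := (exists_isAt P).choose_spec.1

theorem exists_isParameter_closedPoint (P : W.Point) : ∃ t, (closedPoint W P).IsParameter t :=
  (exists_isAt P).choose_spec.2.1.imp fun _ h => h.1

theorem isParameter_closedPoint_zero : (closedPoint W 0).IsParameter (FunctionField.t W) := by
  obtain ⟨t, h, h0⟩ := (exists_isAt (0 : W.Point)).choose_spec.2.1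
  rw [← h0.1 rfl]
  exact h

theorem exists_mem_XYIdeal_ord_eq_one {x₀ y₀ : k} (h : W.Nonsingular x₀ y₀) :
    ∃ t, (closedPoint W (.some x₀ y₀ h)).ord t = 1 ∧ ∃ a ∈ CoordinateRing.XYIdeal W x₀ (C y₀),
      (t : W.FunctionField) = algebraMap _ _ a := by
  obtain ⟨t, ht, -, h1⟩ := (exists_isAt (.some x₀ y₀ h : W.Point)).choose_spec.2.1
  exact ⟨t, ht.ord_eq_one, h1 x₀ y₀ h rfl⟩

theorem IsAt.eq_closedPoint {Q : CurvePoint k W.FunctionField} {P : W.Point} (h : IsAt W Q P) :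
    Q = closedPoint W P := (exists_isAt P).choose_spec.2.2 Q h

theorem pointDivisor_eq (P : W.Point) : pointDivisor W P = Finsupp.single (closedPoint W P) 1 := by
  have hex : ∃ Q, IsAt W Q P := ⟨_, isAt_closedPoint P⟩
  rw [pointDivisor, dif_pos hex, hex.choose_spec.eq_closedPoint]

theorem IsAt.unique {Q : CurvePoint k W.FunctionField} {P P' : W.Point} (h : IsAt W Q P)
    (h' : IsAt W Q P') : P = P' := by
  rcases P with _ | ⟨x₀, y₀, hns⟩ <;> rcases P' with _ | ⟨x₁, y₁, hns'⟩
  · rfl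
  · exact ((isAt_zero_iff.1 h).2 (isAt_some_iff.1 h').x_mem).elim
  · exact ((isAt_zero_iff.1 h').2 (isAt_some_iff.1 h).x_mem).elim
  · have h1 := isAt_some_iff.1 h
    have h2 := isAt_some_iff.1 h'
    have key {a b : k} {z : W.FunctionField} (ha : z - algebraMap k _ a ∈ Q.ring.nonunits)
        (hb : z - algebraMap k _ b ∈ Q.ring.nonunits) : a = b := by
      by_contra hne
      have := sub_mem ha hb
      rw [sub_sub_sub_cancel_left, ← map_sub] at this
      exact ValuationSubring.algebraMap_notMem_nonunits Q.containsConstants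
        (Units.mk0 _ (sub_ne_zero.2 (Ne.symm hne))) this
    have hx := h1.2.1
    have hx' := h2.2.1
    have hy := h1.2.2
    have hy' := h2.2.2
    rw [x_sub] at hx hx'
    rw [y_sub] at hy hy'
    cases key hx hx'
    cases key hy hy'
    rfl

end WeierstrassCurve.Affine

/-! ### Functions without zeros and poles -/

namespace WeierstrassCurve.Affine

open Polynomial
open scoped Polynomial.Bivariate nonZeroDivisors

variable {k : Type*} [Field k] {W : Affine k}

namespace FunctionField

instance : FaithfulSMul k[X] W.FunctionField :=
  (faithfulSMul_iff_algebraMap_injective _ _).2 (by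
    rw [IsScalarTower.algebraMap_eq k[X] W.CoordinateRing W.FunctionField]
    exact algebraMap_injective.comp (FaithfulSMul.algebraMap_injective _ _))

theorem algebraMap_polynomial (p : k[X]) : algebraMap k[X] W.FunctionField p = aeval (x W) p := by
  rw [IsScalarTower.algebraMap_apply k[X] W.CoordinateRing W.FunctionField, ← algebraMap_C]
  rfl

instance : Module.Finite k[X] W.CoordinateRing := Module.Finite.of_basis (CoordinateRing.basis W)

variable (K : Type*) [Field K] [Algebra k[X] K] [IsFractionRing k[X] K] [Algebra K W.FunctionField]
  [IsScalarTower k[X] K W.FunctionField]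

theorem isLocalization_algebraMapSubmonoid : IsLocalization
    (Algebra.algebraMapSubmonoid W.CoordinateRing k[X]⁰) W.FunctionField := inferInstance

theorem finiteDimensional : FiniteDimensional K W.FunctionField :=
  have := isLocalization_algebraMapSubmonoid (W := W)
  Module.Finite.of_isLocalization k[X] W.CoordinateRing k[X]⁰

theorem norm_algebraMap (a : W.CoordinateRing) :
    Algebra.norm K (algebraMap _ W.FunctionField a) = algebraMap k[X] K (Algebra.norm k[X] a) :=
  have := isLocalization_algebraMapSubmonoid (W := W)
  Algebra.norm_localization k[X] k[X]⁰ a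

/-- The quadratic equation of y over k(x) has discriminant (a₁x + a₃)² + 4(x³ + …), whose
coefficients at x³ and x² are 4 and a₁² + 4a₂. For a₁ ≠ 0 they cannot both vanish, in any
characteristic. -/
theorem isSeparable_y (h : W.a₁ ≠ 0) : IsSeparable K (y W) := by
  let b : k[X] := C W.a₁ * X + C W.a₃
  let c : k[X] := X ^ 3 + C W.a₂ * X ^ 2 + C W.a₄ * X + C W.a₆
  have hd : b ^ 2 + 4 * c ≠ 0 := by
    intro h0
    have e : b ^ 2 + 4 * c = (⟨4, W.a₁ ^ 2 + 4 * W.a₂, 2 * W.a₁ * W.a₃ + 4 * W.a₄,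
        W.a₃ ^ 2 + 4 * W.a₆⟩ : Cubic k).toPoly := by
      simp only [b, c, Cubic.toPoly, C_add, C_mul, C_pow, C_ofNat]
      ring
    rw [e] at h0
    have h3 : (4 : k) = 0 := by
      have := congrArg (fun p => p.coeff 3) h0
      rwa [Cubic.coeff_eq_a, coeff_zero] at this
    have h2 : W.a₁ ^ 2 + 4 * W.a₂ = 0 := by
      have := congrArg (fun p => p.coeff 2) h0
      rwa [Cubic.coeff_eq_b, coeff_zero] at this
    rw [h3, zero_mul, add_zero] at h2
    exact h (pow_eq_zero_iff two_ne_zero |>.1 h2)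
  let B := algebraMap k[X] K b
  let D := algebraMap k[X] K c
  have hD : B ^ 2 + 4 * D ≠ 0 := by
    have := (map_ne_zero_iff (algebraMap k[X] K) (IsFractionRing.injective k[X] K)).2 hd
    rwa [map_add, map_mul, map_pow, map_ofNat] at this
  let f : K[X] := X ^ 2 + C B * X - C D
  have hf : aeval (y W) f = 0 := by
    have hB : algebraMap K W.FunctionField B =
        algebraMap k _ W.a₁ * x W + algebraMap k _ W.a₃ := by
      rw [← IsScalarTower.algebraMap_apply, algebraMap_polynomial]
      simp [b]
    have hC : algebraMap K W.FunctionField D = x W ^ 3 + algebraMap k _ W.a₂ * x W ^ 2 +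
        algebraMap k _ W.a₄ * x W + algebraMap k _ W.a₆ := by
      rw [← IsScalarTower.algebraMap_apply, algebraMap_polynomial]
      simp [c]
    simp only [f, map_add, map_sub, map_mul, map_pow, aeval_X, aeval_C, hB, hC]
    linear_combination equation (W := W)
  have hsep : f.Separable := by
    have hder : derivative f = 2 * X + C B := by
      simp [f]
      exact one_add_one_eq_two
    -- The Bézout identity is f'² - 4f = B² + 4D.
    refine ⟨-C (4 * (B ^ 2 + 4 * D)⁻¹), C ((B ^ 2 + 4 * D)⁻¹) * (2 * X + C B), ?_⟩
    rw [hder]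
    have : (C ((B ^ 2 + 4 * D)⁻¹) * (C B ^ 2 + 4 * C D) : K[X]) = 1 := by
      rw [← C_1, ← inv_mul_cancel₀ hD]
      simp only [C_add, C_mul, C_pow, C_ofNat]
    simp only [f, C_mul, C_ofNat]
    linear_combination this
  exact hsep.of_dvd (minpoly.dvd K _ hf)

theorem algebra_isSeparable (h : W.a₁ ≠ 0) : Algebra.IsSeparable K W.FunctionField := by
  have htop : IntermediateField.adjoin K {y W} = ⊤ := by
    rw [eq_top_iff]
    intro f _
    obtain ⟨a, b, -, rfl⟩ := IsFractionRing.div_surjective (A := W.CoordinateRing) f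
    have key (a : W.CoordinateRing) :
        algebraMap _ W.FunctionField a ∈ IntermediateField.adjoin K {y W} := by
      obtain ⟨p, q, rfl⟩ := CoordinateRing.exists_smul_basis_eq a
      rw [algebraMap_smul_basis, ← algebraMap_polynomial, ← algebraMap_polynomial]
      rw [IsScalarTower.algebraMap_apply k[X] K W.FunctionField p,
        IsScalarTower.algebraMap_apply k[X] K W.FunctionField q]
      exact add_mem (IntermediateField.algebraMap_mem _ _)
        (mul_mem (IntermediateField.algebraMap_mem _ _)
          (IntermediateField.mem_adjoin_simple_self K _))
    exact div_mem (key a) (key b)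
  have := (IntermediateField.isSeparable_adjoin_simple_iff_isSeparable K W.FunctionField).2
    (isSeparable_y K h)
  rw [htop] at this
  exact AlgEquiv.Algebra.isSeparable (IntermediateField.topEquiv (F := K) (E := W.FunctionField))

/-- A function without poles at the closed points away from infinity is integral over `k[x]`. -/
theorem isIntegral_of_ord_nonneg (h : W.a₁ ≠ 0) (f : W.FunctionFieldˣ)
    (hf : ∀ Q : CurvePoint k W.FunctionField, 0 ≤ Q.ord f) :
    _root_.IsIntegral k[X] (f : W.FunctionField) := by
  letI : Algebra (FractionRing k[X]) W.FunctionField := FractionRing.liftAlgebra _ _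
  have := finiteDimensional (W := W) (FractionRing k[X])
  -- Separability makes the integral closure of k[x] a Dedekind domain whose height one primes are
  -- closed points; integrality can then be tested at those primes.
  have := algebra_isSeparable (W := W) (FractionRing k[X]) h
  have : IsDedekindDomain (integralClosure k[X] W.FunctionField) :=
    integralClosure.isDedekindDomain k[X] (FractionRing k[X]) _
  have : IsFractionRing (integralClosure k[X] W.FunctionField) W.FunctionField :=
    IsIntegralClosure.isFractionRing_of_finite_extension k[X] (FractionRing k[X]) _ _
  obtain ⟨a, ha⟩ : (f : W.FunctionField) ∈
      (algebraMap (integralClosure k[X] W.FunctionField) W.FunctionField).range := by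
    refine IsDedekindDomain.HeightOneSpectrum.mem_integers_of_valuation_le_one _ _ fun v => ?_
    let R := IsDedekindDomain.HeightOneSpectrum.valuationSubringAtPrime W.FunctionField v
    have hDVR : IsDiscreteValuationRing R :=
      IsLocalization.AtPrime.isDiscreteValuationRing_of_dedekind_domain _ v.ne_bot R
    have hc (c : k) : algebraMap k W.FunctionField c ∈ R := by
      have : (algebraMap k W.FunctionField c) = algebraMap k[X] _ (C c) := by
        rw [algebraMap_polynomial, aeval_C]
      rw [this, IsScalarTower.algebraMap_apply k[X] (integralClosure k[X] W.FunctionField),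
        IsScalarTower.algebraMap_apply (integralClosure k[X] W.FunctionField) R]
      exact (algebraMap (integralClosure k[X] W.FunctionField) R _).2
    have := (CurvePoint.mem_ring_iff ⟨R, hc, hDVR⟩ f).2 (hf _)
    change (f : W.FunctionField) ∈ R at this
    rwa [show R = (v.valuation W.FunctionField).valuationSubring from
      IsDedekindDomain.HeightOneSpectrum.valuationSubringAtPrime_eq_valuationSubring v] at this
  rw [← ha]
  exact a.2

theorem natDegree_norm_C {b : k[X]} :
    (Algebra.norm k[X] (algebraMap k[X] W.CoordinateRing b)) = b ^ 2 := by
  rw [Algebra.algebraMap_eq_smul_one, ← add_zero (b • 1),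
    ← zero_smul k[X] (CoordinateRing.mk W Y), CoordinateRing.norm_smul_basis]
  ring

/-- A function integral over `k[x]` that vanishes at infinity is zero. -/
theorem eq_zero_of_isIntegral {g : W.FunctionField} (hg : _root_.IsIntegral k[X] g)
    {R : ValuationSubring W.FunctionField} (hR : AtInfinity R) (hgR : g ∈ R.nonunits) : g = 0 := by
  letI : Algebra (FractionRing k[X]) W.FunctionField := FractionRing.liftAlgebra _ _
  have := isLocalization_algebraMapSubmonoid (W := W)
  by_contra hg0
  obtain ⟨⟨a, ⟨_, b, hb, rfl⟩⟩, hab⟩ := IsLocalization.surj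
    (Algebra.algebraMapSubmonoid W.CoordinateRing k[X]⁰) g
  simp only at hab
  have hb0 : b ≠ 0 := nonZeroDivisors.ne_zero hb
  have hb1 : algebraMap k[X] W.CoordinateRing b ≠ 0 :=
    (map_ne_zero_iff _ (FaithfulSMul.algebraMap_injective _ _)).2 hb0
  have hb2 : algebraMap W.CoordinateRing W.FunctionField (algebraMap k[X] _ b) ≠ 0 :=
    (map_ne_zero_iff _ algebraMap_injective).2 hb1
  have ha0 : a ≠ 0 := by
    rintro rfl
    rw [map_zero, mul_eq_zero] at hab
    exact hab.elim hg0 hb2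
  -- With g = a/b the norm r of g is a polynomial, so N(a) = r b² and the order of g at infinity is
  -- -deg r ≤ 0. Thus g cannot vanish there.
  obtain ⟨r, hr⟩ := IsIntegrallyClosed.isIntegral_iff.1 (Algebra.isIntegral_norm (FractionRing k[X]) hg)
  have hN := congrArg (Algebra.norm (FractionRing k[X])) hab
  rw [map_mul, norm_algebraMap, norm_algebraMap, ← hr, ← map_mul] at hN
  have hN' := IsFractionRing.injective k[X] (FractionRing k[X]) hN
  rw [natDegree_norm_C] at hN'
  have hr0 : r ≠ 0 := by
    rintro rfl
    rw [zero_mul, eq_comm, Algebra.norm_eq_zero_iff_of_basis (CoordinateRing.basis W)] at hN'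
    exact ha0 hN'
  obtain ⟨c, hc⟩ := exists_hasLead_infinity ha0
  obtain ⟨d, hd⟩ := exists_hasLead_infinity hb1
  have h1 := ((hc R hR).div hR.1 (hd R hR) (t W).ne_zero).valuation_eq_zpow hR.1 (t W).ne_zero
  rw [← hab, mul_div_cancel_right₀ _ hb2, ← hN', natDegree_norm_C,
    natDegree_mul hr0 (pow_ne_zero _ hb0)] at h1
  have ht := R.mem_nonunits_iff.1 (t_mem hR)
  rw [ValuationSubring.mem_nonunits_iff, h1] at hgR
  refine hgR.not_ge (one_le_zpow_of_nonpos₀ ?_ ht.le (by omega))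
  exact zero_lt_iff.2 ((Valuation.ne_zero_iff _).2 (t W).ne_zero)

/-- Functions without zeros and poles are constant. -/
theorem exists_eq_algebraMap (h : W.a₁ ≠ 0) (f : W.FunctionFieldˣ)
    (hf : ∀ Q : CurvePoint k W.FunctionField, Q.ord f = 0) :
    ∃ c : kˣ, (f : W.FunctionField) = algebraMap k _ c := by
  have hint := isIntegral_of_ord_nonneg h f fun Q => (hf Q).ge
  obtain ⟨n, c, hc⟩ := isParameter_closedPoint_zero.exists_lead f
  have hn := isParameter_closedPoint_zero.ord_eq hc
  rw [hf] at hn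
  rw [ValuationSubring.HasLead, ← hn, zpow_zero, div_one] at hc
  refine ⟨c, sub_eq_zero.1 (eq_zero_of_isIntegral (hint.sub ?_)
    (isAt_zero_iff.1 (isAt_closedPoint 0)) hc)⟩
  have : algebraMap k W.FunctionField c = algebraMap k[X] _ (C (c : k)) := by
    rw [algebraMap_polynomial, aeval_C]
  rw [this]
  exact isIntegral_algebraMap

end FunctionField

end WeierstrassCurve.Affine

/-! ### The divisor of a chord -/

namespace CurvePoint

variable {k F : Type*} [Field k] [Field F] [Algebra k F] (Q : CurvePoint k F)

theorem ord_eq_zero_of_unit (u : Q.ringˣ) (f : Fˣ) (hf : (f : F) = (u : Q.ring)) :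
    Q.ord f = 0 := by
  have h1 := (Q.mem_ring_iff f).1 (by rw [hf]; exact (u : Q.ring).2)
  have h3 : ((f⁻¹ : Fˣ) : F) = ((u⁻¹ : Q.ringˣ) : Q.ring) := by
    rw [Units.val_inv_eq_inv_val, hf]
    exact inv_eq_of_mul_eq_one_left (congrArg Subtype.val u.inv_mul)
  have h2 := (Q.mem_ring_iff f⁻¹).1 (by rw [h3]; exact ((u⁻¹ : Q.ringˣ) : Q.ring).2)
  rw [ord_inv] at h2
  omega

theorem ord_eq_of_associated {a b : Q.ring} (h : Associated a b) {f g : Fˣ} (hf : (f : F) = a)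
    (hg : (g : F) = b) : Q.ord f = Q.ord g := by
  obtain ⟨u, hu⟩ := h
  have e : g = f * (g / f) := (mul_div_cancel f g).symm
  rw [e, ord_mul, Q.ord_eq_zero_of_unit u (g / f), add_zero]
  rw [Units.val_div_eq_div_val, hf, hg, ← hu, MulMemClass.coe_mul, mul_div_cancel_left₀]
  rw [← hf]; exact f.ne_zero

end CurvePoint

namespace WeierstrassCurve.Affine

open Polynomial
open scoped Polynomial.Bivariate

variable {k : Type*} [Field k] {W : Affine k}

open FunctionField

theorem pointDivisor_apply_of_isAt {Q : CurvePoint k W.FunctionField} {P : W.Point}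
    (h : IsAt W Q P) : pointDivisor W P Q = 1 := by
  rw [pointDivisor_eq, h.eq_closedPoint, Finsupp.single_eq_same]

theorem pointDivisor_apply_of_not_isAt {Q : CurvePoint k W.FunctionField} {P : W.Point}
    (h : ¬IsAt W Q P) : pointDivisor W P Q = 0 := by
  rw [pointDivisor_eq, Finsupp.single_eq_of_ne]
  rintro rfl
  exact h (isAt_closedPoint P)

namespace FunctionField

theorem y_mem_of_x_mem {R : ValuationSubring W.FunctionField} (hR : R.ContainsConstants k)
    (hx : x W ∈ R) : y W ∈ R := by
  by_contra hy
  have hi : (y W)⁻¹ ∈ R := (R.mem_or_inv_mem _).resolve_left hy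
  refine hy ?_
  have e : y W = (x W ^ 3 + algebraMap k _ W.a₂ * x W ^ 2 + algebraMap k _ W.a₄ * x W +
      algebraMap k _ W.a₆) * (y W)⁻¹ - (algebraMap k _ W.a₁ * x W + algebraMap k _ W.a₃) := by
    have hy0 := y_ne_zero (W := W)
    field_simp
    linear_combination equation (W := W)
  rw [e]
  exact sub_mem (mul_mem (add_mem (add_mem (add_mem (pow_mem hx 3) (mul_mem (hR _) (pow_mem hx 2)))
    (mul_mem (hR _) hx)) (hR _)) hi) (add_mem (mul_mem (hR _) hx) (hR _))

end FunctionField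

section Ideal

variable {Q : CurvePoint k W.FunctionField} (hQ : ¬IsAt W Q 0)

/-- Regular functions are regular at the points away from infinity. -/
noncomputable def toRing : W.CoordinateRing →+* Q.ring :=
  (algebraMap W.CoordinateRing W.FunctionField).codRestrict Q.ring.toSubring
    (algebraMap_mem_of_mem Q.containsConstants (not_not.1 hQ)
      (y_mem_of_x_mem Q.containsConstants (not_not.1 hQ)))

theorem coe_toRing (a : W.CoordinateRing) :
    (toRing hQ a : W.FunctionField) = algebraMap _ _ a := rfl

/-- Translates identities between ideals of the coordinate ring into identities between orders at Q:
the ideal of a point becomes the maximal ideal at that point and the unit ideal elsewhere. -/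
theorem map_XYIdeal {x₀ y₀ : k} (h : W.Nonsingular x₀ y₀) :
    ∃ e : ℕ, (e : ℤ) = pointDivisor W (.some x₀ y₀ h) Q ∧
      (CoordinateRing.XYIdeal W x₀ (C y₀)).map (toRing hQ) = Ideal.span {Q.uniformizer ^ e} := by
  by_cases hat : IsAt W Q (.some x₀ y₀ h)
  · refine ⟨1, by rw [pointDivisor_apply_of_isAt hat, Nat.cast_one], ?_⟩
    rw [pow_one, ← Q.uniformizer_irreducible.maximalIdeal_eq]
    refine le_antisymm (Ideal.map_le_iff_le_comap.2 fun a ha => ?_) ?_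
    · rw [Ideal.mem_comap, ← ValuationSubring.coe_mem_nonunits_iff]
      exact (isAt_some_iff.1 hat).algebraMap_mem_nonunits ha
    · obtain ⟨t, ht, a, ha, hta⟩ := exists_mem_XYIdeal_ord_eq_one h
      rw [← hat.eq_closedPoint] at ht
      have h0 : (Q.uniformizer : W.FunctionField) ≠ 0 :=
        fun h => Q.uniformizer_irreducible.ne_zero (Subtype.ext h)
      have h1 := Q.ord_uniformizer Q.uniformizer_irreducible (Units.mk0 _ h0) rfl
      have h2 : ((Units.mk0 _ h0 / t : W.FunctionFieldˣ) : W.FunctionField) ∈ Q.ring :=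
        (Q.mem_ring_iff _).2 (by rw [Q.ord_div, h1, ht, sub_self])
      rw [Q.uniformizer_irreducible.maximalIdeal_eq, Ideal.span_singleton_le_iff_mem]
      have e : Q.uniformizer = ⟨_, h2⟩ * toRing hQ a := by
        apply Subtype.ext
        rw [MulMemClass.coe_mul, coe_toRing, ← hta]
        change _ = ((Units.mk0 _ h0 / t : W.FunctionFieldˣ) : W.FunctionField) * t
        rw [← Units.val_mul, div_mul_cancel, Units.val_mk0]
      rw [e]
      exact Ideal.mul_mem_left _ _ (Ideal.mem_map_of_mem _ ha)
  · refine ⟨0, by rw [pointDivisor_apply_of_not_isAt hat, Nat.cast_zero], ?_⟩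
    rw [pow_zero, Ideal.span_singleton_one]
    rw [isAt_some_iff, AtPoint] at hat
    have key (a : W.CoordinateRing) (ha : a ∈ CoordinateRing.XYIdeal W x₀ (C y₀))
        (h : algebraMap _ W.FunctionField a ∉ Q.ring.nonunits) :
        (CoordinateRing.XYIdeal W x₀ (C y₀)).map (toRing hQ) = ⊤ := by
      refine Ideal.eq_top_of_isUnit_mem _ (Ideal.mem_map_of_mem _ ha) ?_
      rw [← coe_toRing hQ, ValuationSubring.coe_mem_nonunits_iff, IsLocalRing.mem_maximalIdeal,
        mem_nonunits_iff, not_not] at h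
      exact h
    by_cases hx : algebraMap W.CoordinateRing W.FunctionField (CoordinateRing.XClass W x₀) ∈
        Q.ring.nonunits
    · exact key _ (Ideal.subset_span (Set.mem_insert_of_mem _ rfl))
        fun hy => hat ⟨Q.containsConstants, hx, hy⟩
    · exact key _ (Ideal.subset_span (Set.mem_insert _ _)) hx

end Ideal

section Chord

variable [DecidableEq k] {x₁ y₁ x₂ y₂ : k}

/-- The function `(y - y₁ - ℓ (x - x₁)) / (x - x₃)` attached to the chord through two points. -/
noncomputable def chord (W : Affine k) (x₁ y₁ x₂ y₂ : k) : W.FunctionFieldˣ :=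
  Units.mk0 (algebraMap _ _ (CoordinateRing.YClass W (linePolynomial x₁ y₁ (W.slope x₁ x₂ y₁ y₂))))
      ((map_ne_zero_iff _ algebraMap_injective).2 (CoordinateRing.YClass_ne_zero _)) /
    Units.mk0 (algebraMap _ _ (CoordinateRing.XClass W (W.addX x₁ x₂ (W.slope x₁ x₂ y₁ y₂))))
      ((map_ne_zero_iff _ algebraMap_injective).2 (CoordinateRing.XClass_ne_zero _))

theorem coe_chord : (chord W x₁ y₁ x₂ y₂ : W.FunctionField) =
    algebraMap _ _ (CoordinateRing.YClass W (linePolynomial x₁ y₁ (W.slope x₁ x₂ y₁ y₂))) /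
      algebraMap _ _ (CoordinateRing.XClass W (W.addX x₁ x₂ (W.slope x₁ x₂ y₁ y₂))) := rfl

theorem algebraMap_YClass (p : k[X]) :
    algebraMap W.CoordinateRing W.FunctionField (CoordinateRing.YClass W p) =
      y W + aeval (x W) (-p) := by
  rw [CoordinateRing.YClass, map_sub, map_sub, algebraMap_C, map_neg, sub_eq_add_neg]
  rfl

/-- At infinity y has order -3 and dominates the linear polynomial in x, while x - x₃ has order -2.
Both have leading coefficient 1. -/
theorem hasLead_chord {R : ValuationSubring W.FunctionField} (hR : AtInfinity R) :
    R.HasLead (t W : W.FunctionField) (chord W x₁ y₁ x₂ y₂ : W.FunctionField) (-1) (1 : kˣ) := by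
  rw [coe_chord]
  have h1 : R.HasLead (t W : W.FunctionField) (algebraMap _ _ (CoordinateRing.YClass W
      (linePolynomial x₁ y₁ (W.slope x₁ x₂ y₁ y₂)))) (-3) (1 : kˣ) := by
    rw [algebraMap_YClass]
    rcases eq_or_ne (-linePolynomial x₁ y₁ (W.slope x₁ x₂ y₁ y₂)) 0 with h0 | h0
    · rw [h0, map_zero, add_zero]; exact hasLead_y hR
    · refine (hasLead_y hR).add (t W).ne_zero hR.1 (t_mem hR) (hasLead_aeval hR h0) ?_
      have : (-linePolynomial x₁ y₁ (W.slope x₁ x₂ y₁ y₂)).natDegree ≤ 1 := by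
        rw [natDegree_neg, linePolynomial]
        compute_degree
      omega
  have h2 : R.HasLead (t W : W.FunctionField) (algebraMap _ _ (CoordinateRing.XClass W
      (W.addX x₁ x₂ (W.slope x₁ x₂ y₁ y₂)))) (-2) (1 : kˣ) := by
    have := hasLead_aeval hR (X_sub_C_ne_zero (W.addX x₁ x₂ (W.slope x₁ x₂ y₁ y₂)))
    rw [natDegree_X_sub_C, ← algebraMap_C] at this
    convert this using 1
    · rfl
    · rfl
    · exact Units.ext (by rw [Units.val_mk0, leadingCoeff_X_sub_C, Units.val_one])
  have h3 := h1.div hR.1 h2 (t W).ne_zero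
  rwa [div_one] at h3

theorem hasLead_chord_some {x₀ y₀ : k} {R : ValuationSubring W.FunctionField} (hR : AtPoint x₀ y₀ R)
    (heq : W.Equation x₀ y₀) (hx : x₀ ≠ W.addX x₁ x₂ (W.slope x₁ x₂ y₁ y₂)) {c : kˣ}
    (hc : c * (x₀ - W.addX x₁ x₂ (W.slope x₁ x₂ y₁ y₂)) =
      y₀ - (W.slope x₁ x₂ y₁ y₂ * (x₀ - x₁) + y₁)) {t : W.FunctionFieldˣ} :
    R.HasLead (t : W.FunctionField) (chord W x₁ y₁ x₂ y₂ : W.FunctionField) 0 c := by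
  have hX (a : k) : CoordinateRing.evalAt heq (CoordinateRing.XClass W a) = x₀ - a := by
    have h0 : CoordinateRing.evalAt heq (CoordinateRing.XClass W x₀) = 0 :=
      (CoordinateRing.evalAt_eq_zero_iff heq).2 (Ideal.subset_span (Set.mem_insert _ _))
    have e : CoordinateRing.XClass W a =
        CoordinateRing.XClass W x₀ + algebraMap k _ (x₀ - a) := by
      change _ = _ + CoordinateRing.mk W (C (C (x₀ - a)))
      rw [CoordinateRing.XClass, CoordinateRing.XClass, ← map_add, ← C_add]
      congr 2
      rw [Polynomial.C_sub]
      ring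
    rw [e, map_add, h0, zero_add, AlgHom.commutes]
    rfl
  have hY (ℓ : k) : CoordinateRing.evalAt heq (CoordinateRing.YClass W (linePolynomial x₁ y₁ ℓ)) =
      y₀ - (ℓ * (x₀ - x₁) + y₁) := by
    have h0 : CoordinateRing.evalAt heq (CoordinateRing.YClass W (C y₀)) = 0 :=
      (CoordinateRing.evalAt_eq_zero_iff heq).2
        (Ideal.subset_span (Set.mem_insert_of_mem _ rfl))
    have e : CoordinateRing.YClass W (linePolynomial x₁ y₁ ℓ) =
        CoordinateRing.YClass W (C y₀) + algebraMap k _ (y₀ - y₁) -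
          algebraMap k _ ℓ * CoordinateRing.XClass W x₁ := by
      change _ = _ + CoordinateRing.mk W (C (C (y₀ - y₁))) -
        CoordinateRing.mk W (C (C ℓ)) * CoordinateRing.XClass W x₁
      rw [CoordinateRing.YClass, CoordinateRing.YClass, CoordinateRing.XClass, ← map_add, ← map_mul,
        ← map_sub, linePolynomial]
      congr 1
      simp only [C_add, Polynomial.C_sub, C_mul]
      ring
    rw [e, map_sub, map_add, map_mul, h0, hX, zero_add, AlgHom.commutes, AlgHom.commutes]
    change y₀ - y₁ - ℓ * (x₀ - x₁) = _
    ring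
  have hx0 := sub_ne_zero.2 hx
  have hx1 := (hX (W.addX x₁ x₂ (W.slope x₁ x₂ y₁ y₂))).trans_ne hx0
  have hy1 := (hY (W.slope x₁ x₂ y₁ y₂)).trans_ne (hc ▸ mul_ne_zero c.ne_zero hx0)
  have := (hR.hasLead_of_notMem heq (t := t) hy1).div hR.1 (hR.hasLead_of_notMem heq hx1) t.ne_zero
  rw [coe_chord]
  rw [sub_zero] at this
  convert this using 1
  apply Units.ext
  rw [Units.val_div_eq_div_val, Units.val_mk0, Units.val_mk0, hX, hY, ← hc, mul_div_cancel_right₀ _ hx0]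

/-- The divisor of a chord. -/
theorem ord_chord (h₁ : W.Nonsingular x₁ y₁) (h₂ : W.Nonsingular x₂ y₂) (hx : x₁ ≠ x₂)
    (Q : CurvePoint k W.FunctionField) :
    Q.ord (chord W x₁ y₁ x₂ y₂) = pointDivisor W (.some x₁ y₁ h₁) Q +
      pointDivisor W (.some x₂ y₂ h₂) Q -
      pointDivisor W (.some x₁ y₁ h₁ + .some x₂ y₂ h₂) Q - pointDivisor W 0 Q := by
  have hxy : ¬(x₁ = x₂ ∧ y₁ = W.negY x₂ y₂) := fun h => hx h.1
  rw [Point.add_some hxy]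
  by_cases hQ : IsAt W Q 0
  · have hne {x₀ y₀ : k} (h : W.Nonsingular x₀ y₀) : pointDivisor W (.some x₀ y₀ h) Q = 0 :=
      pointDivisor_apply_of_not_isAt fun h' => Point.some_ne_zero h (h'.unique hQ)
    rw [hne, hne, hne, pointDivisor_apply_of_isAt hQ, hQ.eq_closedPoint]
    exact isParameter_closedPoint_zero.ord_eq (hasLead_chord (isAt_zero_iff.1 (isAt_closedPoint 0)))
  obtain ⟨e₁, he₁, hm₁⟩ := map_XYIdeal hQ h₁
  obtain ⟨e₂, he₂, hm₂⟩ := map_XYIdeal hQ h₂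
  obtain ⟨e₃, he₃, hm₃⟩ := map_XYIdeal hQ (nonsingular_add h₁ h₂ hxy)
  -- Away from infinity the orders follow from the ideal identity (x - x₃) I₁ I₂ = (line) I₃,
  -- extended to the local ring at Q.
  have h := congrArg (Ideal.map (toRing hQ)) (CoordinateRing.XYIdeal_mul_XYIdeal h₁.1 h₂.1 hxy)
  rw [Ideal.map_mul, Ideal.map_mul, Ideal.map_mul, hm₁, hm₂, hm₃, CoordinateRing.XIdeal,
    CoordinateRing.YIdeal, Ideal.map_span, Ideal.map_span, Set.image_singleton, Set.image_singleton,
    Ideal.span_singleton_mul_span_singleton, Ideal.span_singleton_mul_span_singleton,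
    Ideal.span_singleton_mul_span_singleton, Ideal.span_singleton_eq_span_singleton] at h
  have h0 : (Q.uniformizer : W.FunctionField) ≠ 0 :=
    fun h => Q.uniformizer_irreducible.ne_zero (Subtype.ext h)
  have h1 := Q.ord_uniformizer Q.uniformizer_irreducible (Units.mk0 _ h0) rfl
  have hX := (map_ne_zero_iff (algebraMap W.CoordinateRing W.FunctionField)
    algebraMap_injective).2 (CoordinateRing.XClass_ne_zero (W.addX x₁ x₂ (W.slope x₁ x₂ y₁ y₂)))
  have hY := (map_ne_zero_iff (algebraMap W.CoordinateRing W.FunctionField)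
    algebraMap_injective).2
      (CoordinateRing.YClass_ne_zero (linePolynomial x₁ y₁ (W.slope x₁ x₂ y₁ y₂)))
  have key := Q.ord_eq_of_associated h
    (f := Units.mk0 _ hX * (Units.mk0 _ h0 ^ e₁ * Units.mk0 _ h0 ^ e₂))
    (g := Units.mk0 _ hY * Units.mk0 _ h0 ^ e₃) (by push_cast; rfl) (by push_cast; rfl)
  rw [Q.ord_mul, Q.ord_mul, Q.ord_mul, Q.ord_pow, Q.ord_pow, Q.ord_pow, h1] at key
  rw [pointDivisor_apply_of_not_isAt hQ, ← he₁, ← he₂, ← he₃]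
  change Q.ord (Units.mk0 _ hY / Units.mk0 _ hX) = _
  rw [Q.ord_div]
  linarith

end Chord

end WeierstrassCurve.Affine

/-! ### The pairing on the Tate curve -/

namespace TateCurve

variable {K : Type*} [NontriviallyNormedField K] [CompleteSpace K] [IsUltrametricDist K]

/-- The line also passes through the point with parameter (xy)⁻¹. Factoring out X(v) - X(xy) leaves
the combination of ζ for the triple x, y, v/(xy) with product v, which `zetaSum_add` evaluates. -/
theorem line_eq {q : K} (hq : ‖q‖ < 1) (hq0 : q ≠ 0) {x y v : K} (hx : x ≠ 0) (hy : y ≠ 0)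
    (hv : v ≠ 0) (hx' : Generic q x) (hy' : Generic q y) (hv' : Generic q v)
    (hxy : Generic q (x * y)) (hvw : Generic q (v / (x * y))) :
    (yFun q v - ((zetaSum q x + zetaSum q y - zetaSum q (x * y)) * (xFun q v - xFun q x) +
        yFun q x)) * (theta q x * theta q y * theta q (v / (x * y)) * theta q v) =
      -(thetaReg q 1 * theta q (x * y) * theta q (v / y) * theta q (v / x)) *
        (xFun q v - xFun q (x * y)) := by
  have hxy0 := mul_ne_zero hx hy
  have h1 := yFun_mul hq hq0 hx hy hx' hy' hxy
  have h2 := yFun_sub hq hq0 hv (inv_ne_zero hxy0) hv' hxy.inv (by rwa [← div_eq_mul_inv])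
  rw [xFun_inv hq0 hxy0 hxy, yFun_inv hq hq0 hxy0 hxy, zetaSum_inv hq hq0 hxy0 hxy,
    ← div_eq_mul_inv] at h2
  have e : x * y * (v / (x * y)) = v := mul_div_cancel₀ v hxy0
  have h3 := zetaSum_add hq hq0 hx hy (div_ne_zero hv hxy0) hx' hy' hvw (by rwa [e])
  rw [e, show x * (v / (x * y)) = v / y by field_simp,
    show y * (v / (x * y)) = v / x by field_simp] at h3
  linear_combination (theta q x * theta q y * theta q (v / (x * y)) * theta q v) * (h2 - h1) -
    (xFun q v - xFun q (x * y)) * h3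

variable {q : Kˣ}

theorem theta_ne_zero_of_notMem (hq : ‖(q : K)‖ < 1) {u : Kˣ} (hu : u ∉ Subgroup.zpowers q) :
    theta (q : K) u ≠ 0 := theta_ne_zero hq q.ne_zero (generic_iff.2 hu)

open Classical in
/-- The value of the theta function, as a unit (`1` on `q ^ ℤ`). -/
noncomputable def thetaUnit (q u : Kˣ) : Kˣ :=
  if h : theta (q : K) u ≠ 0 then Units.mk0 _ h else 1

theorem coe_thetaUnit (hq : ‖(q : K)‖ < 1) {u : Kˣ} (hu : u ∉ Subgroup.zpowers q) :
    (thetaUnit q u : K) = theta (q : K) u := by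
  rw [thetaUnit, dif_pos (theta_ne_zero_of_notMem hq hu), Units.val_mk0]

/-- The value at `v` of the chord through the points with parameters `x` and `y`. -/
noncomputable def chordValue (hq : ‖(q : K)‖ < 1) (x y v : Kˣ) : Kˣ :=
  -(Units.mk0 _ (thetaReg_one_ne_zero hq) * thetaUnit q (x * y) * thetaUnit q (v / y) *
    thetaUnit q (v / x)) / (thetaUnit q x * thetaUnit q y * thetaUnit q (v / (x * y)) * thetaUnit q v)

open Classical in
/-- The function with divisor `[x] + [y] - [x y] - [O]`. -/
noncomputable def chordFun (q x y : Kˣ) : (curve q).FunctionFieldˣ :=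
  WeierstrassCurve.Affine.chord (curve q) (xFun (q : K) x) (yFun (q : K) x) (xFun (q : K) y)
    (yFun (q : K) y)

open WeierstrassCurve.Affine

section

variable (hq : ‖(q : K)‖ < 1) {x y : Kˣ} (hx : x ∉ Subgroup.zpowers q)
  (hy : y ∉ Subgroup.zpowers q) (hxy : x * y ∉ Subgroup.zpowers q)
  (hxy' : x⁻¹ * y ∉ Subgroup.zpowers q)

include hq hx hy hxy hxy'

theorem xFun_ne_of_notMem : xFun (q : K) x ≠ xFun (q : K) y := by
  rw [← generic_iff] at hx hy hxy hxy'
  push_cast at hxy hxy'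
  exact xFun_ne hq q.ne_zero x.ne_zero y.ne_zero hx hy hxy' hxy

theorem ord_chordFun (Q : CurvePoint K (curve q).FunctionField) :
    Q.ord (chordFun q x y) = pointDivisor (curve q) (point q x) Q +
      pointDivisor (curve q) (point q y) Q - pointDivisor (curve q) (point q (x * y)) Q -
      pointDivisor (curve q) 0 Q := by
  classical
  rw [point_mul hq, point_eq_some hq (generic_iff.2 hx), point_eq_some hq (generic_iff.2 hy)]
  exact ord_chord _ _ (xFun_ne_of_notMem hq hx hy hxy hxy') Q

open Classical in
theorem slope_eq : (curve q).slope (xFun (q : K) x) (xFun (q : K) y) (yFun (q : K) x)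
    (yFun (q : K) y) = zetaSum (q : K) x + zetaSum (q : K) y - zetaSum (q : K) (x * y) := by
  have hX := xFun_ne_of_notMem hq hx hy hxy hxy'
  rw [← generic_iff] at hx hy hxy
  push_cast at hxy
  rw [slope_of_X_ne hX, div_eq_iff (sub_ne_zero.2 hX),
    yFun_sub hq q.ne_zero x.ne_zero y.ne_zero hx hy hxy, mul_comm]

theorem hasLead_chordFun {v : Kˣ} (hv : v ∉ Subgroup.zpowers q) (h1 : v / x ∉ Subgroup.zpowers q)
    (h2 : v / y ∉ Subgroup.zpowers q) (h3 : v / (x * y) ∉ Subgroup.zpowers q)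
    (h4 : v * (x * y) ∉ Subgroup.zpowers q) (t : (curve q).FunctionFieldˣ) :
    (closedPoint (curve q) (point q v)).ring.HasLead (t : (curve q).FunctionField) (chordFun q x y) 0
      (chordValue hq x y v) := by
  classical
  have hs := slope_eq hq hx hy hxy hxy'
  have hne : xFun (q : K) v ≠ xFun (q : K) (x * y : Kˣ) :=
    xFun_ne_of_notMem hq hv hxy h4 (by rwa [← inv_mem_iff, mul_inv_rev, inv_inv, mul_comm,
      ← div_eq_mul_inv])
  have ha : (curve q).addX (xFun (q : K) x) (xFun (q : K) y) ((curve q).slope (xFun (q : K) x)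
      (xFun (q : K) y) (yFun (q : K) x) (yFun (q : K) y)) = xFun (q : K) (x * y : Kˣ) := by
    have := sum_xFun hq q.ne_zero x.ne_zero y.ne_zero (generic_iff.2 hx) (generic_iff.2 hy)
      (by have := generic_iff.2 hxy; rwa [Units.val_mul] at this)
    rw [hs, addX, Units.val_mul]
    change _ + 1 * _ - 0 - _ - _ = _
    linear_combination -this
  have hat := isAt_closedPoint (point q v)
  rw [point_eq_some hq (generic_iff.2 hv)] at hat ⊢
  refine hasLead_chord_some (isAt_some_iff.1 hat) (curve_equation hq (generic_iff.2 hv)) ?_ ?_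
  · rw [ha]
    exact hne
  · rw [ha, hs]
    have key := line_eq hq q.ne_zero x.ne_zero y.ne_zero v.ne_zero (generic_iff.2 hx)
      (generic_iff.2 hy) (generic_iff.2 hv)
      (by have := generic_iff.2 hxy; rwa [Units.val_mul] at this)
      (by have := generic_iff.2 h3; rwa [Units.val_div_eq_div_val, Units.val_mul] at this)
    have n1 := theta_ne_zero_of_notMem hq hx
    have n2 := theta_ne_zero_of_notMem hq hy
    have n3 := theta_ne_zero_of_notMem hq h3
    have n4 := theta_ne_zero_of_notMem hq hv
    rw [chordValue]
    push_cast
    rw [coe_thetaUnit hq hx, coe_thetaUnit hq hy, coe_thetaUnit hq hxy, coe_thetaUnit hq h1,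
      coe_thetaUnit hq h2, coe_thetaUnit hq h3, coe_thetaUnit hq hv, Units.val_mk0]
    push_cast at n3 ⊢
    rw [div_mul_eq_mul_div, div_eq_iff (mul_ne_zero (mul_ne_zero (mul_ne_zero n1 n2) n3) n4), key]

end

theorem hasLead_chordFun_zero (x y : Kˣ) :
    (closedPoint (curve q) 0).ring.HasLead
      (FunctionField.t (curve q) : (curve q).FunctionField) (chordFun q x y) (-1) (1 : Kˣ) := by
  classical
  exact hasLead_chord (isAt_zero_iff.1 (isAt_closedPoint 0))

/-- The quasi-periodicity of `θ(b / u) / θ(u)`. -/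
theorem thetaUnit_quot_zpow_mul (hq : ‖(q : K)‖ < 1) {b u : Kˣ} (hu : u ∉ Subgroup.zpowers q)
    (hbu : b / u ∉ Subgroup.zpowers q) (s : ℤ) :
    thetaUnit q (b / (q ^ s * u)) / thetaUnit q (q ^ s * u) =
      (b / q) ^ s * (thetaUnit q (b / u) / thetaUnit q u) := by
  -- Apply θ(qu) = -u⁻¹θ(u) at u and at b/(qu): the two factors combine to b/q.
  have step : ∀ {u : Kˣ}, u ∉ Subgroup.zpowers q → b / u ∉ Subgroup.zpowers q →
      thetaUnit q (b / (q * u)) / thetaUnit q (q * u) =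
        b / q * (thetaUnit q (b / u) / thetaUnit q u) := by
    intro u hu hbu
    have hq1 := Subgroup.mem_zpowers q
    have h1 : q * u ∉ Subgroup.zpowers q := by rwa [Subgroup.mul_mem_cancel_left _ hq1]
    have h2 : b / (q * u) ∉ Subgroup.zpowers q := by
      have e : b / (q * u) = q⁻¹ * (b / u) := by
        rw [div_mul_eq_div_div_swap, div_eq_inv_mul]
      rwa [e, Subgroup.mul_mem_cancel_left _ (inv_mem hq1)]
    have t1 := theta_mul_self hq q.ne_zero u.ne_zero
    have t2 := theta_mul_self hq q.ne_zero (b / (q * u) : Kˣ).ne_zero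
    have e2 : (q : K) * (b / (q * u) : Kˣ) = (b / u : Kˣ) := by
      have := q.ne_zero
      have := u.ne_zero
      push_cast
      field_simp
    rw [e2] at t2
    have n1 := theta_ne_zero_of_notMem hq hu
    have hu0 := u.ne_zero
    have hb0 := b.ne_zero
    have hq0 := q.ne_zero
    have e3 : (thetaUnit q (b / (q * u)) : K) / thetaUnit q (q * u) =
        (b / q) * (thetaUnit q (b / u) / thetaUnit q u) := by
      rw [coe_thetaUnit hq h2, coe_thetaUnit hq h1, coe_thetaUnit hq hbu, coe_thetaUnit hq hu,
        Units.val_mul q u, t1, t2]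
      generalize theta (q : K) (b / (q * u) : Kˣ) = T
      push_cast
      field_simp
    apply Units.ext
    push_cast
    exact e3
  have hmem (s : ℤ) {u : Kˣ} (hu : u ∉ Subgroup.zpowers q) (hbu : b / u ∉ Subgroup.zpowers q) :
      q ^ s * u ∉ Subgroup.zpowers q ∧ b / (q ^ s * u) ∉ Subgroup.zpowers q := by
    have hs := Subgroup.zpow_mem_zpowers q s
    refine ⟨by rwa [Subgroup.mul_mem_cancel_left _ hs], ?_⟩
    have e : b / (q ^ s * u) = (q ^ s)⁻¹ * (b / u) := by rw [div_mul_eq_div_div_swap, div_eq_inv_mul]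
    rwa [e, Subgroup.mul_mem_cancel_left _ (inv_mem hs)]
  induction s using Int.induction_on with
  | zero => simp
  | succ n ih =>
    obtain ⟨h1, h2⟩ := hmem n hu hbu
    rw [zpow_add_one, mul_comm (q ^ (n : ℤ)), mul_assoc, step h1 h2, ih, zpow_add_one]
    group
  | pred n ih =>
    obtain ⟨h1, h2⟩ := hmem (-n - 1) hu hbu
    have := step h1 h2
    rw [← mul_assoc, mul_comm q, ← zpow_add_one, sub_add_cancel, ih] at this
    rw [zpow_sub_one (b / q), mul_comm _ (b / q)⁻¹, mul_assoc, eq_inv_mul_iff_mul_eq, this]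

end TateCurve

namespace TateCurve

open WeierstrassCurve.Affine

variable {K : Type*} [NontriviallyNormedField K] [CompleteSpace K] [IsUltrametricDist K] {q : Kˣ}

theorem curve_a₁_ne_zero : (curve q).a₁ ≠ 0 := one_ne_zero (α := K)

/-- Needed when the left point is O. The definition may still choose a nonconstant multiple of 1, so
the independence of the choice is invoked with f = 1. -/
theorem divisorPairing_zero_left {E : CurveDivisor K (curve q).FunctionField} {P P' : (curve q).Point}
    (hE : E = pointDivisor (curve q) P - pointDivisor (curve q) P') : divisorPairing 0 E = 0 := by
  obtain ⟨t, ht⟩ := exists_isParameter_closedPoint P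
  obtain ⟨t', ht'⟩ := exists_isParameter_closedPoint P'
  rw [hE, pointDivisor_eq, pointDivisor_eq, CurvePoint.divisorPairing_eq
    (FunctionField.exists_eq_algebraMap curve_a₁_ne_zero) ht ht' (n := 1) one_pos (f := 1)
    (n₁ := 0) (n₀ := 0) (c₁ := 1) (c₀ := 1), div_self', unitTmul_one]
  · intro Q
    rw [Q.ord_one, Finsupp.zero_apply, mul_zero]
  · simpa using ValuationSubring.HasLead.const (k := K)
      (R := (closedPoint (curve q) P).ring) (t := (t : (curve q).FunctionField)) 1
  · simpa using ValuationSubring.HasLead.const (k := K)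
      (R := (closedPoint (curve q) P').ring) (t := (t' : (curve q).FunctionField)) 1

theorem divisorPairing_zero_right {k F : Type*} [Field k] [Field F] [Algebra k F]
    (D : CurveDivisor k F) : divisorPairing D 0 = 0 := by
  rw [divisorPairing]
  split_ifs
  · exact Finsupp.sum_zero_index
  · rfl

theorem prod_range_div_telescope {G : Type*} [CommGroup G] (R : G) (φ : ℕ → G) (m : ℕ) :
    ∏ i ∈ Finset.range m, R * (φ i / φ (i + 1)) = R ^ m * (φ 0 / φ m) := by
  rw [Finset.prod_mul_distrib, Finset.prod_const, Finset.card_range, Finset.prod_range_div']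

/-- When the two chords have the same sum, the factors depending only on XY and b cancel. The
dependence on Y is through u ↦ θ(b/u)/θ(u), which telescopes in products. -/
theorem chordValue_div (hq : ‖(q : K)‖ < 1) {X Y X' Y' b : Kˣ} (h : X * Y = X' * Y') :
    chordValue hq X Y b / chordValue hq X' Y' b =
      thetaUnit q (b / X) * thetaUnit q X' / (thetaUnit q X * thetaUnit q (b / X')) *
        ((thetaUnit q (b / Y) / thetaUnit q Y) / (thetaUnit q (b / Y') / thetaUnit q Y')) := by
  rw [chordValue, chordValue, h]
  generalize thetaUnit q (X' * Y') = s
  generalize thetaUnit q (b / (X' * Y')) = s'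
  generalize thetaUnit q b = s''
  apply Units.ext
  push_cast
  have n1 := (thetaUnit q X).ne_zero
  have n2 := (thetaUnit q Y).ne_zero
  have n3 := (thetaUnit q X').ne_zero
  have n4 := (thetaUnit q Y').ne_zero
  have n5 := s.ne_zero
  have n6 := s'.ne_zero
  have n7 := s''.ne_zero
  have n8 := (thetaUnit q (b / X)).ne_zero
  have n9 := (thetaUnit q (b / Y)).ne_zero
  have n10 := (thetaUnit q (b / X')).ne_zero
  have n11 := (thetaUnit q (b / Y')).ne_zero
  have n12 := (Units.mk0 _ (thetaReg_one_ne_zero hq)).ne_zero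
  generalize Units.mk0 _ (thetaReg_one_ne_zero hq) = κ at *
  field_simp

/-- A shift `x` for which all the products that occur are generic. -/
theorem exists_generic_shift (hq : ‖(q : K)‖ < 1) (a b c : Kˣ) (m : ℕ) :
    ∃ x : Kˣ, ∀ i j l : ℤ, i ∈ Finset.Icc (-1 : ℤ) (m + 1) → j ∈ Finset.Icc (-1 : ℤ) 1 →
      l ∈ Finset.Icc (-1 : ℤ) 1 → a ^ i * c ^ j * b ^ l * x ∉ Subgroup.zpowers q := by
  classical
  obtain ⟨x, hx⟩ := exists_generic_unit hq
    ((Finset.Icc (-1 : ℤ) (m + 1) ×ˢ Finset.Icc (-1 : ℤ) 1 ×ˢ Finset.Icc (-1 : ℤ) 1).image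
      fun p => a ^ p.1 * c ^ p.2.1 * b ^ p.2.2)
  refine ⟨x, fun i j l hi hj hl => generic_iff.1 (hx _ (Finset.mem_image.2 ⟨(i, j, l), ?_, rfl⟩))⟩
  rw [Finset.mem_product, Finset.mem_product]
  exact ⟨hi, hj, hl⟩

/-- The pairing of two points different from `O`. -/
theorem torsionPairing_of_notMem (hq : ‖(q : K)‖ < 1) {a b : Kˣ} (ha : a ∉ Subgroup.zpowers q)
    (hb : b ∉ Subgroup.zpowers q) {m : ℕ} (hm : 0 < m) {s : ℤ} (has : a ^ m = q ^ s) :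
    (curve q).torsionPairing (point q a) (point q b) = unitTmul (b ^ (-s)) m := by
  classical
  -- The multipliers c and, below, x keep all chords away from tangents and vertical lines, and keep
  -- b off the supports of the quotients `g i`.
  obtain ⟨c, hc⟩ := exists_generic_unit hq {1, a, a⁻¹, b⁻¹, b⁻¹ * a}
  simp only [generic_iff] at hc
  have hc1 : c ∉ Subgroup.zpowers q := by simpa using hc 1 (by simp)
  have hac := hc a (by simp)
  have hac' := hc a⁻¹ (by simp)
  have hbc : b / c ∉ Subgroup.zpowers q := by
    rw [← inv_mem_iff, inv_div, div_eq_inv_mul]; exact hc b⁻¹ (by simp)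
  have hbac : b / (a * c) ∉ Subgroup.zpowers q := by
    rw [← inv_mem_iff, inv_div, div_eq_inv_mul, ← mul_assoc]; exact hc (b⁻¹ * a) (by simp)
  obtain ⟨x, hx⟩ := exists_generic_shift hq a b c m
  have hx' (i j l : ℤ) (hi : -1 ≤ i ∧ i ≤ m + 1 := by omega) (hj : -1 ≤ j ∧ j ≤ 1 := by omega)
      (hl : -1 ≤ l ∧ l ≤ 1 := by omega) {u : Kˣ} (hu : u = a ^ i * c ^ j * b ^ l * x) :
      u ∉ Subgroup.zpowers q := by
    rw [hu]
    exact hx i j l (Finset.mem_Icc.2 hi) (Finset.mem_Icc.2 hj) (Finset.mem_Icc.2 hl)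
  have hxi (i j l : ℤ) (hi : -1 ≤ i ∧ i ≤ m + 1 := by omega) (hj : -1 ≤ j ∧ j ≤ 1 := by omega)
      (hl : -1 ≤ l ∧ l ≤ 1 := by omega) {u : Kˣ} (hu : u⁻¹ = a ^ i * c ^ j * b ^ l * x) :
      u ∉ Subgroup.zpowers q := by
    rw [← inv_mem_iff]
    exact hx' i j l hi hj hl hu
  obtain ⟨t, ht⟩ := exists_isParameter_closedPoint (point q b)
  have ht0 := isParameter_closedPoint_zero (W := curve q)
  have hQ := (closedPoint (curve q) (point q b)).containsConstants
  have hQ0 := (closedPoint (curve q) 0).containsConstants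
  -- the function with divisor `m ([a] - [O])`
  let g : ℕ → (curve q).FunctionFieldˣ := fun i =>
    chordFun q (a * c) (a ^ i * x) / chordFun q c (a ^ (i + 1) * x)
  -- `g i` has divisor [ac] - [c] + [aⁱx] - [aⁱ⁺¹x]. The last two terms telescope to zero over i < m
  -- because [a^m x] = [x]; the m-th power contributes m([a] + [c] - [ac] - [O]).
  let f : (curve q).FunctionFieldˣ := chordFun q a c ^ m * ∏ i ∈ Finset.range m, g i
  let φ : ℕ → Kˣ := fun i => thetaUnit q (b / (a ^ i * x)) / thetaUnit q (a ^ i * x)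
  let R : Kˣ := thetaUnit q (b / (a * c)) * thetaUnit q c / (thetaUnit q (a * c) * thetaUnit q (b / c))
  have hmul (i : ℕ) : a * c * (a ^ i * x) = c * (a ^ (i + 1) * x) := by rw [pow_succ]; ac_rfl
  have g1 (i : ℕ) (hi : i < m) : a ^ i * x ∉ Subgroup.zpowers q :=
    hx' i 0 0 (by omega) (hu := by simp)
  have g2 (i : ℕ) (hi : i < m) : a ^ (i + 1) * x ∉ Subgroup.zpowers q :=
    hx' (i + 1) 0 0 (by omega) (hu := by
      simp [zpow_add, pow_succ])
  have g3 (i : ℕ) (hi : i < m) : c * (a ^ (i + 1) * x) ∉ Subgroup.zpowers q :=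
    hx' (i + 1) 1 0 (by omega) (hu := by
      simp [zpow_add, pow_succ, mul_comm, mul_left_comm])
  have g4 (i : ℕ) (hi : i < m) : (a * c)⁻¹ * (a ^ i * x) ∉ Subgroup.zpowers q :=
    hx' (i - 1) (-1) 0 (by omega) (hu := by
      simp [zpow_sub, pow_succ, mul_comm, mul_assoc])
  have g5 (i : ℕ) (hi : i < m) : c⁻¹ * (a ^ (i + 1) * x) ∉ Subgroup.zpowers q :=
    hx' (i + 1) (-1) 0 (by omega) (hu := by
      simp [zpow_add, pow_succ, mul_comm, mul_left_comm, mul_assoc])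
  have g6 (i : ℕ) (hi : i < m) : b / (a ^ i * x) ∉ Subgroup.zpowers q :=
    hxi i 0 (-1) (by omega) (hu := by
      simp [pow_succ, div_eq_mul_inv, mul_comm, mul_assoc])
  have g7 (i : ℕ) (hi : i < m) : b / (a ^ (i + 1) * x) ∉ Subgroup.zpowers q :=
    hxi (i + 1) 0 (-1) (by omega) (hu := by
      simp [zpow_add, pow_succ, div_eq_mul_inv, mul_comm, mul_left_comm, mul_assoc])
  have g8 (i : ℕ) (hi : i < m) : b / (c * (a ^ (i + 1) * x)) ∉ Subgroup.zpowers q :=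
    hxi (i + 1) 1 (-1) (by omega) (hu := by
      simp [zpow_add, pow_succ, div_eq_mul_inv, mul_comm, mul_left_comm, mul_assoc])
  have g9 (i : ℕ) (hi : i < m) : b * (c * (a ^ (i + 1) * x)) ∉ Subgroup.zpowers q :=
    hx' (i + 1) 1 1 (by omega) (hu := by
      simp [zpow_add, pow_succ, mul_comm, mul_left_comm])
  have hlead : ∀ i ∈ Finset.range m, (closedPoint (curve q) (point q b)).ring.HasLead
      (t : (curve q).FunctionField) (g i) (0 - 0) (R * (φ i / φ (i + 1))) := by
    intro i hi
    have hi' := Finset.mem_range.1 hi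
    have l1 := hasLead_chordFun hq hac (g1 i hi') (by rw [hmul]; exact g3 i hi') (g4 i hi') hb hbac
      (g6 i hi') (by rw [hmul]; exact g8 i hi') (by rw [hmul]; exact g9 i hi') t
    have l2 := hasLead_chordFun hq hc1 (g2 i hi') (g3 i hi') (g5 i hi') hb hbc
      (g7 i hi') (g8 i hi') (g9 i hi') t
    have l3 := l1.div hQ l2 t.ne_zero
    rw [chordValue_div hq (hmul i)] at l3
    exact_mod_cast l3
  have hlead0 : ∀ i ∈ Finset.range m, (closedPoint (curve q) 0).ring.HasLead
      (FunctionField.t (curve q) : (curve q).FunctionField) (g i) (-1 - -1) (1 / 1 : Kˣ) := by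
    intro i _
    have l3 := (hasLead_chordFun_zero (q := q) (a * c) (a ^ i * x)).div hQ0
      (hasLead_chordFun_zero (q := q) c (a ^ (i + 1) * x)) (FunctionField.t (curve q)).ne_zero
    exact_mod_cast l3
  have hord (Q : CurvePoint K (curve q).FunctionField) : Q.ord f =
      m * (pointDivisor (curve q) (point q a) - pointDivisor (curve q) 0) Q := by
    have hgi : ∀ i ∈ Finset.range m, Q.ord (g i) = (pointDivisor (curve q) (point q (a * c)) Q -
        pointDivisor (curve q) (point q c) Q) + (pointDivisor (curve q) (point q (a ^ i * x)) Q -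
        pointDivisor (curve q) (point q (a ^ (i + 1) * x)) Q) := by
      intro i hi
      have hi' := Finset.mem_range.1 hi
      rw [Q.ord_div, ord_chordFun hq hac (g1 i hi') (by rw [hmul]; exact g3 i hi') (g4 i hi'),
        ord_chordFun hq hc1 (g2 i hi') (g3 i hi') (g5 i hi'), hmul]
      ring
    have hper : point q (a ^ m * x) = point q (a ^ 0 * x) := by
      rw [has, pow_zero, one_mul, point_zpow_mul]
    rw [Q.ord_mul, Q.ord_pow, Q.ord_prod, Finset.sum_congr rfl hgi, Finset.sum_add_distrib,
      Finset.sum_const, Finset.card_range,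
      Finset.sum_range_sub' (fun i => pointDivisor (curve q) (point q (a ^ i * x)) Q), hper,
      ord_chordFun hq ha hc1 hac hac', Finsupp.sub_apply, nsmul_eq_mul]
    ring
  -- This chord may have a zero or pole at b, for instance when b = a. Its leading coefficient
  -- enters only as an m-th power and need not be computed.
  obtain ⟨n₀, c₀, hc₀⟩ := ht.exists_lead (chordFun q a c)
  have L1 := (hc₀.pow hQ t.ne_zero m).mul hQ
    (ValuationSubring.HasLead.prod hQ t.ne_zero (Finset.range m) hlead) t.ne_zero
  have L0 := ((hasLead_chordFun_zero (q := q) a c).pow hQ0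
      (FunctionField.t (curve q)).ne_zero m).mul hQ0
    (ValuationSubring.HasLead.prod hQ0 (FunctionField.t (curve q)).ne_zero (Finset.range m) hlead0)
      (FunctionField.t (curve q)).ne_zero
  have hcoe : (f : (curve q).FunctionField) = (chordFun q a c : (curve q).FunctionField) ^ m *
      ∏ i ∈ Finset.range m, (g i : (curve q).FunctionField) := by
    rw [Units.val_mul, Units.val_pow_eq_pow_val, Units.coe_prod]
  rw [← hcoe] at L1 L0
  rw [torsionPairing, pointDivisor_eq (point q b), pointDivisor_eq 0]
  rw [pointDivisor_eq 0] at hord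
  rw [CurvePoint.divisorPairing_eq (FunctionField.exists_eq_algebraMap curve_a₁_ne_zero) ht ht0 hm
    hord L1 L0, prod_range_div_telescope]
  -- Since a^m x = q^s x, quasi-periodicity gives (q/b)^s for the telescoped quotient, and q^s = a^m
  -- is an m-th power.
  have hφ : φ 0 / φ m = a ^ m * b ^ (-s) := by
    have h1 : x ∉ Subgroup.zpowers q := hx' 0 0 0 (by omega) (hu := by simp)
    have h2 : b / x ∉ Subgroup.zpowers q :=
      hxi 0 0 (-1) (by omega) (hu := by simp [div_eq_mul_inv, mul_comm])
    simp only [φ]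
    rw [has, thetaUnit_quot_zpow_mul hq h1 h2, pow_zero, one_mul, div_mul_cancel_right, ← inv_zpow,
      inv_div, div_zpow, zpow_neg, div_eq_mul_inv]
  rw [hφ, div_self', one_pow, Finset.prod_const_one, one_mul, div_one, unitTmul_mul,
    unitTmul_pow_self _ hm, zero_add, unitTmul_mul, unitTmul_pow_self _ hm, zero_add, unitTmul_mul,
    unitTmul_pow_self _ hm, zero_add]

theorem zpow_injective (hq : ‖(q : K)‖ < 1) : Function.Injective fun n : ℤ => q ^ n := by
  intro i j hij
  have h1 := congrArg (fun u : Kˣ => ‖(u : K)‖) hij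
  simp only [Units.val_zpow_eq_zpow_val, norm_zpow] at h1
  exact zpow_right_injective₀ (norm_pos_iff.2 q.ne_zero) hq.ne h1

/-- The pairing on the Tate curve. -/
theorem torsionPairing_eq (hq : ‖(q : K)‖ < 1) {a b : Kˣ} {m : ℕ} (hm : 0 < m) {s t : ℤ}
    (ha : a ^ m = q ^ s) (hb : b ^ m = q ^ t) :
    (curve q).torsionPairing (point q a) (point q b) = unitTmul (a ^ (-t)) m ∧
      unitTmul (a ^ (-t)) m = unitTmul (b ^ (-s)) m ∧
      unitTmul (b ^ (-s)) m = unitTmul (q ^ (-(s * t))) (m ^ 2) := by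
  have key {a b : Kˣ} {s t : ℤ} (ha : a ^ m = q ^ s) :
      unitTmul (q ^ (-(s * t))) (m ^ 2) = unitTmul (a ^ (-t)) m := by
    rw [show -(s * t) = s * -t by ring, zpow_mul, ← ha, ← zpow_natCast a, ← zpow_mul,
      mul_comm (m : ℤ), zpow_mul, zpow_natCast, sq, unitTmul_pow_mul _ hm]
  -- For a ∈ q^ℤ the exponent s is a multiple of m, so the formula gives zero, as it must when one
  -- point is O.
  have hzero {a : Kˣ} {s : ℤ} (ha : a ^ m = q ^ s) (h : a ∈ Subgroup.zpowers q) (b : Kˣ) :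
      unitTmul (b ^ (-s)) m = 0 := by
    obtain ⟨j, rfl⟩ := h
    have : s = m * j := by
      apply zpow_injective hq
      simp only
      rw [← ha, mul_comm, zpow_mul, zpow_natCast]
    rw [this, ← mul_neg, unitTmul_zpow_mul_self _ hm]
  have e1 := key (b := b) (t := t) ha
  have e2 := key (b := a) (t := s) hb
  rw [mul_comm t s] at e2
  refine ⟨?_, e1.symm.trans e2, e2.symm⟩
  by_cases hbq : b ∈ Subgroup.zpowers q
  · rw [hzero hb hbq, torsionPairing, (point_eq_zero_iff hq).2 hbq, sub_self,
      divisorPairing_zero_right]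
  by_cases haq : a ∈ Subgroup.zpowers q
  · rw [← e1, e2, hzero ha haq, torsionPairing, (point_eq_zero_iff hq).2 haq, sub_self]
    exact divisorPairing_zero_left rfl
  · rw [torsionPairing_of_notMem hq haq hbq hm ha, ← e1, e2]

end TateCurve

/-! ### The kernel of `x ↦ x ⊗ (1/n)` -/

section UnitTmul

variable {K : Type*} [Field K]

/-- ℚ ⊗ A is the localization of A at the nonzero integers, so the kernel of A → ℚ ⊗ A is the
torsion of A. -/
theorem exists_nsmul_eq_zero_of_one_tmul_eq_zero {A : Type*} [AddCommGroup A] {x : A}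
    (hx : (1 : ℚ) ⊗ₜ[ℤ] x = 0) : ∃ d : ℕ, 0 < d ∧ d • x = 0 := by
  have h : IsLocalizedModule (nonZeroDivisors ℤ) (TensorProduct.mk ℤ ℚ A 1) := inferInstance
  obtain ⟨c, hc⟩ := (IsLocalizedModule.eq_zero_iff (nonZeroDivisors ℤ)
    (TensorProduct.mk ℤ ℚ A 1)).1 hx
  have hc0 : (c : ℤ) ≠ 0 := nonZeroDivisors.coe_ne_zero c
  refine ⟨(c : ℤ).natAbs, Int.natAbs_pos.2 hc0, ?_⟩
  have hc' : (c : ℤ) • x = 0 := hc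
  rcases Int.natAbs_eq (c : ℤ) with h | h <;> rw [h] at hc' <;> simpa using hc'

/-- Tensoring ℤ → ℚ → ℚ/ℤ is right exact, so x ⊗ 1/n = 0 means x ⊗ 1/n = c ⊗ 1 in K^× ⊗ ℚ. After
multiplication by n, x / cⁿ dies in K^× ⊗ ℚ, hence is torsion. -/
theorem exists_of_unitTmul_eq_zero {x : Kˣ} {n : ℕ} (hn : 0 < n) (hx : unitTmul x n = 0) :
    ∃ ζ c : Kˣ, IsOfFinOrder ζ ∧ x = ζ * c ^ n := by
  have hn' : (n : ℚ) ≠ 0 := by positivity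
  let i : ℤ →ₗ[ℤ] ℚ := (Int.castAddHom ℚ).toIntLinearMap
  let p : ℚ →ₗ[ℤ] QModZ := (QuotientAddGroup.mk' (AddSubgroup.zmultiples (1 : ℚ))).toIntLinearMap
  have hp : Function.Surjective p := QuotientAddGroup.mk'_surjective _
  have hex : Function.Exact i p := by
    intro y
    change (QuotientAddGroup.mk y : QModZ) = 0 ↔ _
    rw [QuotientAddGroup.eq_zero_iff, AddSubgroup.mem_zmultiples_iff]
    constructor
    · rintro ⟨j, rfl⟩
      exact ⟨j, by simp [i]⟩
    · rintro ⟨j, rfl⟩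
      exact ⟨j, by simp [i]⟩
  obtain ⟨z, hz⟩ := (lTensor_exact (Additive Kˣ) hex hp
    (Additive.ofMul x ⊗ₜ[ℤ] (1 / (n : ℚ)))).1 hx
  obtain ⟨c, rfl⟩ := (TensorProduct.rid ℤ (Additive Kˣ)).symm.surjective z
  rw [TensorProduct.rid_symm_apply, LinearMap.lTensor_tmul] at hz
  have h1 : (1 : ℚ) ⊗ₜ[ℤ] (Additive.ofMul x - n • c) = 0 := by
    have h2 := congrArg (fun w => n • TensorProduct.comm ℤ (Additive Kˣ) ℚ w) hz
    simp only [TensorProduct.comm_tmul] at h2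
    rw [TensorProduct.smul_tmul' n (1 / (n : ℚ)), nsmul_eq_mul, mul_one_div_cancel hn',
      ← TensorProduct.tmul_smul] at h2
    rw [TensorProduct.tmul_sub, ← h2]
    simp [i]
  obtain ⟨d, hd, hd'⟩ := exists_nsmul_eq_zero_of_one_tmul_eq_zero h1
  refine ⟨x / c.toMul ^ n, c.toMul, isOfFinOrder_iff_pow_eq_one.2 ⟨d, hd, ?_⟩, by simp⟩
  exact congrArg Additive.toMul hd'

end UnitTmul

namespace TateCurve

open WeierstrassCurve WeierstrassCurve.Affine

variable {K : Type*} [NontriviallyNormedField K] [CompleteSpace K] [IsUltrametricDist K] {q : Kˣ}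

/-! ### Torsion points -/

open Classical in
/-- The uniformization, as a homomorphism. -/
noncomputable def pointHom (hq : ‖(q : K)‖ < 1) : Additive Kˣ →+ (curve q).Point :=
  AddMonoidHom.mk' (fun a => point q a.toMul) fun a b => point_mul hq a.toMul b.toMul

open Classical in
theorem nsmul_point_eq_zero_iff (hq : ‖(q : K)‖ < 1) (m : ℕ) (a : Kˣ) :
    m • point q a = 0 ↔ ∃ s : ℤ, a ^ m = q ^ s := by
  have h : m • point q a = point q (a ^ m) :=
    (map_nsmul (pointHom hq) m (Additive.ofMul a)).symm
  rw [h, point_eq_zero_iff hq, Subgroup.mem_zpowers_iff]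
  exact exists_congr fun _ => eq_comm

theorem exists_zpow_of_point_eq (hq : ‖(q : K)‖ < 1) {a b : Kˣ} (h : point q a = point q b) :
    ∃ j : ℤ, a = q ^ j * b := by
  classical
  have h1 : point q (a / b) = 0 := by
    have := map_sub (pointHom hq) (Additive.ofMul a) (Additive.ofMul b)
    exact this.trans (sub_eq_zero.2 h)
  obtain ⟨j, hj⟩ := (point_eq_zero_iff hq).1 h1
  exact ⟨j, by simpa using (div_eq_iff_eq_mul.1 hj.symm)⟩

/-- Another parameter of the same point differs by a factor q^j, which changes s by jm. Powers of q
are distinct, so the class modulo m is unambiguous. -/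
theorem sIndex_point (hq : ‖(q : K)‖ < 1) {a : Kˣ} {m : ℕ} {s : ℤ} (ha : a ^ m = q ^ s) :
    sIndex q m (point q a) = (s : ZMod m) := by
  have hex : ∃ s : ℤ, ∃ b : Kˣ, point q b = point q a ∧ b ^ m = q ^ s := ⟨s, a, rfl, ha⟩
  rw [sIndex, dif_pos hex]
  obtain ⟨b, hb, hbs⟩ := hex.choose_spec
  obtain ⟨j, rfl⟩ := exists_zpow_of_point_eq hq hb
  have h : hex.choose = j * m + s := by
    apply zpow_injective hq
    simp only
    rw [← hbs, mul_pow, ha, zpow_add, zpow_mul, zpow_natCast]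
  rw [h]
  simp

open Classical in
theorem isOfFinAddOrder_point_iff (hq : ‖(q : K)‖ < 1) {a : Kˣ} :
    IsOfFinAddOrder (point q a) ↔ ∃ m : ℕ, 0 < m ∧ ∃ s : ℤ, a ^ m = q ^ s := by
  simp only [isOfFinAddOrder_iff_nsmul_eq_zero, nsmul_point_eq_zero_iff hq]

open Classical in
/-- The intrinsic subgroup of a Tate curve over a discretely valued field. -/
theorem intrinsicSubgroup_curve (hq : ‖(q : K)‖ < 1) (w : Additive Kˣ →+ ℤ)
    (hw : w (Additive.ofMul q) ≠ 0) :
    (curve q).intrinsicSubgroup = {P | ∃ ζ : Kˣ, IsOfFinOrder ζ ∧ P = point q ζ} := by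
  ext P
  obtain ⟨a, rfl⟩ := point_surjective hq P
  constructor
  · rintro ⟨hP, hpair⟩
    -- a generator of the group of values of the elements that give torsion points
    let M : AddSubgroup (Additive Kˣ) := (AddCommGroup.torsion (curve q).Point).comap (pointHom hq)
    have hM {b : Kˣ} : Additive.ofMul b ∈ M ↔ IsOfFinAddOrder (point q b) := Iff.rfl
    obtain ⟨v, hv⟩ := Int.subgroup_cyclic (M.map w)
    rw [← AddSubgroup.zmultiples_eq_closure] at hv
    obtain ⟨b, hb, hbv⟩ : v ∈ M.map w := by rw [hv]; exact AddSubgroup.mem_zmultiples v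
    have hgen {c : Kˣ} (hc : IsOfFinAddOrder (point q c)) : ∃ i : ℤ, w (Additive.ofMul c) = i * v := by
      have : w (Additive.ofMul c) ∈ M.map w := ⟨_, hM.2 hc, rfl⟩
      rw [hv] at this
      obtain ⟨i, hi⟩ := this
      exact ⟨i, by rw [← hi]; simp⟩
    have hv0 : v ≠ 0 := by
      rintro rfl
      obtain ⟨i, hi⟩ := hgen ((isOfFinAddOrder_point_iff hq).2 ⟨1, one_pos, 1, by simp⟩ :
        IsOfFinAddOrder (point q q))
      exact hw (by rw [hi, mul_zero])
    have hb' : IsOfFinAddOrder (point q b.toMul) := hM.1 hb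
    obtain ⟨m₁, hm₁, s₁, hs₁⟩ := (isOfFinAddOrder_point_iff hq).1 hP
    obtain ⟨m₂, hm₂, t₂, ht₂⟩ := (isOfFinAddOrder_point_iff hq).1 hb'
    -- Pass to a common exponent for a and b.
    have hm : 0 < m₁ * m₂ := Nat.mul_pos hm₁ hm₂
    have hs : a ^ (m₁ * m₂) = q ^ (s₁ * m₂) := by rw [pow_mul, hs₁, zpow_mul, zpow_natCast]
    have ht : b.toMul ^ (m₁ * m₂) = q ^ (t₂ * m₁) := by
      rw [mul_comm, pow_mul, ht₂, zpow_mul, zpow_natCast]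
    generalize m₁ * m₂ = m at *
    generalize s₁ * m₂ = s at *
    generalize t₂ * m₁ = t at *
    obtain ⟨h1, h2, -⟩ := torsionPairing_eq hq hm hs ht
    have h3 : unitTmul (b.toMul ^ (-s)) m = 0 := by
      rw [← h2, ← h1]
      exact hpair _ hb'
    obtain ⟨ζ, c, hζ, hc⟩ := exists_of_unitTmul_eq_zero hm h3
    obtain ⟨d, hd, hζd⟩ := isOfFinOrder_iff_pow_eq_one.1 hζ
    -- A power of c is a power of b, so c is again the parameter of a torsion point and its
    -- valuation is a multiple of v.
    have hcf : IsOfFinAddOrder (point q c) := by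
      refine (isOfFinAddOrder_point_iff hq).2 ⟨m * d * m, by positivity, -s * d * t, ?_⟩
      have h4 : c ^ (m * d) = b.toMul ^ (-s * d) := by
        rw [zpow_mul, zpow_natCast, hc, mul_pow, hζd, one_mul, pow_mul]
      rw [pow_mul, h4, ← zpow_natCast, ← zpow_mul, mul_comm, zpow_mul, zpow_natCast, ht, ← zpow_mul,
        mul_comm]
    obtain ⟨i, hi⟩ := hgen hcf
    have hζ0 : w (Additive.ofMul ζ) = 0 := by
      have := congrArg (fun x => w (Additive.ofMul x)) hζd
      simpa [hd.ne'] using this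
    -- Take valuations in b^(-s) = ζ c^m; roots of unity have valuation zero, and v ≠ 0 can be
    -- cancelled.
    have h5 : -s = m * i := by
      have := congrArg (fun x => w (Additive.ofMul x)) hc
      simp only [ofMul_mul, ofMul_zpow, ofMul_pow, map_add, map_zsmul, map_nsmul, hζ0, zero_add, hi,
        ofMul_toMul, hbv, smul_eq_mul, nsmul_eq_mul] at this
      rw [← mul_assoc] at this
      exact mul_right_cancel₀ hv0 this
    refine ⟨q ^ i * a, isOfFinOrder_iff_pow_eq_one.2 ⟨m, hm, ?_⟩, (point_zpow_mul a i).symm⟩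
    rw [mul_pow, hs, ← zpow_natCast, ← zpow_mul, ← zpow_add, mul_comm i, ← h5, neg_add_cancel,
      zpow_zero]
  · rintro ⟨ζ, hζ, h⟩
    rw [h]
    obtain ⟨d, hd, hζd⟩ := isOfFinOrder_iff_pow_eq_one.1 hζ
    refine ⟨(isOfFinAddOrder_point_iff hq).2 ⟨d, hd, 0, by rw [hζd, zpow_zero]⟩, fun Q hQ => ?_⟩
    obtain ⟨b, rfl⟩ := point_surjective hq Q
    obtain ⟨m, hm, t, ht⟩ := (isOfFinAddOrder_point_iff hq).1 hQ
    have hs : ζ ^ (d * m) = q ^ (0 : ℤ) := by rw [pow_mul, hζd, one_pow, zpow_zero]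
    have ht' : b ^ (d * m) = q ^ (t * d) := by rw [mul_comm, pow_mul, ht, zpow_mul, zpow_natCast]
    obtain ⟨h1, h2, -⟩ := torsionPairing_eq hq (Nat.mul_pos hd hm) hs ht'
    rw [h1, h2, neg_zero, zpow_zero, unitTmul_one]

/-- The pairing in terms of arbitrary representatives of the classes `s_m`. -/
theorem torsionPairing_eq_of_sIndex (hq : ‖(q : K)‖ < 1) {a b : Kˣ} {m : ℕ} (hm : 0 < m) {s t : ℤ}
    (ha : ∃ s : ℤ, a ^ m = q ^ s) (hb : ∃ t : ℤ, b ^ m = q ^ t)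
    (hs : (s : ZMod m) = sIndex q m (point q a)) (ht : (t : ZMod m) = sIndex q m (point q b)) :
    (curve q).torsionPairing (point q a) (point q b) = unitTmul (a ^ (-t)) m ∧
      unitTmul (a ^ (-t)) m = unitTmul (b ^ (-s)) m ∧
      unitTmul (b ^ (-s)) m = unitTmul (q ^ (-(s * t))) (m ^ 2) := by
  obtain ⟨s₀, hs₀⟩ := ha
  obtain ⟨t₀, ht₀⟩ := hb
  rw [sIndex_point hq hs₀, eq_comm, ZMod.intCast_eq_intCast_iff, Int.modEq_iff_dvd] at hs
  rw [sIndex_point hq ht₀, eq_comm, ZMod.intCast_eq_intCast_iff, Int.modEq_iff_dvd] at ht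
  obtain ⟨i, hi⟩ := hs
  obtain ⟨j, hj⟩ := ht
  obtain rfl : s = m * i + s₀ := by omega
  obtain rfl : t = m * j + t₀ := by omega
  -- Another representative of s_m([a]) arises from replacing a by qⁱa, which leaves the point
  -- unchanged. This settles the term q^(-st) ⊗ 1/m².
  have shift {a : Kˣ} {s₀ : ℤ} (h : a ^ m = q ^ s₀) (i : ℤ) :
      (q ^ i * a) ^ m = q ^ (m * i + s₀) := by
    rw [mul_pow, h, zpow_add, mul_comm (m : ℤ), zpow_mul, zpow_natCast]
  have move {x : Kˣ} {t₀ : ℤ} (j : ℤ) :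
      unitTmul (x ^ (-(m * j + t₀))) m = unitTmul (x ^ (-t₀)) m := by
    rw [neg_add, zpow_add, unitTmul_mul, ← mul_neg, unitTmul_zpow_mul_self _ hm, zero_add]
  obtain ⟨e1, e2, -⟩ := torsionPairing_eq hq hm hs₀ ht₀
  obtain ⟨e3, e4, e5⟩ := torsionPairing_eq hq hm (shift hs₀ i) (shift ht₀ j)
  rw [point_zpow_mul, point_zpow_mul] at e3
  rw [move, move]
  exact ⟨e1, e2, by rw [← e5, ← e4, ← e3, e1, e2]⟩

end TateCurve

/-! ### The theorem over a complete discretely valued field -/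

theorem mainTheorem11 {k : Type*} [Field k] [DecidableEq k] [Valued k ℤᵐ⁰] [CompleteSpace k]
    (hv : Function.Surjective (Valued.v : k → ℤᵐ⁰))
    (q : kˣ) (hq : Valued.v (q : k) < 1) :
    (∀ m : ℕ, 0 < m → ∀ a : kˣ, m • TateCurve.point q a = 0 →
      ∃ s : ℤ, a ^ m = q ^ s ∧ TateCurve.sIndex q m (TateCurve.point q a) = (s : ZMod m)) ∧
    (∀ m : ℕ, 0 < m → ∀ a b : kˣ,
      m • TateCurve.point q a = 0 → m • TateCurve.point q b = 0 →
      ∀ s t : ℤ, (s : ZMod m) = TateCurve.sIndex q m (TateCurve.point q a) →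
        (t : ZMod m) = TateCurve.sIndex q m (TateCurve.point q b) →
        (TateCurve.curve q).torsionPairing (TateCurve.point q a) (TateCurve.point q b) =
            unitTmul (a ^ (-t)) m ∧
        unitTmul (a ^ (-t)) m = unitTmul (b ^ (-s)) m ∧
        unitTmul (b ^ (-s)) m = unitTmul (q ^ (-(s * t))) (m ^ 2)) ∧
    (TateCurve.curve q).intrinsicSubgroup =
      {P | ∃ ζ : kˣ, IsOfFinOrder ζ ∧ P = TateCurve.point q ζ} := by
  rename_i dec _ _
  obtain rfl : dec = fun a b => Classical.propDecidable (a = b) := Subsingleton.elim _ _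
  have hnt : (Valued.v : Valuation k ℤᵐ⁰).IsNontrivial := by
    obtain ⟨x, hx⟩ := hv (WithZero.exp 1)
    exact ⟨x, by simp [hx], by rw [hx, ← WithZero.exp_zero]; simp⟩
  -- A rank one embedding of the value group turns the valuation into an ultrametric norm inducing
  -- the given topology, so the series of the statement are those of the analytic part.
  obtain ⟨hr⟩ := (Valuation.nonempty_rankOne_iff_mulArchimedean
    (v := (Valued.v : Valuation k ℤᵐ⁰))).2 inferInstance
  let _ : NontriviallyNormedField k := Valued.toNontriviallyNormedField k ℤᵐ⁰
  have _ : IsUltrametricDist k := Valued.instIsUltrametricDist k ℤᵐ⁰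
  have hq' : ‖(q : k)‖ < 1 := Valued.toNormedField.norm_lt_one_iff.2 hq
  -- The additive valuation, up to sign; only its being integer valued and nonzero at q matters.
  let w : Additive kˣ →+ ℤ := AddMonoidHom.mk'
    (fun a => WithZero.log (Valued.v ((a.toMul : kˣ) : k))) fun a b => by
      rw [toMul_add, Units.val_mul, map_mul, WithZero.log_mul] <;> simp
  have hw : w (Additive.ofMul q) ≠ 0 := by
    have h0 : Valued.v (q : k) ≠ 0 := by simp
    intro h
    have h1 : WithZero.log (Valued.v (q : k)) = 0 := h
    rw [← WithZero.exp_log h0, h1, WithZero.exp_zero] at hq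
    exact lt_irrefl _ hq
  refine ⟨fun m hm a ha => ?_, fun m hm a b ha hb s t hs ht => ?_, ?_⟩
  · obtain ⟨s, hs⟩ := (TateCurve.nsmul_point_eq_zero_iff hq' m a).1 ha
    exact ⟨s, hs, TateCurve.sIndex_point hq' hs⟩
  · exact TateCurve.torsionPairing_eq_of_sIndex hq' hm
      ((TateCurve.nsmul_point_eq_zero_iff hq' m a).1 ha)
      ((TateCurve.nsmul_point_eq_zero_iff hq' m b).1 hb) hs ht
  · exact TateCurve.intrinsicSubgroup_curve hq' w hw
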